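/- Let $\mathbb K$ be a field of characteristic zero, $\mathcal O$ a commutative unital $\mathbb K$-algebra, and $(\mathcal A,[\cdot,\cdot]_{\mathcal A},\rho_{\mathcal A})$ a Lie--Rinehart algebra over $\mathcal O$. A (negatively graded) Lie $\infty$-algebroid over $\mathcal O$ is a collection $\mathcal E=(\mathcal E_i)_{i\le -1}$ of projective $\mathcal O$-modules with graded symmetric $\mathbb K$-multilinear brackets $\ell_k$ of arity $k\ge 1$ and degree $+1$, and an $\mathcal O$-linear anchor $\rho_{\mathcal E}\colon\mathcal E_{-1}\to\mathrm{Der}(\mathcal O)$ (extended by zero to $\mathcal E_{i}$, $i\le -2$), such that: the higher Jacobi identities $\sum_{i=1}^n\sum_{\sigma\in\mathfrak S_{i,n-i}}\epsilon(\sigma)\,\ell_{n-i+1}(\ell_i(x_{\sigma(1)},\dots,x_{\sigma(i)}),x_{\sigma(i+1)},\dots,x_{\sigma(n)})=0$ hold for all $n\ge1$ and homogeneous $x_1,\dots,x_n$ ($\mathfrak S_{i,n-i}$ the $(i,n-i)$-shuffles, $\epsilon$ the Koszul sign); $\ell_k$ is $\mathcal O$-multilinear for $k\ne 2$; $\ell_2(x,fy)=\rho_{\mathcal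 E}(x)[f]\,y+f\ell_2(x,y)$; $\rho_{\mathcal E}\circ\ell_1=0$ on $\mathcal E_{-2}$; and $\rho_{\mathcal E}(\ell_2(x,y))=[\rho_{\mathcal E}(x),\rho_{\mathcal E}(y)]$ on $\mathcal E_{-1}$. It terminates in $\mathcal A$ through a hook $\pi$ if $\pi\colon\mathcal E_{-1}\to\mathcal A$ is $\mathcal O$-linear with $\rho_{\mathcal A}\circ\pi=\rho_{\mathcal E}$, $\pi(\ell_2(x,y))=[\pi(x),\pi(y)]_{\mathcal A}$ for $x,y\in\mathcal E_{-1}$, and $\pi\circ\ell_1=0$ on $\mathcal E_{-2}$. It is universal for $\mathcal A$ if, moreover, $\cdots\xrightarrow{\ell_1}\mathcal E_{-2}\xrightarrow{\ell_1}\mathcal E_{-1}\xrightarrow{\pi}\mathcal A\to0$ is exact, i.e. a projective resolution of $\mathcal A$. A morphism of Lie $\infty$-algebroids $\mathcal E'\to\mathcal E$ is a co-algebra morphism $\Phi\colon S^\bullet_{\mathbb K}(\mathcal E')\to S^\bullet_{\mathbb K}(\mathcal E)$ commuting with the co-derivations defined by the brackets, with $\mathcal O$-multilinear Taylor coefficients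 $\Phi^{(n)}\colon S^{n+1}_{\mathbb K}(\mathcal E')\to\mathcal E$, $n\ge 0$, and with $\rho_{\mathcal E}\circ\Phi^{(0)}=\rho_{\mathcal E'}$ on $\mathcal E'_{-1}$; it is over $\mathcal A$ if $\pi\circ\Phi^{(0)}=\pi'$. **Proposition.** Let $(\mathcal E',(\ell'_k)_{k\ge1},\rho_{\mathcal E'})$ be a Lie $\infty$-algebroid over $\mathcal O$ that terminates in $\mathcal A$ through a hook $\pi'$. Then there exist a Lie $\infty$-algebroid $(\mathcal E,(\ell_k)_{k\ge1},\rho_{\mathcal E})$ that is universal for $\mathcal A$ through a hook $\pi$, and an injective degree-preserving $\mathcal O$-linear map $\iota\colon\mathcal E'\hookrightarrow\mathcal E$, such that 1. $\iota$ makes $(\mathcal E',\ell_1',\pi')$ a subcomplex of $(\mathcal E,\ell_1,\pi)$, that is, $\iota\circ\ell_1'=\ell_1\circ\iota$ and $\pi\circ\iota=\pi'$, and $\iota(\mathcal E')$ is a direct summand of the graded $\mathcal O$-module $\mathcal E$: for every $i\le -1$ there is a submodule $\mathcal V_i\subset\mathcal E_i$ with $\mathcal E_i=\iota(\mathcal E'_i)\oplus\mathcal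 V_i$; 2. the inclusion is a strict morphism: there is a Lie $\infty$-algebroid morphism $\Phi\colon\mathcal E'\to\mathcal E$ over $\mathcal A$ with $\Phi^{(0)}=\iota$ and $\Phi^{(n)}=0$ for all $n\ge1$. -/

import Mathlib

universe u v w

/-- The Koszul sign of the rearrangement of a list of homogeneous elements `x 0, …, x (n-1)`, of
degrees `d 0, …, d (n-1)`, which sorts it by the key `c` (elements with the same key keep their
order): a factor `(-1) ^ (d p * d q)` for every pair `p < q` whose order gets exchanged.
For a permutation `σ` the rearranged list `x (σ 0), …, x (σ (n-1))` is the one with key `σ⁻¹`. -/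
def koszulSign {n : ℕ} {κ : Type*} [LinearOrder κ] (d : Fin n → ℤ) (c : Fin n → κ) : ℤ :=
  ∏ p : Fin n × Fin n,
    if p.1 < p.2 ∧ c p.2 < c p.1 then ((d p.1 * d p.2).negOnePow : ℤ) else 1

/-- The list `x_J = (x j₁, …, x jᵣ)`, for `J = {j₁ < … < jᵣ}`. -/
def sublist {n : ℕ} {M : Type*} (x : Fin n → M) (J : Finset (Fin n)) : Fin J.card → M :=
  fun a => x (J.orderEmbOfFin rfl a)

/-- The key of the `(i, n - i)`-shuffle that moves the elements of `I` (with `|I| = i`) to the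
front, and keeps the order inside `I` and inside its complement. -/
def shuffleKey {n : ℕ} (I : Finset (Fin n)) : Fin n → ℕ :=
  fun j => if j ∈ I then 0 else 1

/-- The (unordered) partitions of `{0, …, n-1}` into `k` non-empty blocks. A partition is encoded by
the map `c` that sends an element to the number of its block, where the blocks are numbered
`0, …, k-1` in the order of their least elements. -/
def setPartitions (n k : ℕ) : Finset (Fin n → Fin k) :=
  {c | Function.Surjective c ∧ ∀ j, ∀ b < c j, ∃ i < j, c i = b}

/-- The block with number `b` of the partition `c`. -/
def block {n k : ℕ} (c : Fin n → Fin k) (b : Fin k) : Finset (Fin n) :=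
  {j | c j = b}

/-- A (negatively graded) Lie `∞`-algebroid over the commutative `K`-algebra `O`, on the graded
`O`-module `M = ⨁_{i ≤ -1} deg i`. The bracket of arity `n` is given as a graded symmetric
`K`-multilinear map of degree `+1` on `M`. The anchor is extended by zero to `deg i`, `i ≠ -1`. -/
structure LieInftyAlgebroid (K O M : Type*) [Field K] [CommRing O] [Algebra K O]
    [AddCommGroup M] [Module K M] [Module O M] [IsScalarTower K O M] where
  /-- the component of degree `i` -/
  deg : ℤ → Submodule O M
  isInternal : DirectSum.IsInternal deg
  deg_eq_bot : ∀ i, 0 ≤ i → deg i = ⊥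
  projective : ∀ i, Module.Projective O (deg i)
  /-- the bracket `ℓ_n` of arity `n ≥ 1` -/
  bracket (n : ℕ) : MultilinearMap K (fun _ : Fin n => M) M
  /-- there is no bracket of arity `0` -/
  bracket_zero : bracket 0 = 0
  bracket_mem_deg : ∀ (n : ℕ) (d : Fin n → ℤ) (x : Fin n → M), (∀ a, x a ∈ deg (d a)) →
    bracket n x ∈ deg (∑ a, d a + 1)
  bracket_symm : ∀ (n : ℕ) (d : Fin n → ℤ) (x : Fin n → M), (∀ a, x a ∈ deg (d a)) →
    ∀ σ : Equiv.Perm (Fin n), bracket n (x ∘ σ) = koszulSign d σ.symm • bracket n x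
  /-- the anchor map -/
  anchor : M →ₗ[O] Derivation K O O
  anchor_eq_zero : ∀ i, i ≠ -1 → ∀ x ∈ deg i, anchor x = 0
  /-- the higher Jacobi identity: the sum of
  `ε ℓ_{n-i+1} (ℓ_i (x_{σ(1)}, …, x_{σ(i)}), x_{σ(i+1)}, …, x_{σ(n)})` over all `i ≥ 1` and all
  `(i, n-i)`-shuffles `σ`, each of which is encoded by the set `I = {σ(1), …, σ(i)}` -/
  jacobi : ∀ (n : ℕ) (d : Fin n → ℤ) (x : Fin n → M), (∀ a, x a ∈ deg (d a)) →
    ∑ I : Finset (Fin n) with I.Nonempty, koszulSign d (shuffleKey I) •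
      bracket (Iᶜ.card + 1)
        (Fin.cons (bracket I.card (sublist x I)) (sublist x Iᶜ) : Fin (Iᶜ.card + 1) → M) = 0
  bracket_smul : ∀ (n : ℕ), n ≠ 2 → ∀ (x : Fin n → M) (a : Fin n) (f : O),
    bracket n (Function.update x a (f • x a)) = f • bracket n x
  leibniz : ∀ (x y : M) (f : O),
    bracket 2 ![x, f • y] = anchor x f • y + f • bracket 2 ![x, y]
  anchor_differential : ∀ x ∈ deg (-2), anchor (bracket 1 ![x]) = 0
  anchor_bracket : ∀ x ∈ deg (-1), ∀ y ∈ deg (-1),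
    anchor (bracket 2 ![x, y]) = ⁅anchor x, anchor y⁆

namespace LieInftyAlgebroid

/-- The linear map `π : deg (-1) → A` (extended by zero to `deg i`, `i ≠ -1`) is a hook through
which the Lie `∞`-algebroid `E` terminates at the Lie–Rinehart algebra `A`: it is compatible with
the anchors and the binary brackets, and `… → deg (-2) → deg (-1) → A` is a complex. -/
structure IsHook {K O M A : Type*} [Field K] [CommRing O] [Algebra K O]
    [AddCommGroup M] [Module K M] [Module O M] [IsScalarTower K O M]
    [LieRing A] [LieAlgebra K A] [Module O A] [LieRingModule A O] [LieRinehartRing O A]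
    [LieRinehartAlgebra K O A]
    (E : LieInftyAlgebroid K O M) (π : M →ₗ[O] A) : Prop where
  eq_zero : ∀ i, i ≠ -1 → ∀ x ∈ E.deg i, π x = 0
  anchor_hook : ∀ x ∈ E.deg (-1), LieRinehartAlgebra.anchor K O A (π x) = E.anchor x
  hook_bracket : ∀ x ∈ E.deg (-1), ∀ y ∈ E.deg (-1), π (E.bracket 2 ![x, y]) = ⁅π x, π y⁆
  hook_differential : ∀ x ∈ E.deg (-2), π (E.bracket 1 ![x]) = 0

/-- `E` is universal for `A` through the hook `π`: the complex
`… → deg (-3) → deg (-2) → deg (-1) → A → 0` is a (projective) resolution of `A`. -/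
structure IsUniversal {K O M A : Type*} [Field K] [CommRing O] [Algebra K O]
    [AddCommGroup M] [Module K M] [Module O M] [IsScalarTower K O M]
    [LieRing A] [LieAlgebra K A] [Module O A] [LieRingModule A O] [LieRinehartRing O A]
    [LieRinehartAlgebra K O A]
    (E : LieInftyAlgebroid K O M) (π : M →ₗ[O] A) : Prop where
  isHook : E.IsHook π
  surjective : ∀ a : A, ∃ x ∈ E.deg (-1), π x = a
  exact_hook : ∀ x ∈ E.deg (-1), π x = 0 → ∃ y ∈ E.deg (-2), E.bracket 1 ![y] = x
  exact_differential : ∀ i, i ≤ -2 → ∀ x ∈ E.deg i, E.bracket 1 ![x] = 0 →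
    ∃ y ∈ E.deg (i - 1), E.bracket 1 ![y] = x

/-- A morphism of Lie `∞`-algebroids, i.e. an `O`-multilinear co-algebra morphism
`Φ : S_K(E') → S_K(E)` with `Φ ∘ Q' = Q ∘ Φ` that is compatible with the anchors. It is given by its
Taylor coefficients, i.e. its components `S_K^n(E') → E`, for arities `n ≥ 1`. -/
structure Morphism {K O M' M : Type*} [Field K] [CommRing O] [Algebra K O]
    [AddCommGroup M'] [Module K M'] [Module O M'] [IsScalarTower K O M']
    [AddCommGroup M] [Module K M] [Module O M] [IsScalarTower K O M]
    (E' : LieInftyAlgebroid K O M') (E : LieInftyAlgebroid K O M) where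
  /-- the Taylor coefficient with `n` arguments -/
  taylor (n : ℕ) : MultilinearMap O (fun _ : Fin n => M') M
  taylor_zero : taylor 0 = 0
  taylor_mem_deg : ∀ (n : ℕ) (d : Fin n → ℤ) (x : Fin n → M'), (∀ a, x a ∈ E'.deg (d a)) →
    taylor n x ∈ E.deg (∑ a, d a)
  taylor_symm : ∀ (n : ℕ) (d : Fin n → ℤ) (x : Fin n → M'), (∀ a, x a ∈ E'.deg (d a)) →
    ∀ σ : Equiv.Perm (Fin n), taylor n (x ∘ σ) = koszulSign d σ.symm • taylor n x
  /-- `Φ ∘ Q' = Q ∘ Φ`, in Taylor coefficients: on the left a sum over shuffles, on the right a sum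
  over the partitions of the set of arguments into `k ≥ 1` blocks -/
  map_brackets : ∀ (n : ℕ) (d : Fin n → ℤ) (x : Fin n → M'), (∀ a, x a ∈ E'.deg (d a)) →
    ∑ I : Finset (Fin n) with I.Nonempty, koszulSign d (shuffleKey I) •
      taylor (Iᶜ.card + 1)
        (Fin.cons (E'.bracket I.card (sublist x I)) (sublist x Iᶜ) : Fin (Iᶜ.card + 1) → M') =
    ∑ k ∈ Finset.Icc 1 n, ∑ c ∈ setPartitions n k, koszulSign d c •
      E.bracket k (fun b => taylor (block c b).card (sublist x (block c b)))
  anchor_comp : ∀ x ∈ E'.deg (-1), E.anchor (taylor 1 ![x]) = E'.anchor x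

/-- The morphism `Φ` is over `A`, for given hooks `π'` and `π`: `π ∘ Φ⁽⁰⁾ = π'`. -/
def Morphism.IsOver {K O M' M A : Type*} [Field K] [CommRing O] [Algebra K O]
    [AddCommGroup M'] [Module K M'] [Module O M'] [IsScalarTower K O M']
    [AddCommGroup M] [Module K M] [Module O M] [IsScalarTower K O M]
    [AddCommGroup A] [Module O A]
    {E' : LieInftyAlgebroid K O M'} {E : LieInftyAlgebroid K O M} (Φ : Morphism E' E)
    (π' : M' →ₗ[O] A) (π : M →ₗ[O] A) : Prop :=
  ∀ x ∈ E'.deg (-1), π (Φ.taylor 1 ![x]) = π' x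

/-- The only non-vanishing Taylor coefficient of `Φ` is the linear one, and it equals `ι`. -/
def Morphism.IsStrict {K O M' M : Type*} [Field K] [CommRing O] [Algebra K O]
    [AddCommGroup M'] [Module K M'] [Module O M'] [IsScalarTower K O M']
    [AddCommGroup M] [Module K M] [Module O M] [IsScalarTower K O M]
    {E' : LieInftyAlgebroid K O M'} {E : LieInftyAlgebroid K O M} (Φ : Morphism E' E)
    (ι : M' →ₗ[O] M) : Prop :=
  (∀ x, Φ.taylor 1 ![x] = ι x) ∧ ∀ n, n ≠ 1 → Φ.taylor n = 0

/-- `ι` identifies the complex `… → E'_{-2} → E'_{-1} → A` with a subcomplex of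
`… → E_{-2} → E_{-1} → A`. -/
structure IsSubcomplexInclusion {K O M' M A : Type*} [Field K] [CommRing O] [Algebra K O]
    [AddCommGroup M'] [Module K M'] [Module O M'] [IsScalarTower K O M']
    [AddCommGroup M] [Module K M] [Module O M] [IsScalarTower K O M]
    [AddCommGroup A] [Module O A]
    (E' : LieInftyAlgebroid K O M') (π' : M' →ₗ[O] A)
    (E : LieInftyAlgebroid K O M) (π : M →ₗ[O] A) (ι : M' →ₗ[O] M) : Prop where
  injective : Function.Injective ι
  map_deg : ∀ i, ∀ x ∈ E'.deg i, ι x ∈ E.deg i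
  map_differential : ∀ x, ι (E'.bracket 1 ![x]) = E.bracket 1 ![ι x]
  hook_comp : ∀ x, π (ι x) = π' x

/-- The image of the graded module `E'` under `ι` is a direct summand of the graded `O`-module `E`:
`E_i = ι(E'_i) ⊕ V_i` for all `i`. -/
def IsGradedDirectSummand {K O M' M : Type*} [Field K] [CommRing O] [Algebra K O]
    [AddCommGroup M'] [Module K M'] [Module O M'] [IsScalarTower K O M']
    [AddCommGroup M] [Module K M] [Module O M] [IsScalarTower K O M]
    (E' : LieInftyAlgebroid K O M') (E : LieInftyAlgebroid K O M) (ι : M' →ₗ[O] M) : Prop :=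
  ∃ V : ℤ → Submodule O M, ∀ i,
    (E'.deg i).map ι ⊓ V i = ⊥ ∧ (E'.deg i).map ι ⊔ V i = E.deg i

end LieInftyAlgebroid

/-!
The complex `… → E'_{-2} → E'_{-1} → A` is enlarged to a projective resolution of `A` by adding free
generators degree by degree, and the brackets of `E'` are extended to this resolution by obstruction
theory.

*Resolution* (`exists_resolution`). In degree `-1`, the free module on the set `A` is added, and
afterwards the free module on the kernel of the previous differential. The new graded module is
`E = E' ⊕ F` with `F` free, so `E'` is a direct summand, and `E` has a homogeneous dual basis
(`exists_gradedDualBasis`) that respects the summand `E'`.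

*Initial brackets* (`isPartialBracket_extBracket`). The anchor on `E` has to be the one that is
induced by `A`. The dual basis provides covariant derivatives along derivations of `O`, and hence a
graded symmetric binary bracket that satisfies the Leibniz rule (`leibnizBracket`). Subtracting the
restrictions to `E'` and adding the given brackets of `E'` yields brackets on `E` that restrict to
those of `E'`, and have the differential of the resolution as their unary part. From then on,
brackets are changed by `O`-multilinear corrections only.

*Corrections* (`IsPartialBracket.exists_correction`). The failure of the hook to preserve the binary
bracket is `O`-bilinear, and is lifted through the surjection onto `A`. After that, the Jacobiator
is `O`-multilinear (`IsAnchoredBracket.jac_smul_cons`) and is annihilated by the hook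
(`IsPartialBracket.hook_jac`). The induction runs over the total degree `-t` of the arguments: since
all arguments have negative degree, the Jacobiator in total degree `-t` involves only brackets of
total degree `≥ -t`, and if it vanishes in total degrees `> -t`, then by the Bianchi identity
(`IsGradedBracket.bianchi`) it takes values in the cycles. By exactness it can be lifted through the
differential. In characteristic zero the lift on generators can be made graded symmetric by
averaging (`GradedDualBasis.exists_symm_lift`), and it vanishes where the Jacobiator does, in
particular on `E'`. Adding the lift of minus the Jacobiator removes it in this total degree
(`IsPartialBracket.exists_approximation_succ`), and in the limit everywhere. As the brackets of
elements of `E'` are never changed, the inclusion commutes with all brackets, and is a strict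
morphism (`LieInftyAlgebroid.exists_strict_morphism`).

Families of brackets of all arities are treated as single functions on lists, and sums over shuffles
as the recursively defined `splitSum`, for which coassociativity and cocommutativity are proved
by induction on the list.
-/

/-! ### Signs and sums over splittings of a list -/

/-- The sign `(-1) ^ n`, as an integer. -/
def esign (n : ℤ) : ℤ := (n.negOnePow : ℤ)

theorem esign_add (m n : ℤ) : esign (m + n) = esign m * esign n := by
  simp [esign, Int.negOnePow_add]

theorem esign_eq_of_even {m n : ℤ} (h : Even (m - n)) : esign m = esign n := by
  simp only [esign, (Int.negOnePow_eq_iff m n).2 h]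

theorem esign_zero : esign 0 = 1 := by simp [esign]

theorem esign_one : esign 1 = -1 := by simp [esign]

theorem esign_mul_self (n : ℤ) : esign n * esign n = 1 := by
  rw [← esign_add, ← esign_zero]
  exact esign_eq_of_even ⟨n, by ring⟩

theorem esign_succ (n : ℤ) : esign (n + 1) = -esign n := by
  rw [esign_add, esign_one, mul_neg_one]

theorem esign_neg (n : ℤ) : esign (-n) = esign n := esign_eq_of_even ⟨-n, by ring⟩

section SplitSum

variable {α : Type*} {N : Type*} [AddCommGroup N]

/-- The total weight of a list. -/
def wt (w : α → ℤ) (l : List α) : ℤ := (l.map w).sum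

@[simp] theorem wt_nil (w : α → ℤ) : wt w [] = 0 := rfl

@[simp] theorem wt_cons (w : α → ℤ) (a : α) (l : List α) : wt w (a :: l) = w a + wt w l := by
  simp [wt]

@[simp] theorem wt_append (w : α → ℤ) (l l' : List α) : wt w (l ++ l') = wt w l + wt w l' := by
  simp [wt]

theorem List.Perm.wt_eq {l l' : List α} (h : l.Perm l') (w : α → ℤ) : wt w l = wt w l' :=
  (h.map w).sum_eq

theorem wt_le_neg_length (w : α → ℤ) {l : List α} (h : ∀ p ∈ l, w p < 0) :
    wt w l ≤ -l.length := by
  induction l with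
  | nil => simp
  | cons p l ih =>
    have := ih fun p' hp' => h p' (List.mem_cons_of_mem _ hp')
    have := h p List.mem_cons_self
    rw [wt_cons, List.length_cons]; push_cast; omega

/-- The sum of `ε • G I J` over all ways to split the list `l` of homogeneous elements (with
degrees `w`) into a sublist `I` and its complement `J`, where `ε` is the Koszul sign of the shuffle
that turns `l` into `I ++ J`. This is the coproduct of the symmetric coalgebra followed by `G`. -/
def splitSum (w : α → ℤ) : List α → (List α → List α → N) → N
  | [], G => G [] []
  | a :: l, G => splitSum w l fun I J => G (a :: I) J + esign (w a * wt w I) • G I (a :: J)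

variable (w : α → ℤ)

@[simp] theorem splitSum_nil (G : List α → List α → N) : splitSum w [] G = G [] [] := rfl

theorem splitSum_cons (a : α) (l : List α) (G : List α → List α → N) :
    splitSum w (a :: l) G =
      splitSum w l fun I J => G (a :: I) J + esign (w a * wt w I) • G I (a :: J) := rfl

theorem splitSum_congr {l : List α} {G G' : List α → List α → N}
    (h : ∀ I J, (I ++ J).Perm l → G I J = G' I J) : splitSum w l G = splitSum w l G' := by
  induction l generalizing G G' with
  | nil => exact h [] [] (List.Perm.refl _)
  | cons a l ih =>
    refine ih fun I J hIJ => ?_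
    rw [h (a :: I) J (hIJ.cons a), h I (a :: J) (List.perm_middle.trans (hIJ.cons a))]

theorem splitSum_add (l : List α) (G G' : List α → List α → N) :
    splitSum w l (fun I J => G I J + G' I J) = splitSum w l G + splitSum w l G' := by
  induction l generalizing G G' with
  | nil => rfl
  | cons a l ih =>
    simp only [splitSum_cons, ← ih]
    congr 1; funext I J
    rw [smul_add]; abel

theorem map_splitSum {N' : Type*} [AddCommGroup N'] (φ : N →+ N') (l : List α)
    (G : List α → List α → N) :
    φ (splitSum w l G) = splitSum w l fun I J => φ (G I J) := by
  induction l generalizing G with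
  | nil => rfl
  | cons a l ih => simp only [splitSum_cons, ih, map_add, map_zsmul]

theorem splitSum_zero (l : List α) : splitSum w l (fun _ _ => (0 : N)) = 0 := by
  simpa using (map_splitSum w (0 : N →+ N) l fun _ _ => 0).symm

theorem splitSum_eq_zero {l : List α} {G : List α → List α → N}
    (h : ∀ I J, (I ++ J).Perm l → G I J = 0) : splitSum w l G = 0 :=
  (splitSum_congr w h).trans (splitSum_zero w l)

theorem splitSum_smul {S : Type*} [DistribSMul S N] (c : S) (l : List α)
    (G : List α → List α → N) :
    splitSum w l (fun I J => c • G I J) = c • splitSum w l G :=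
  (map_splitSum w (DistribSMul.toAddMonoidHom N c) l G).symm

theorem splitSum_mem {S : Type*} [SetLike S N] [AddSubgroupClass S N] (s : S) {l : List α}
    {G : List α → List α → N} (h : ∀ I J, (I ++ J).Perm l → G I J ∈ s) :
    splitSum w l G ∈ s := by
  induction l generalizing G with
  | nil => exact h [] [] (List.Perm.refl _)
  | cons a l ih =>
    exact ih fun I J hIJ => add_mem (h _ _ (hIJ.cons a))
      (zsmul_mem (h _ _ (List.perm_middle.trans (hIJ.cons a))) _)

theorem splitSum_map {β : Type*} (τ : β → α) (l : List β) (G : List α → List α → N) :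
    splitSum w (l.map τ) G =
      splitSum (fun b => w (τ b)) l fun I J => G (I.map τ) (J.map τ) := by
  induction l generalizing G with
  | nil => rfl
  | cons b l ih =>
    rw [List.map_cons, splitSum_cons, ih, splitSum_cons]
    simp [wt, Function.comp_def]

theorem splitSum_eq_right_nil {l : List α} {G : List α → List α → N}
    (h : ∀ I J, (I ++ J).Perm l → J ≠ [] → G I J = 0) : splitSum w l G = G l [] := by
  induction l generalizing G with
  | nil => rfl
  | cons a l ih =>
    have h0 : ∀ I J, (I ++ J).Perm l → G I (a :: J) = 0 := fun I J hIJ =>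
      h I (a :: J) (List.perm_middle.trans (hIJ.cons a)) (List.cons_ne_nil _ _)
    rw [splitSum_cons, ih, h0 l [] (by simp), smul_zero, add_zero]
    intro I J hIJ hJ
    rw [h0 I J hIJ, h _ _ (hIJ.cons a) hJ, smul_zero, add_zero]

/-- Coassociativity: both sides are the sum over all splittings into three sublists. -/
theorem splitSum_assoc (l : List α) (G : List α → List α → List α → N) :
    splitSum w l (fun T L => splitSum w T fun I J => G I J L) =
      splitSum w l (fun I S => splitSum w S fun J L => G I J L) := by
  induction l generalizing G with
  | nil => rfl
  | cons a l ih =>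
    have h1 : splitSum w (a :: l) (fun T L => splitSum w T fun I J => G I J L) =
        splitSum w l fun T L => splitSum w T fun I J =>
          G (a :: I) J L + esign (w a * wt w I) • G I (a :: J) L +
            esign (w a * (wt w I + wt w J)) • G I J (a :: L) := by
      rw [splitSum_cons]
      refine splitSum_congr w fun T L _ => ?_
      rw [splitSum_add w T]
      congr 1
      rw [← splitSum_smul]
      refine splitSum_congr w fun I J hIJ => ?_
      rw [← hIJ.wt_eq w, wt_append]
    have h2 : splitSum w (a :: l) (fun I S => splitSum w S fun J L => G I J L) =
        splitSum w l fun I S => splitSum w S fun J L =>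
          G (a :: I) J L + esign (w a * wt w I) • G I (a :: J) L +
            esign (w a * (wt w I + wt w J)) • G I J (a :: L) := by
      rw [splitSum_cons]
      refine splitSum_congr w fun I S _ => ?_
      rw [splitSum_cons, ← splitSum_smul, ← splitSum_add]
      refine splitSum_congr w fun J L _ => ?_
      rw [smul_add, add_assoc, smul_smul, mul_add, esign_add]
    rw [h1, h2, ih]

/-- Graded cocommutativity. -/
theorem splitSum_comm (l : List α) (G : List α → List α → N) :
    splitSum w l G = splitSum w l fun I J => esign (wt w I * wt w J) • G J I := by
  induction l generalizing G with
  | nil => simp [esign_zero]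
  | cons a l ih =>
    rw [splitSum_cons, ih, splitSum_cons]
    refine splitSum_congr w fun I J _ => ?_
    rw [smul_add, smul_smul, smul_smul, add_comm, wt_cons, wt_cons, ← esign_add, ← esign_add]
    congr 2
    · exact esign_eq_of_even ⟨0, by ring⟩
    · exact esign_eq_of_even ⟨-(wt w I * w a), by ring⟩

/-- Two adjacent entries of the list may be exchanged (up to the Koszul sign) in `splitSum`, if they
may be exchanged in both arguments of the summand. -/
theorem splitSum_swap (l₁ : List α) (a b : α) (l₂ : List α) (G : List α → List α → N)
    (h₁ : ∀ I₁ I₂ J, (I₁ ++ a :: b :: I₂ ++ J).Perm (l₁ ++ a :: b :: l₂) →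
      G (I₁ ++ a :: b :: I₂) J = esign (w a * w b) • G (I₁ ++ b :: a :: I₂) J)
    (h₂ : ∀ I J₁ J₂, (I ++ (J₁ ++ a :: b :: J₂)).Perm (l₁ ++ a :: b :: l₂) →
      G I (J₁ ++ a :: b :: J₂) = esign (w a * w b) • G I (J₁ ++ b :: a :: J₂)) :
    splitSum w (l₁ ++ a :: b :: l₂) G =
      esign (w a * w b) • splitSum w (l₁ ++ b :: a :: l₂) G := by
  induction l₁ generalizing G with
  | nil =>
    simp only [List.nil_append, splitSum_cons]
    rw [← splitSum_smul]
    refine splitSum_congr w fun I J hIJ => ?_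
    have e1 := h₁ [] I J ((hIJ.cons b).cons a)
    have e2 := h₂ I [] J (by
      simpa using (List.perm_middle.trans ((List.perm_middle.trans (hIJ.cons b)).cons a)))
    simp only [List.nil_append] at e1 e2
    rw [e1, e2]
    simp only [smul_add, smul_smul, wt_cons, ← esign_add]
    have k1 : esign (w a * (w b + wt w I)) = esign (w a * w b + w a * wt w I) := by
      rw [mul_add]
    have k2 : esign (w a * w b + w b * (w a + wt w I)) = esign (w b * wt w I) :=
      esign_eq_of_even ⟨w a * w b, by ring⟩
    have k3 : esign (w b * wt w I + (w a * wt w I + w a * w b)) =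
      esign (w a * w b + (w a * wt w I + w b * wt w I)) :=
      esign_eq_of_even ⟨0, by ring⟩
    simp only [k1, k2, k3]
    abel
  | cons c l ih =>
    simp only [List.cons_append, splitSum_cons]
    apply ih
    · intro I₁ I₂ J hp
      have e1 := h₁ (c :: I₁) I₂ J (hp.cons c)
      have e2 := h₁ I₁ I₂ (c :: J) (List.perm_middle.trans (hp.cons c))
      simp only [List.cons_append] at e1
      rw [e1, e2, smul_add, smul_comm (esign (w a * w b))]
      congr 4
      simp only [wt_append, wt_cons]; ring
    · intro I J₁ J₂ hp
      have e1 := h₂ (c :: I) J₁ J₂ (hp.cons c)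
      have e2 := h₂ I (c :: J₁) J₂ (List.perm_middle.trans (hp.cons c))
      simp only [List.cons_append] at e2
      rw [e1, e2, smul_add, smul_comm (esign (w a * w b))]

end SplitSum

/-! ### Functions of homogeneous arguments -/

section Tagged

variable {O M N : Type*} [CommRing O] [AddCommGroup M] [Module O M] [AddCommGroup N]

/-- A list of pairs (degree, element) in which every element is homogeneous of the given degree. -/
def Homog (deg : ℤ → Submodule O M) (l : List (ℤ × M)) : Prop := ∀ p ∈ l, p.2 ∈ deg p.1

/-- The underlying list of elements of a list of pairs (degree, element). -/
abbrev vals (l : List (ℤ × M)) : List M := l.map Prod.snd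

variable {deg : ℤ → Submodule O M}

theorem homog_nil : Homog deg [] := by simp [Homog]

@[simp] theorem homog_cons {p : ℤ × M} {l : List (ℤ × M)} :
    Homog deg (p :: l) ↔ p.2 ∈ deg p.1 ∧ Homog deg l := by simp [Homog]

@[simp] theorem homog_append {l l' : List (ℤ × M)} :
    Homog deg (l ++ l') ↔ Homog deg l ∧ Homog deg l' := by
  simp only [Homog, List.mem_append, or_imp, forall_and]

theorem Homog.perm {l l' : List (ℤ × M)} (h : Homog deg l) (hp : l'.Perm l) : Homog deg l' :=
  fun p hm => h p (hp.mem_iff.1 hm)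

/-- Graded symmetry of a function of homogeneous arguments, in terms of adjacent transpositions. -/
def SwapSymm (deg : ℤ → Submodule O M) (F : List (ℤ × M) → N) : Prop :=
  ∀ l₁ a b l₂, Homog deg (l₁ ++ a :: b :: l₂) →
    F (l₁ ++ a :: b :: l₂) = esign (a.1 * b.1) • F (l₁ ++ b :: a :: l₂)

theorem SwapSymm.cons {F : List (ℤ × M) → N} (hF : SwapSymm deg F) {p : ℤ × M}
    (hp : p.2 ∈ deg p.1) : SwapSymm deg fun l => F (p :: l) :=
  fun l₁ a b l₂ h => hF (p :: l₁) a b l₂ (homog_cons.2 ⟨hp, h⟩)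

theorem SwapSymm.move_front {F : List (ℤ × M) → N} (hF : SwapSymm deg F) {l₁ : List (ℤ × M)}
    {a : ℤ × M} {l₂ : List (ℤ × M)} (h : Homog deg (l₁ ++ a :: l₂)) :
    F (l₁ ++ a :: l₂) = esign (a.1 * wt Prod.fst l₁) • F (a :: (l₁ ++ l₂)) := by
  induction l₁ generalizing F with
  | nil => simp [esign_zero]
  | cons p l ih =>
    rw [List.cons_append, homog_cons] at h
    rw [List.cons_append, ih (hF.cons h.1) h.2]
    have := hF [] p a (l ++ l₂) (by simp_all)
    simp only [List.nil_append] at this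
    rw [this, smul_smul, ← esign_add, wt_cons, List.cons_append]
    congr 1
    exact esign_eq_of_even ⟨0, by ring⟩

/-- `O`-linearity in each argument, on homogeneous arguments. -/
structure MultiLin [Module O N] (deg : ℤ → Submodule O M) (F : List (ℤ × M) → N) : Prop where
  add : ∀ l₁ l₂ d x y, Homog deg l₁ → Homog deg l₂ → x ∈ deg d → y ∈ deg d →
    F (l₁ ++ (d, x + y) :: l₂) = F (l₁ ++ (d, x) :: l₂) + F (l₁ ++ (d, y) :: l₂)
  smul : ∀ l₁ l₂ d (f : O) x, Homog deg l₁ → Homog deg l₂ → x ∈ deg d →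
    F (l₁ ++ (d, f • x) :: l₂) = f • F (l₁ ++ (d, x) :: l₂)

theorem MultiLin.cons [Module O N] {F : List (ℤ × M) → N} (hF : MultiLin deg F) {p : ℤ × M}
    (hp : p.2 ∈ deg p.1) : MultiLin deg fun l => F (p :: l) where
  add l₁ l₂ d x y h₁ h₂ := hF.add (p :: l₁) l₂ d x y (homog_cons.2 ⟨hp, h₁⟩) h₂
  smul l₁ l₂ d f x h₁ h₂ := hF.smul (p :: l₁) l₂ d f x (homog_cons.2 ⟨hp, h₁⟩) h₂

/-- For graded symmetric functions, linearity has to be checked in the first argument only. -/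
theorem SwapSymm.multiLin [Module O N] {F : List (ℤ × M) → N} (hF : SwapSymm deg F)
    (hadd : ∀ l d x y, Homog deg l → x ∈ deg d → y ∈ deg d →
      F ((d, x + y) :: l) = F ((d, x) :: l) + F ((d, y) :: l))
    (hsmul : ∀ l d (f : O) x, Homog deg l → x ∈ deg d →
      F ((d, f • x) :: l) = f • F ((d, x) :: l)) : MultiLin deg F where
  add l₁ l₂ d x y h₁ h₂ hx hy := by
    have h : ∀ z ∈ deg d, Homog deg (l₁ ++ (d, z) :: l₂) := fun z hz => by simp_all
    rw [hF.move_front (h _ (add_mem hx hy)), hF.move_front (h _ hx), hF.move_front (h _ hy),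
      hadd _ _ _ _ (homog_append.2 ⟨h₁, h₂⟩) hx hy, smul_add]
  smul l₁ l₂ d f x h₁ h₂ hx := by
    have h : ∀ z ∈ deg d, Homog deg (l₁ ++ (d, z) :: l₂) := fun z hz => by simp_all
    rw [hF.move_front (h _ (Submodule.smul_mem _ f hx)), hF.move_front (h _ hx),
      hsmul _ _ _ _ (homog_append.2 ⟨h₁, h₂⟩) hx, smul_comm]

end Tagged

/-! ### Graded brackets and their Jacobiator -/

section Jacobiator

variable {K O M : Type*} [Field K] [CommRing O]
  [AddCommGroup M] [Module K M] [Module O M]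

/-- A family of graded symmetric `K`-multilinear brackets of degree `+1`, one for every arity
`n ≥ 1`, regarded as a single function on lists. -/
structure IsGradedBracket (K : Type*) [Field K] [Module K M] (deg : ℤ → Submodule O M)
    (q : List M → M) : Prop where
  nil : q [] = 0
  linear : ∀ l₁ l₂, IsLinearMap K fun x => q (l₁ ++ x :: l₂)
  mem_deg : ∀ l, Homog deg l → q (vals l) ∈ deg (wt Prod.fst l + 1)
  swap : SwapSymm deg fun l => q (vals l)

/-- The Jacobiator of a family of brackets: the sum of `ε q(q(x_I), x_J)` over all splittings of the
arguments into `x_I` and `x_J`. -/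
def jac (q : List M → M) (l : List (ℤ × M)) : M :=
  splitSum Prod.fst l fun I J => q (q (vals I) :: vals J)

variable {deg : ℤ → Submodule O M} {q : List M → M}

namespace IsGradedBracket

theorem map_add (hq : IsGradedBracket K deg q) (x y : M) (l : List M) :
    q ((x + y) :: l) = q (x :: l) + q (y :: l) := (hq.linear [] l).map_add x y

theorem zero_cons (hq : IsGradedBracket K deg q) (l : List M) : q (0 :: l) = 0 :=
  (hq.linear [] l).map_zero

/-- The bracket as an additive map in its first argument. -/
def fstHom (hq : IsGradedBracket K deg q) (l : List M) : M →+ M :=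
  AddMonoidHom.mk' (fun x => q (x :: l)) fun x y => hq.map_add x y l

theorem zsmul_cons (hq : IsGradedBracket K deg q) (c : ℤ) (x : M) (l : List M) :
    q ((c • x) :: l) = c • q (x :: l) := map_zsmul (hq.fstHom l) c x

theorem splitSum_left (hq : IsGradedBracket K deg q) (l : List M) (T : List (ℤ × M))
    (G : List (ℤ × M) → List (ℤ × M) → M) :
    q (splitSum Prod.fst T G :: l) = splitSum Prod.fst T fun I J => q (G I J :: l) :=
  map_splitSum Prod.fst (hq.fstHom l) T G

theorem swap_head (hq : IsGradedBracket K deg q) {a b : ℤ} {x y : M} {l : List (ℤ × M)}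
    (hx : x ∈ deg a) (hy : y ∈ deg b) (hl : Homog deg l) :
    q (x :: y :: vals l) = esign (a * b) • q (y :: x :: vals l) :=
  hq.swap [] (a, x) (b, y) l (by simp_all)

theorem eq_zero_of_mem (hq : IsGradedBracket K deg q) {l : List M} (h : (0 : M) ∈ l) :
    q l = 0 := by
  obtain ⟨l₁, l₂, rfl⟩ := List.append_of_mem h
  exact (hq.linear l₁ l₂).map_zero

theorem jac_cons (a : ℤ) (x : M) (l : List (ℤ × M)) :
    jac q ((a, x) :: l) = splitSum Prod.fst l fun I J =>
      q (q (x :: vals I) :: vals J) +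
        esign (a * wt Prod.fst I) • q (q (vals I) :: x :: vals J) := rfl

theorem jac_mem_deg (hq : IsGradedBracket K deg q) {l : List (ℤ × M)} (hl : Homog deg l) :
    jac q l ∈ deg (wt Prod.fst l + 2) := by
  refine splitSum_mem _ _ fun I J hIJ => ?_
  have h := homog_append.1 (hl.perm hIJ)
  have := hq.mem_deg ((wt Prod.fst I + 1, q (vals I)) :: J) (homog_cons.2 ⟨hq.mem_deg I h.1, h.2⟩)
  have e : wt Prod.fst I + wt Prod.fst J + 2 =
      wt Prod.fst ((wt Prod.fst I + 1, q (vals I)) :: J) + 1 := by rw [wt_cons]; ring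
  rw [← hIJ.wt_eq Prod.fst, wt_append, e]
  exact this

theorem jac_swap (hq : IsGradedBracket K deg q) : SwapSymm deg (jac q) := by
  intro l₁ a b l₂ hl
  refine splitSum_swap _ l₁ a b l₂ _ (fun I₁ I₂ J hp => ?_) (fun I J₁ J₂ hp => ?_)
  · have h := homog_append.1 (hl.perm hp)
    have := hq.swap I₁ a b I₂ h.1
    dsimp only at this
    rw [this, hq.zsmul_cons]
  · have h := homog_append.1 (hl.perm hp)
    exact hq.swap ((wt Prod.fst I + 1, q (vals I)) :: J₁) a b J₂
      (homog_cons.2 ⟨hq.mem_deg I h.1, h.2⟩)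

/-- The Bianchi identity: the brackets commute with their Jacobiator. This is the pre-Lie identity
for the insertion product of an odd operation with itself: the terms `q(q(x_I), q(x_J), x_L)` with
two unnested inner brackets are antisymmetric in `I` and `J`, and cancel. -/
theorem bianchi [CharZero K] (hq : IsGradedBracket K deg q) {l : List (ℤ × M)}
    (hl : Homog deg l) :
    (splitSum Prod.fst l fun T J => q (jac q T :: vals J)) =
      splitSum Prod.fst l fun I J => jac q ((wt Prod.fst I + 1, q (vals I)) :: J) := by
  have e1 : (splitSum Prod.fst l fun T J => q (jac q T :: vals J)) =
      splitSum Prod.fst l fun I S => splitSum Prod.fst S fun J L =>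
        q (q (q (vals I) :: vals J) :: vals L) := by
    rw [← splitSum_assoc]
    exact splitSum_congr _ fun T J _ => hq.splitSum_left _ _ _
  -- the terms with two unnested inner brackets
  let G : List (ℤ × M) → List (ℤ × M) → List (ℤ × M) → M := fun I J L =>
    esign ((wt Prod.fst I + 1) * wt Prod.fst J) • q (q (vals J) :: q (vals I) :: vals L)
  have e2 : (splitSum Prod.fst l fun I S => splitSum Prod.fst S fun J L => G I J L) = 0 := by
    rw [← splitSum_assoc]
    refine splitSum_eq_zero _ fun T L hT => ?_
    have hT := homog_append.1 (hl.perm hT)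
    have : splitSum Prod.fst T (fun I J => G I J L) =
        - splitSum Prod.fst T (fun I J => G I J L) := by
      conv_lhs => rw [splitSum_comm]
      rw [← neg_one_smul ℤ, ← splitSum_smul]
      refine splitSum_congr _ fun I J hIJ => ?_
      have hIJ := homog_append.1 (hT.1.perm hIJ)
      simp only [G]
      rw [hq.swap_head (hq.mem_deg I hIJ.1) (hq.mem_deg J hIJ.2) hT.2, smul_smul, smul_smul,
        smul_smul, ← esign_one, ← esign_add, ← esign_add, ← esign_add]
      congr 1
      exact esign_eq_of_even ⟨wt Prod.fst I * wt Prod.fst J + wt Prod.fst I - (-0), by ring⟩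
    have h2 : (2 : K) • splitSum Prod.fst T (fun I J => G I J L) = 0 := by
      rw [two_smul]; nth_rw 1 [this]; exact neg_add_cancel _
    exact (smul_eq_zero_iff_right two_ne_zero).1 h2
  rw [e1, ← add_zero (splitSum _ _ _), ← e2, ← splitSum_add]
  refine splitSum_congr _ fun I S _ => ?_
  rw [← splitSum_add]
  rfl

/-- Homogeneous arguments vanish unless their degrees are negative. -/
theorem exists_zero_mem (hbot : ∀ i, 0 ≤ i → deg i = ⊥) {l : List (ℤ × M)} (hl : Homog deg l)
    (h : ¬∀ p ∈ l, p.1 < 0) : (0 : M) ∈ vals l := by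
  push Not at h
  obtain ⟨p, hp, hp0⟩ := h
  have : p.2 = 0 := by simpa [hbot _ hp0] using hl p hp
  exact this ▸ List.mem_map_of_mem hp

/-- A linear map that is concentrated in degree `-1` and vanishes on the image of the differential
vanishes on all brackets, except for the binary brackets of elements of degree `-1`. -/
theorem map_bracket_eq_zero (hq : IsGradedBracket K deg q) (hbot : ∀ i, 0 ≤ i → deg i = ⊥)
    {N : Type*} [AddCommGroup N] [Module O N] (φ : M →ₗ[O] N)
    (hφ : ∀ i, i ≠ -1 → ∀ x ∈ deg i, φ x = 0) (hφd : ∀ x, φ (q [x]) = 0) {l : List (ℤ × M)}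
    (hl : Homog deg l) (h : l.map Prod.fst ≠ [-1, -1]) : φ (q (vals l)) = 0 := by
  by_cases hneg : ∀ p ∈ l, p.1 < 0
  · match l, hl, h, hneg with
    | [], _, _, _ => simp [hq.nil]
    | [p], _, _, _ => exact hφd p.2
    | p₁ :: p₂ :: l, hl, h, hneg =>
      refine hφ _ (fun hd => h ?_) _ (hq.mem_deg _ hl)
      have h0 := wt_le_neg_length Prod.fst hneg
      have h1 := hneg p₁ (by simp)
      have h2 := hneg p₂ (by simp)
      simp only [wt_cons, List.length_cons] at hd h0
      push_cast at h0
      obtain rfl : l = [] := List.length_eq_zero_iff.1 (by omega)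
      simp only [wt_nil] at hd
      simp only [List.map_cons, List.map_nil, List.cons.injEq, and_true]
      omega
  · rw [hq.eq_zero_of_mem (exists_zero_mem hbot hl hneg), map_zero]

end IsGradedBracket

end Jacobiator

/-! ### Multilinearity of the Jacobiator of anchored brackets -/

section Anchored

variable {K O M : Type*} [Field K] [CommRing O] [Algebra K O]
  [AddCommGroup M] [Module K M] [Module O M] {deg : ℤ → Submodule O M} {q : List M → M}
  {ρ : M →ₗ[O] Derivation K O O}

/-- A family of graded brackets that are `O`-multilinear, except for the binary bracket, which
satisfies the Leibniz rule for an anchor map `ρ`. -/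
structure IsLeibnizBracket (deg : ℤ → Submodule O M) (ρ : M →ₗ[O] Derivation K O O)
    (q : List M → M) : Prop extends IsGradedBracket K deg q where
  smul : ∀ l₁ l₂ (f : O) x, l₁.length + l₂.length ≠ 1 → q (l₁ ++ (f • x) :: l₂) =
    f • q (l₁ ++ x :: l₂)
  leibniz : ∀ x y (f : O), q [x, f • y] = ρ x f • y + f • q [x, y]
  deg_eq_bot : ∀ i, 0 ≤ i → deg i = ⊥
  anchor_eq_zero : ∀ i, i ≠ -1 → ∀ x ∈ deg i, ρ x = 0

/-- A family of graded brackets as in `IsLeibnizBracket` for which the anchor is compatible with the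
differential and with the binary bracket. -/
structure IsAnchoredBracket (deg : ℤ → Submodule O M) (ρ : M →ₗ[O] Derivation K O O)
    (q : List M → M) : Prop extends IsLeibnizBracket deg ρ q where
  anchor_differential : ∀ x, ρ (q [x]) = 0
  anchor_bracket : ∀ x ∈ deg (-1), ∀ y ∈ deg (-1), ρ (q [x, y]) = ⁅ρ x, ρ y⁆

namespace IsLeibnizBracket

/-- The failure of `O`-linearity of a bracket in its first argument, which comes from the Leibniz
rule and concerns the binary bracket only. -/
def anomaly (ρ : M →ₗ[O] Derivation K O O) (f : O) (a : ℤ) (x : M) : List (ℤ × M) → M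
  | [p] => esign a • ρ p.2 f • x
  | _ => 0

/-- A sign with an exponent divisible by the degree of `y` may be replaced if `y` is anchored: then
its degree is `-1`. -/
theorem esign_smul_anchor (hq : IsLeibnizBracket deg ρ q) {b : ℤ} {y : M} (hy : y ∈ deg b)
    {m n : ℤ} (h : b = -1 → Even (m - n)) (f : O) (x : M) :
    esign m • ρ y f • x = esign n • ρ y f • x := by
  by_cases hb : b = -1
  · rw [esign_eq_of_even (h hb)]
  · simp [hq.anchor_eq_zero b hb y hy]

theorem smul_cons (hq : IsLeibnizBracket deg ρ q) {a : ℤ} {x : M} {l : List (ℤ × M)}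
    (hx : x ∈ deg a) (hl : Homog deg l) (f : O) :
    q (f • x :: vals l) = f • q (x :: vals l) + anomaly ρ f a x l := by
  match l, hl with
  | [], _ => simpa [anomaly] using hq.smul [] [] f x (by simp)
  | [(b, y)], hl =>
    have hy : y ∈ deg b := (homog_cons.1 hl).1
    have h1 := hq.swap_head (Submodule.smul_mem _ f hx) hy homog_nil
    have h2 := hq.swap_head hx hy homog_nil
    simp only [List.map_nil] at h1 h2
    simp only [List.map_cons, List.map_nil, anomaly]
    rw [h1, h2, hq.leibniz, smul_add, smul_comm f, add_comm]
    congr 1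
    exact hq.esign_smul_anchor hy (fun h => ⟨-a, by rw [h]; ring⟩) f x
  | p :: p' :: l, _ => simpa [anomaly] using hq.smul [] (vals (p :: p' :: l)) f x (by simp)

end IsLeibnizBracket

namespace IsAnchoredBracket

open IsLeibnizBracket

/-- The Jacobiator is `O`-linear in its first argument, although the binary bracket is not: the
anomalies of the two nested brackets cancel, since the anchor is compatible with the bracket. -/
theorem jac_smul_cons (hq : IsAnchoredBracket deg ρ q) {a : ℤ} {x : M} {l : List (ℤ × M)}
    (hx : x ∈ deg a) (hl : Homog deg l) (f : O) :
    jac q ((a, f • x) :: l) = f • jac q ((a, x) :: l) := by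
  -- the contribution of `ρ` of one argument, applied to `f`
  let X₁ : List (ℤ × M) → List (ℤ × M) → M := fun I J =>
    anomaly ρ f (a + wt Prod.fst I + 1) (q (x :: vals I)) J
  let X₂ : List (ℤ × M) → List (ℤ × M) → M := fun I J => anomaly ρ f a (q (x :: vals J)) I
  -- the contribution of two anchors applied to `f`
  let X₃ : List (ℤ × M) → List (ℤ × M) → M := fun I J =>
    match I with
    | [p] => esign a • anomaly ρ (ρ p.2 f) a x J
    | _ => 0
  -- the contribution of the anchor of a bracket
  let X₄ : List (ℤ × M) → List (ℤ × M) → M := fun I J =>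
    esign a • anomaly ρ f a x ((wt Prod.fst I + 1, q (vals I)) :: J)
  have key : jac q ((a, f • x) :: l) = splitSum Prod.fst l fun I J =>
      f • (q (q (x :: vals I) :: vals J) +
        esign (a * wt Prod.fst I) • q (q (vals I) :: x :: vals J)) +
      ((X₁ I J + X₂ I J) + (X₃ I J + X₄ I J)) := by
    rw [IsGradedBracket.jac_cons]
    refine splitSum_congr _ fun I J hIJ => ?_
    have h := homog_append.1 (hl.perm hIJ)
    have hqI := hq.mem_deg I h.1
    have e1 : q (q (f • x :: vals I) :: vals J) =
        f • q (q (x :: vals I) :: vals J) + X₁ I J + (X₂ I J + X₃ I J) := by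
      have hqx : q (x :: vals I) ∈ deg (a + wt Prod.fst I + 1) := by
        simpa using hq.mem_deg ((a, x) :: I) (homog_cons.2 ⟨hx, h.1⟩)
      rw [hq.smul_cons hx h.1, hq.map_add, hq.smul_cons hqx h.2]
      congr 1
      match I, h.1 with
      | [], _ => simp [X₂, X₃, anomaly, hq.zero_cons]
      | [p], _ =>
        simp only [X₂, X₃, anomaly]
        rw [hq.zsmul_cons, hq.smul_cons hx h.2, smul_add]
        rfl
      | p :: p' :: I, _ => simp [X₂, X₃, anomaly, hq.zero_cons]
    have e2 : esign (a * wt Prod.fst I) • q (q (vals I) :: f • x :: vals J) =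
        f • (esign (a * wt Prod.fst I) • q (q (vals I) :: x :: vals J)) + X₄ I J := by
      rw [hq.swap_head hqI (Submodule.smul_mem _ f hx) h.2, hq.swap_head hqI hx h.2,
        smul_smul, smul_smul, ← esign_add]
      have := hq.smul_cons (l := (wt Prod.fst I + 1, q (vals I)) :: J) hx
        (homog_cons.2 ⟨hqI, h.2⟩) f
      simp only [List.map_cons] at this
      rw [this, smul_add, smul_comm f]
      have e : esign (a * wt Prod.fst I + (wt Prod.fst I + 1) * a) = esign a :=
        esign_eq_of_even ⟨a * wt Prod.fst I, by ring⟩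
      rw [e]
    rw [e1, e2, smul_add]
    abel
  have h12 : splitSum Prod.fst l (fun I J => X₁ I J + X₂ I J) = 0 := by
    rw [splitSum_add, splitSum_comm Prod.fst l X₂, ← splitSum_add]
    refine splitSum_eq_zero _ fun I J hIJ => ?_
    have h := homog_append.1 (hl.perm hIJ)
    match J, h.2 with
    | [], _ => simp [X₁, X₂, anomaly]
    | [(b, y)], hJ =>
      simp only [X₁, X₂, anomaly, smul_smul, wt_cons, wt_nil, esign_succ]
      rw [← esign_add, hq.esign_smul_anchor (homog_cons.1 hJ).1 (n := a + wt Prod.fst I)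
        (fun (hb : b = -1) => ⟨-wt Prod.fst I, by rw [hb]; ring⟩) f, neg_smul, neg_add_cancel]
    | p :: p' :: J, _ => simp [X₁, X₂, anomaly]
  have h34 : splitSum Prod.fst l (fun I J => X₃ I J + X₄ I J) = 0 := by
    by_cases h2 : l.length = 2
    · obtain ⟨p, p', rfl⟩ := List.length_eq_two.1 h2
      obtain ⟨b, y⟩ := p
      obtain ⟨c, z⟩ := p'
      have hy : y ∈ deg b := (homog_cons.1 hl).1
      have hz : z ∈ deg c := (homog_cons.1 (homog_cons.1 hl).2).1
      have hX : splitSum Prod.fst [(b, y), (c, z)] (fun I J => X₃ I J + X₄ I J) =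
          ρ z (ρ y f) • x + esign (b * c) • ρ y (ρ z f) • x + ρ (q [y, z]) f • x := by
        simp only [splitSum_cons, splitSum_nil, X₃, X₄, anomaly, wt_nil, wt_cons, smul_smul,
          esign_mul_self, mul_zero, esign_zero, List.map_cons, List.map_nil, smul_zero,
          zero_add, add_zero, one_smul]
        abel
      rw [hX]
      by_cases hbc : b = -1 ∧ c = -1
      · obtain ⟨rfl, rfl⟩ := hbc
        rw [hq.anchor_bracket y hy z hz, Derivation.commutator_apply, sub_smul]
        have : esign (-1 * -1) = -1 := by rw [← esign_one]; rfl
        rw [this, neg_one_smul]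
        abel
      · have h0 : ρ (q [y, z]) = 0 :=
          hq.map_bracket_eq_zero hq.deg_eq_bot ρ hq.anchor_eq_zero hq.anchor_differential hl
            (by simpa using hbc)
        rcases not_and_or.1 hbc with hb | hc
        · simp [hq.anchor_eq_zero b hb y hy, h0]
        · simp [hq.anchor_eq_zero c hc z hz, h0]
    · refine splitSum_eq_zero _ fun I J hIJ => ?_
      have h := homog_append.1 (hl.perm hIJ)
      rw [← hIJ.length_eq, List.length_append] at h2
      have h3 : X₃ I J = 0 := by
        match I, J, h2 with
        | [p], [p'], h2 => simp at h2
        | [], _, _ => rfl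
        | _ :: _ :: _, _, _ => rfl
        | [p], [], _ => simp [X₃, anomaly]
        | [p], _ :: _ :: _, _ => simp [X₃, anomaly]
      have h4 : X₄ I J = 0 := by
        match J, h2 with
        | [], h2 =>
          have := hq.map_bracket_eq_zero hq.deg_eq_bot ρ hq.anchor_eq_zero
            hq.anchor_differential h.1 fun h' => h2 (by simpa using congrArg List.length h')
          simp [X₄, anomaly, this]
        | _ :: _, _ => simp [X₄, anomaly]
      rw [h3, h4, add_zero]
  rw [key, splitSum_add, splitSum_add _ _ (fun I J => X₁ I J + X₂ I J), h12, h34, splitSum_smul,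
    add_zero, add_zero]
  rfl

theorem jac_multiLin (hq : IsAnchoredBracket deg ρ q) : MultiLin deg (jac q) := by
  refine hq.jac_swap.multiLin (fun l d x y _ _ _ => ?_) (fun l d f x hl hx =>
    hq.jac_smul_cons hx hl f)
  simp only [IsGradedBracket.jac_cons, ← splitSum_add]
  refine splitSum_congr _ fun I J _ => ?_
  have h := (hq.linear [q (vals I)] (vals J)).map_add x y
  simp only [List.cons_append, List.nil_append] at h
  rw [hq.map_add, hq.map_add, h, smul_add]
  abel

end IsAnchoredBracket

end Anchored

/-! ### Koszul signs of permutations and shuffles -/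

section Koszul

variable {n : ℕ}

theorem koszulSign_eq {κ : Type*} [LinearOrder κ] (d : Fin n → ℤ) (c : Fin n → κ) :
    koszulSign d c =
      ∏ p : Fin n × Fin n, if p.1 < p.2 ∧ c p.2 < c p.1 then esign (d p.1 * d p.2) else 1 := rfl

/-- A product over all ordered pairs, rearranged as a product over all pairs `p < q`. -/
theorem prod_pairs_fold {R : Type*} [CommMonoid R] (F : Fin n × Fin n → R)
    (h : ∀ p, F (p, p) = 1) :
    ∏ x, F x = ∏ x : Fin n × Fin n, if x.1 < x.2 then F x * F x.swap else 1 := by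
  have e1 : ∏ x, F x = (∏ x : Fin n × Fin n, if x.1 < x.2 then F x else 1) *
      ∏ x : Fin n × Fin n, if x.2 < x.1 then F x else 1 := by
    rw [← Finset.prod_mul_distrib]
    refine Finset.prod_congr rfl fun x _ => ?_
    obtain ⟨p, q⟩ := x
    rcases lt_trichotomy p q with hpq | rfl | hpq
    · simp [hpq, hpq.asymm]
    · simp [h]
    · simp [hpq, hpq.asymm]
  rw [e1, ← (Equiv.prodComm (Fin n) (Fin n)).prod_comp fun x => if x.2 < x.1 then F x else 1,
    ← Finset.prod_mul_distrib]
  refine Finset.prod_congr rfl fun x _ => ?_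
  by_cases hx : x.1 < x.2 <;> simp [hx]

theorem koszulSign_id (d : Fin n → ℤ) : koszulSign d (id : Fin n → Fin n) = 1 :=
  Finset.prod_eq_one fun _ _ => if_neg fun h => h.1.asymm h.2

theorem koszulSign_mul_self {κ : Type*} [LinearOrder κ] (d : Fin n → ℤ) (c : Fin n → κ) :
    koszulSign d c * koszulSign d c = 1 := by
  rw [koszulSign_eq, ← Finset.prod_mul_distrib]
  refine Finset.prod_eq_one fun p _ => ?_
  split_ifs
  · exact esign_mul_self _
  · rfl

/-- The Koszul sign is a cocycle. For each pair of indices, the factor of the composition is the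
product of the factors of the two steps, since an exchange that is undone gives the factor `1`. -/
theorem koszulSign_mul (d : Fin n → ℤ) (σ τ : Equiv.Perm (Fin n)) :
    koszulSign d (σ * τ).symm = koszulSign d σ.symm * koszulSign (d ∘ σ) τ.symm := by
  have e2 : koszulSign (d ∘ σ) τ.symm = ∏ x : Fin n × Fin n, if x.1 < x.2 then
      (if σ.symm x.1 < σ.symm x.2 ∧ (σ * τ).symm x.2 < (σ * τ).symm x.1 then
        esign (d x.1 * d x.2) else 1) *
      (if σ.symm x.2 < σ.symm x.1 ∧ (σ * τ).symm x.1 < (σ * τ).symm x.2 then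
        esign (d x.2 * d x.1) else 1) else 1 := by
    rw [koszulSign_eq, ← (Equiv.prodCongr σ.symm σ.symm).prod_comp, prod_pairs_fold]
    · simp only [Equiv.Perm.mul_def, Equiv.symm_trans_apply, Equiv.prodCongr_apply, Prod.map,
        Prod.swap, Function.comp, Equiv.apply_symm_apply]
      congr!
    · simp
  rw [e2, koszulSign_eq, koszulSign_eq, ← Finset.prod_mul_distrib]
  refine Finset.prod_congr rfl fun x _ => ?_
  obtain ⟨p, q⟩ := x
  dsimp only
  by_cases hpq : p < q
  · have hne : σ.symm p ≠ σ.symm q := fun h => hpq.ne (σ.symm.injective h)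
    have hne' : (σ * τ).symm p ≠ (σ * τ).symm q := fun h => hpq.ne ((σ * τ).symm.injective h)
    rcases hne.lt_or_gt with h1 | h1 <;> rcases hne'.lt_or_gt with h2 | h2 <;>
      simp only [hpq, h1, h2, h1.asymm, h2.asymm, and_self, and_true, and_false, if_true,
        if_false, mul_one, one_mul, mul_comm (d q), esign_mul_self]
  · simp [hpq]

theorem koszulSign_swap (d : Fin (n + 1) → ℤ) (i : Fin n) :
    koszulSign d (Equiv.swap i.castSucc i.succ).symm = esign (d i.castSucc * d i.succ) := by
  rw [koszulSign_eq, Equiv.symm_swap, Finset.prod_eq_single (i.castSucc, i.succ)]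
  · rw [if_pos]
    simp
  · rintro ⟨p, q⟩ _ hne
    refine if_neg fun h => hne ?_
    simp only [Equiv.swap_apply_def, Fin.lt_def, Fin.ext_iff, Prod.mk.injEq,
      Fin.val_castSucc, Fin.val_succ] at h ⊢
    obtain ⟨h1, h2⟩ := h
    split_ifs at h2 <;> simp_all <;> omega
  · simp

end Koszul

section PermSymm

variable {α N : Type*} [AddCommGroup N] (w : α → ℤ)

/-- Transposing two adjacent arguments of a finite family, in terms of lists. -/
theorem ofFn_comp_swap {n : ℕ} {y : Fin (n + 1) → α} {i : Fin n} {l₁ l₂ : List α} {a b : α}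
    (hy : List.ofFn y = l₁ ++ a :: b :: l₂) (hi : l₁.length = i) :
    y i.castSucc = a ∧ y i.succ = b ∧
      List.ofFn (y ∘ Equiv.swap i.castSucc i.succ) = l₁ ++ b :: a :: l₂ := by
  have hget : ∀ (j : ℕ) (hj : j < n + 1), (l₁ ++ a :: b :: l₂)[j]? = some (y ⟨j, hj⟩) := by
    intro j hj
    rw [← hy, List.getElem?_ofFn, dif_pos hj]
  have ha : y i.castSucc = a := by
    have := hget i (by omega)
    simp [← hi] at this
    rw [this]
    congr 1
    exact Fin.ext hi.symm
  have hb : y i.succ = b := by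
    have := hget (l₁.length + 1) (by omega)
    rw [List.getElem?_append_right (by omega)] at this
    simp at this
    rw [this]
    congr 1
    exact Fin.ext (by simp [hi])
  refine ⟨ha, hb, ?_⟩
  have hlen : (List.ofFn y).length = l₁.length + (l₂.length + 2) := by
    rw [hy]; simp
  rw [List.length_ofFn] at hlen
  refine List.ext_getElem? fun j => ?_
  by_cases hj : j < n + 1
  · rw [List.getElem?_ofFn, dif_pos hj]
    have := hget j hj
    simp only [Function.comp, Equiv.swap_apply_def, Fin.ext_iff, Fin.val_castSucc, Fin.val_succ]
    rcases lt_trichotomy j l₁.length with h | h | h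
    · rw [if_neg (by omega), if_neg (by omega), ← this, List.getElem?_append_left h,
        List.getElem?_append_left h]
    · rw [if_pos (by omega), List.getElem?_append_right h.ge, hb, h]
      simp
    · rw [if_neg (by omega)]
      rw [List.getElem?_append_right h.le] at this ⊢
      obtain ⟨k, hk⟩ : ∃ k, j - l₁.length = k + 1 := ⟨j - l₁.length - 1, by omega⟩
      rw [hk] at this ⊢
      rcases k with _ | k
      · rw [if_pos (by omega), ha]; simp
      · rw [if_neg (by omega), ← this]; simp
  · rw [List.getElem?_eq_none (by simpa using hj), List.getElem?_eq_none (by simp; omega)]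

/-- Graded symmetry for adjacent transpositions implies it for all permutations. -/
theorem perm_symm_of_swap {F : List α → N}
    (hF : ∀ l₁ a b l₂, F (l₁ ++ a :: b :: l₂) = esign (w a * w b) • F (l₁ ++ b :: a :: l₂))
    {n : ℕ} (y : Fin n → α) (σ : Equiv.Perm (Fin n)) :
    F (List.ofFn (y ∘ σ)) = koszulSign (w ∘ y) σ.symm • F (List.ofFn y) := by
  cases n with
  | zero =>
    obtain rfl : σ = 1 := Subsingleton.elim _ _
    simp [koszulSign]
  | succ n =>
    have hσ : σ ∈ Submonoid.closure
        (Set.range fun i : Fin n => Equiv.swap i.castSucc i.succ) := by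
      rw [Equiv.Perm.mclosure_swap_castSucc_succ]; trivial
    induction hσ using Submonoid.closure_induction generalizing y with
    | mem σ h =>
      obtain ⟨i, rfl⟩ := h
      have hlt : (i : ℕ) + 1 < (List.ofFn y).length := by simp
      have hsplit : List.ofFn y = (List.ofFn y).take i ++
          y i.castSucc :: y i.succ :: (List.ofFn y).drop (i + 2) := by
        conv_lhs => rw [← List.take_append_drop i (List.ofFn y),
          List.drop_eq_getElem_cons (by omega), List.drop_eq_getElem_cons hlt]
        simp only [List.getElem_ofFn]
        rfl
      have := ofFn_comp_swap (i := i) hsplit (by simp; omega)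
      dsimp only
      rw [this.2.2, koszulSign_swap, hF]
      conv_rhs => rw [hsplit]
      rw [hF]
      simp only [Function.comp, smul_smul, mul_comm (w (y i.succ)), esign_mul_self, one_smul]
    | one =>
      rw [show (1 : Equiv.Perm (Fin (n + 1))).symm = 1 from rfl]
      simp [koszulSign_id (w ∘ y)]
    | mul σ τ _ _ h1 h2 =>
      rw [koszulSign_mul, mul_comm, ← smul_smul, ← h1]
      exact h2 (y ∘ σ)

/-- Graded symmetry for all permutations implies it for adjacent transpositions. -/
theorem swap_symm_of_perm {F : List α → N}
    (hF : ∀ (n : ℕ) (y : Fin n → α) (σ : Equiv.Perm (Fin n)),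
      F (List.ofFn (y ∘ σ)) = koszulSign (w ∘ y) σ.symm • F (List.ofFn y))
    (l₁ : List α) (a b : α) (l₂ : List α) :
    F (l₁ ++ a :: b :: l₂) = esign (w a * w b) • F (l₁ ++ b :: a :: l₂) := by
  have hlen : (l₁ ++ b :: a :: l₂).length = (l₁.length + l₂.length + 1) + 1 := by
    simp; omega
  obtain ⟨y, hy⟩ : ∃ y : Fin (l₁.length + l₂.length + 1 + 1) → α,
      List.ofFn y = l₁ ++ b :: a :: l₂ :=
    ⟨fun i => (l₁ ++ b :: a :: l₂)[i], by
      refine List.ext_getElem (by simp; omega) fun i h1 h2 => by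
        simp only [List.getElem_ofFn]; rfl⟩
  obtain ⟨h1, h2, h3⟩ := ofFn_comp_swap (i := ⟨l₁.length, by omega⟩) hy rfl
  rw [← h3, ← hy, hF, koszulSign_swap, Function.comp, Function.comp, h1, h2, mul_comm]

end PermSymm

section Shuffle

variable {α N : Type*} [AddCommGroup N]

theorem ofFn_sublist {n : ℕ} (y : Fin n → α) (I : Finset (Fin n)) :
    List.ofFn (sublist y I) = ((List.finRange n).filter (· ∈ I)).map y := by
  have h : List.ofFn (I.orderEmbOfFin rfl) = (List.finRange n).filter (· ∈ I) := by
    refine List.Perm.eq_of_pairwise (le := (· < ·)) (fun a b _ _ h1 h2 => (h1.asymm h2).elim)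
      ?_ ?_ ?_
    · rw [List.pairwise_ofFn]
      exact fun i j hij => (I.orderEmbOfFin rfl).strictMono hij
    · exact (List.pairwise_lt_finRange n).filter _
    · refine (List.perm_ext_iff_of_nodup ?_ ?_).2 fun a => ?_
      · exact List.nodup_ofFn.2 (I.orderEmbOfFin rfl).injective
      · exact (List.nodup_finRange n).filter _
      · rw [List.mem_ofFn', Finset.range_orderEmbOfFin]
        simp
  rw [← h, List.map_ofFn]
  rfl

theorem sum_finset_fin_succ {n : ℕ} (f : Finset (Fin (n + 1)) → N) :
    ∑ I, f I = ∑ I : Finset (Fin n),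
      (f (insert 0 (I.map (Fin.succEmb n))) + f (I.map (Fin.succEmb n))) := by
  have hu : (Finset.univ : Finset (Fin (n + 1))) =
      insert 0 (Finset.univ.map (Fin.succEmb n)) := by
    ext i; cases i using Fin.cases <;> simp
  rw [← Finset.powerset_univ, hu, Finset.sum_powerset_insert (by simp), add_comm,
    ← Finset.sum_add_distrib]
  symm
  refine Finset.sum_bij (fun I _ => I.map (Fin.succEmb n)) (fun I _ => ?_)
    (fun I _ J _ h => Finset.map_injective _ h) (fun J hJ => ?_) fun I _ => rfl
  · exact Finset.mem_powerset.2 (Finset.map_subset_map.2 (Finset.subset_univ _))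
  · obtain ⟨I, -, rfl⟩ := Finset.subset_map_iff.1 (Finset.mem_powerset.1 hJ)
    exact ⟨I, Finset.mem_univ _, rfl⟩

/-- The Koszul sign of a shuffle, in terms of the shuffle of all arguments except for the first one:
if the first argument is not moved to the front, then all arguments in `J` are moved past it. -/
theorem koszulSign_shuffleKey_succ {n : ℕ} (d : Fin (n + 1) → ℤ) (I : Finset (Fin (n + 1)))
    (J : Finset (Fin n)) (h : ∀ j, j.succ ∈ I ↔ j ∈ J) :
    koszulSign d (shuffleKey I) =
      (if 0 ∈ I then 1 else
        esign (d 0 * (((List.finRange n).filter (· ∈ J)).map (d ∘ Fin.succ)).sum)) *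
      koszulSign (d ∘ Fin.succ) (shuffleKey J) := by
  have hkey : ∀ j, shuffleKey I j.succ = shuffleKey J j := fun j => by simp [shuffleKey, h]
  simp only [koszulSign_eq, Fintype.prod_prod_type, Fin.prod_univ_succ (n := n), hkey,
    Fin.succ_lt_succ_iff, Fin.not_lt_zero, false_and, if_false, one_mul,
    Fin.succ_pos, true_and]
  congr 1
  split_ifs with h0
  · exact Finset.prod_eq_one fun j _ => if_neg (by simp [shuffleKey, h0])
  · have hsum : ∀ l : List (Fin n),
        esign (d 0 * ((l.filter (· ∈ J)).map (d ∘ Fin.succ)).sum) =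
          (l.map fun j => if j ∈ J then esign (d 0 * d j.succ) else 1).prod := by
      intro l
      induction l with
      | nil => simp [esign_zero]
      | cons j l ih =>
        by_cases hj : j ∈ J
        · simp [hj, mul_add, esign_add, ih]
        · simp [hj, ih]
    rw [hsum, ← List.ofFn_eq_map, List.prod_ofFn]
    refine Finset.prod_congr rfl fun j _ => ?_
    by_cases hj : j ∈ J <;> simp [shuffleKey, h0, hj]

/-- The sum over all shuffles, each of them given by the set of the arguments that are moved to the
front, is `splitSum`. -/
theorem sum_shuffle_eq_splitSum (w : α → ℤ) {n : ℕ} (y : Fin n → α)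
    (G : List α → List α → N) :
    ∑ I : Finset (Fin n), koszulSign (w ∘ y) (shuffleKey I) •
      G (List.ofFn (sublist y I)) (List.ofFn (sublist y Iᶜ)) = splitSum w (List.ofFn y) G := by
  simp only [ofFn_sublist, Finset.mem_compl]
  induction n generalizing G with
  | zero =>
    rw [Fintype.sum_eq_single ∅ fun I hI => (hI (Finset.eq_empty_of_isEmpty I)).elim]
    simp [koszulSign]
  | succ n ih =>
    rw [sum_finset_fin_succ, List.ofFn_succ, splitSum_cons, ← ih]
    refine Finset.sum_congr rfl fun I _ => ?_
    rw [koszulSign_shuffleKey_succ _ (insert 0 (I.map (Fin.succEmb n))) I (by simp),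
      koszulSign_shuffleKey_succ _ (I.map (Fin.succEmb n)) I (by simp)]
    simp only [List.finRange_succ, List.filter_cons, List.filter_map, Function.comp_def]
    simp [wt, Function.comp_def, smul_smul, smul_add, mul_comm]

end Shuffle

/-! ### Dual bases of graded projective modules -/

section DualBasis

variable {O M N B : Type*} [CommRing O] [AddCommGroup M] [Module O M]
  [AddCommGroup N] [Module O N]
  {deg : ℤ → Submodule O M}

/-- A homogeneous dual basis of a graded projective module: generators `val b` of degree `dg b`, and
a graded section `sec` of the surjection from the free module on the set `B` of generators. -/
structure GradedDualBasis (deg : ℤ → Submodule O M) (B : Type*) where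
  sec : M →ₗ[O] B →₀ O
  val : B → M
  dg : B → ℤ
  val_mem : ∀ b, val b ∈ deg (dg b)
  dg_eq : ∀ i, ∀ x ∈ deg i, ∀ b, sec x b ≠ 0 → dg b = i
  sum_sec : ∀ x, (sec x).sum (fun b r => r • val b) = x

namespace GradedDualBasis

variable (S : GradedDualBasis deg B)

/-- A generator, together with its degree. -/
def tag (b : B) : ℤ × M := (S.dg b, S.val b)

theorem homog_tag (c : List B) : Homog deg (c.map S.tag) := by
  intro p hp
  obtain ⟨b, -, rfl⟩ := List.mem_map.1 hp
  exact S.val_mem b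

theorem wt_tag (c : List B) : wt Prod.fst (c.map S.tag) = wt S.dg c := by
  simp [wt, Function.comp_def, tag]

/-- The `O`-multilinear extension of a function `g` on lists of generators, namely
`(x₁, …, xₙ) ↦ ∑ (sec x₁)(b₁) ⋯ (sec xₙ)(bₙ) • g (b₁, …, bₙ)`. -/
noncomputable def ext : List M → (List B → N) → N
  | [], g => g []
  | x :: l, g => (S.sec x).sum fun b r => r • ext l fun c => g (b :: c)

/-- The lists of generators that occur in the expansion of a list of elements. -/
def Occurs (l : List M) (c : List B) : Prop :=
  List.Forall₂ (fun x b => S.sec x b ≠ 0) l c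

@[simp] theorem ext_nil (g : List B → N) : S.ext [] g = g [] := rfl

theorem ext_cons (x : M) (l : List M) (g : List B → N) :
    S.ext (x :: l) g = (S.sec x).sum fun b r => r • S.ext l fun c => g (b :: c) := rfl

theorem ext_congr {l : List M} {g g' : List B → N} (h : ∀ c, S.Occurs l c → g c = g' c) :
    S.ext l g = S.ext l g' := by
  induction l generalizing g g' with
  | nil => exact h [] .nil
  | cons x l ih =>
    refine Finsupp.sum_congr fun b hb => ?_
    rw [ih fun c hc => h (b :: c) (.cons (Finsupp.mem_support_iff.1 hb) hc)]

theorem ext_zero (l : List M) : S.ext l (fun _ => (0 : N)) = 0 := by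
  induction l with
  | nil => rfl
  | cons x l ih => simp [ext_cons, ih]

theorem ext_eq_zero {l : List M} {g : List B → N} (h : ∀ c, S.Occurs l c → g c = 0) :
    S.ext l g = 0 := (S.ext_congr h).trans (S.ext_zero l)

theorem ext_add (l : List M) (g g' : List B → N) :
    S.ext l (fun c => g c + g' c) = S.ext l g + S.ext l g' := by
  induction l generalizing g g' with
  | nil => rfl
  | cons x l ih => simp only [ext_cons, ih, smul_add, Finsupp.sum_add]

theorem map_ext {N' : Type*} [AddCommGroup N'] [Module O N'] (θ : N →ₗ[O] N') (l : List M)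
    (g : List B → N) : θ (S.ext l g) = S.ext l fun c => θ (g c) := by
  induction l generalizing g with
  | nil => rfl
  | cons x l ih => simp only [ext_cons, Finsupp.sum, map_sum, map_smul, ih]

theorem ext_smul (l : List M) (f : O) (g : List B → N) :
    S.ext l (fun c => f • g c) = f • S.ext l g := (S.map_ext (LinearMap.lsmul O N f) l g).symm

theorem ext_zsmul (l : List M) (k : ℤ) (g : List B → N) :
    S.ext l (fun c => k • g c) = k • S.ext l g := by
  simp only [← Int.cast_smul_eq_zsmul O, ext_smul]

theorem ext_linear (l₁ l₂ : List M) (g : List B → N) :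
    IsLinearMap O fun x => S.ext (l₁ ++ x :: l₂) g := by
  induction l₁ generalizing g with
  | nil =>
    simp only [List.nil_append, ext_cons]
    constructor
    · intro x y
      rw [map_add, Finsupp.sum_add_index' (by simp) (by simp [add_smul])]
    · intro f x
      rw [map_smul, Finsupp.sum_smul_index' (by simp), Finsupp.smul_sum]
      simp [smul_smul]
  | cons p l ih =>
    simp only [List.cons_append, ext_cons]
    constructor
    · intro x y
      simp only [(ih _).map_add, smul_add, Finsupp.sum_add]
    · intro f x
      simp only [(ih _).map_smul, Finsupp.smul_sum, smul_comm f]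

theorem ext_mem {P : Submodule O N} {l : List M} {g : List B → N}
    (h : ∀ c, S.Occurs l c → g c ∈ P) : S.ext l g ∈ P := by
  induction l generalizing g with
  | nil => exact h [] .nil
  | cons x l ih =>
    exact P.sum_mem fun b hb => P.smul_mem _
      (ih fun c hc => h (b :: c) (.cons (Finsupp.mem_support_iff.1 hb) hc))

variable {S}

theorem Occurs.length_eq {l : List M} {c : List B} (h : S.Occurs l c) : c.length = l.length :=
  (List.Forall₂.length_eq h).symm

theorem Occurs.map_dg {l : List (ℤ × M)} {c : List B} (hl : Homog deg l)
    (h : S.Occurs (vals l) c) : c.map S.dg = l.map Prod.fst := by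
  induction l generalizing c with
  | nil => cases h; rfl
  | cons p l ih =>
    cases h with
    | cons h1 h2 =>
      rw [homog_cons] at hl
      rw [List.map_cons, List.map_cons, ih hl.2 h2, S.dg_eq _ _ hl.1 _ h1]

theorem Occurs.wt_eq {l : List (ℤ × M)} {c : List B} (hl : Homog deg l)
    (h : S.Occurs (vals l) c) : wt S.dg c = wt Prod.fst l := by
  rw [wt, wt, h.map_dg hl]

theorem Occurs.dg_neg (hbot : ∀ i, 0 ≤ i → deg i = ⊥) {l : List (ℤ × M)} {c : List B}
    (hl : Homog deg l) (h : S.Occurs (vals l) c) : ∀ b ∈ c, S.dg b < 0 := by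
  induction l generalizing c with
  | nil => cases h; simp
  | cons p l ih =>
    cases h with
    | @cons _ b _ c h1 h2 =>
      rw [homog_cons] at hl
      intro b' hb'
      rcases List.mem_cons.1 hb' with rfl | hb'
      · by_contra! hneg
        have h0 : p.2 = 0 := by simpa [hbot _ hneg, ← S.dg_eq _ _ hl.1 _ h1] using hl.1
        simp [h0] at h1
      · exact ih hl.2 h2 b' hb'

variable (S)

/-- A multilinear function is the extension of its restriction to generators. -/
theorem ext_eq_of_multiLin {F : List (ℤ × M) → N} (hF : MultiLin deg F) {l : List (ℤ × M)}
    (hl : Homog deg l) : S.ext (vals l) (fun c => F (c.map S.tag)) = F l := by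
  induction l generalizing F with
  | nil => rfl
  | cons p l ih =>
    obtain ⟨a, x⟩ := p
    rw [homog_cons] at hl
    change S.ext (x :: vals l) _ = _
    rw [ext_cons]
    have h1 : ∀ b ∈ (S.sec x).support, S.dg b = a ∧ S.val b ∈ deg a := fun b hb => by
      have : S.dg b = a := S.dg_eq _ _ hl.1 b (Finsupp.mem_support_iff.1 hb)
      exact ⟨this, this ▸ S.val_mem b⟩
    have h2 : ∀ b ∈ (S.sec x).support, S.sec x b • S.ext (vals l) (fun c =>
        F ((b :: c).map S.tag)) = F ((a, S.sec x b • S.val b) :: l) := fun b hb => by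
      have h3 := ih (hF.cons (p := S.tag b) (S.val_mem b)) hl.2
      simp only [List.map_cons]
      rw [h3, tag, (h1 b hb).1]
      exact (hF.smul [] l a _ _ homog_nil hl.2 (h1 b hb).2).symm
    have h4 : ∀ s : Finset B, (∀ b ∈ s, S.val b ∈ deg a) → ∀ r : B → O,
        F ((a, ∑ b ∈ s, r b • S.val b) :: l) = ∑ b ∈ s, F ((a, r b • S.val b) :: l) := by
      classical
      intro s hs r
      induction s using Finset.induction_on with
      | empty =>
        simpa using hF.smul [] l a (0 : O) (0 : M) homog_nil hl.2 (zero_mem _)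
      | insert b s hb ihs =>
        have hs' : ∀ b ∈ s, S.val b ∈ deg a := fun b hb => hs b (Finset.mem_insert_of_mem hb)
        rw [Finset.sum_insert hb, Finset.sum_insert hb, ← ihs hs']
        exact hF.add [] l a _ _ homog_nil hl.2
          (Submodule.smul_mem _ _ (hs b (Finset.mem_insert_self _ _)))
          (Submodule.sum_mem _ fun b hb => Submodule.smul_mem _ _ (hs' b hb))
    rw [Finsupp.sum, Finset.sum_congr rfl h2, ← h4 _ (fun b hb => (h1 b hb).2)]
    conv_rhs => rw [← S.sum_sec x]
    rfl

/-- The multilinear extension of a graded symmetric function is graded symmetric. -/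
theorem ext_swap {g : List B → N}
    (hg : ∀ l₁ a b l₂, g (l₁ ++ a :: b :: l₂) =
      esign (S.dg a * S.dg b) • g (l₁ ++ b :: a :: l₂)) :
    SwapSymm deg fun l => S.ext (vals l) g := by
  intro l₁ p p' l₂ hl
  have key : ∀ l : List M, S.ext (l ++ p.2 :: p'.2 :: vals l₂) g =
      esign (p.1 * p'.1) • S.ext (l ++ p'.2 :: p.2 :: vals l₂) g := by
    intro l
    induction l generalizing g with
    | nil =>
      simp only [List.nil_append, ext_cons]
      rw [← Int.cast_smul_eq_zsmul O, Finsupp.smul_sum]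
      simp only [Finsupp.sum, Finset.smul_sum]
      rw [Finset.sum_comm]
      refine Finset.sum_congr rfl fun b hb => Finset.sum_congr rfl fun a ha => ?_
      have hl := homog_cons.1 (homog_append.1 hl).2
      rw [← S.dg_eq _ _ hl.1 a (Finsupp.mem_support_iff.1 ha),
        ← S.dg_eq _ _ (homog_cons.1 hl.2).1 b (Finsupp.mem_support_iff.1 hb)]
      have := fun c => hg [] a b c
      simp only [List.nil_append] at this
      simp only [this]
      rw [ext_zsmul]
      simp only [← Int.cast_smul_eq_zsmul O, smul_smul]
      congr 1
      ring
    | cons x l ih =>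
      simp only [List.cons_append, ext_cons]
      rw [← Int.cast_smul_eq_zsmul O, Finsupp.smul_sum]
      refine Finsupp.sum_congr fun b _ => ?_
      rw [ih (g := fun c => g (b :: c)) (fun l₁ => hg (b :: l₁)), smul_comm,
        Int.cast_smul_eq_zsmul]
  simpa using key (vals l₁)

open Nat in
/-- Equivariant lifting: if a graded symmetric function `F` can be lifted through `θ` pointwise on
lists of generators that satisfy `P`, then it has a graded symmetric lift there, the average of all
permutations of a pointwise lift. The lift can be chosen to vanish where `F` does. -/
theorem exists_symm_lift (K : Type*) [Field K] [CharZero K] [Algebra K O]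
    (θ : M →ₗ[O] N) {F : List (ℤ × M) → N} (hF : SwapSymm deg F) (P : List B → Prop)
    (hP : ∀ c c', c.Perm c' → P c → P c')
    (h : ∀ c, P c → ∃ y ∈ deg (wt S.dg c + 1), θ y = F (c.map S.tag)) :
    ∃ g : List B → M, (∀ c, ¬P c → g c = 0) ∧ (∀ c, g c ∈ deg (wt S.dg c + 1)) ∧
      (∀ l₁ a b l₂, g (l₁ ++ a :: b :: l₂) =
        esign (S.dg a * S.dg b) • g (l₁ ++ b :: a :: l₂)) ∧
      (∀ c, F (c.map S.tag) = 0 → g c = 0) ∧ ∀ c, P c → θ (g c) = F (c.map S.tag) := by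
  classical
  have h' : ∀ c, ∃ y ∈ deg (wt S.dg c + 1), (P c → θ y = F (c.map S.tag)) ∧
      (F (c.map S.tag) = 0 → y = 0) := fun c => by
    by_cases h0 : P c ∧ F (c.map S.tag) ≠ 0
    · obtain ⟨y, hy, hy'⟩ := h c h0.1
      exact ⟨y, hy, fun _ => hy', fun h1 => (h0.2 h1).elim⟩
    · refine ⟨0, zero_mem _, fun hc => ?_, fun _ => rfl⟩
      rw [map_zero]
      by_contra h1
      exact h0 ⟨hc, Ne.symm h1⟩
  choose y hy hyF hy0 using h'
  have hFperm : ∀ {n : ℕ} (z : Fin n → B) (σ : Equiv.Perm (Fin n)),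
      F ((List.ofFn (z ∘ σ)).map S.tag) =
        koszulSign (S.dg ∘ z) σ.symm • F ((List.ofFn z).map S.tag) :=
    perm_symm_of_swap (F := fun c => F (c.map S.tag)) S.dg fun l₁ a b l₂ => by
      have := hF (l₁.map S.tag) (S.tag a) (S.tag b) (l₂.map S.tag)
        (by simpa using S.homog_tag (l₁ ++ a :: b :: l₂))
      simpa [tag] using this
  have hperm : ∀ {n : ℕ} (z : Fin n → B) (σ : Equiv.Perm (Fin n)),
      (List.ofFn (z ∘ σ)).Perm (List.ofFn z) := fun z σ => Equiv.Perm.ofFn_comp_perm σ z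
  let avg : (n : ℕ) → (Fin n → B) → M := fun n z => algebraMap K O ((n ! : K)⁻¹) •
    ∑ σ : Equiv.Perm (Fin n), koszulSign (S.dg ∘ z) σ.symm • y (List.ofFn (z ∘ σ))
  have havg : ∀ {n : ℕ} (z : Fin n → B) (τ : Equiv.Perm (Fin n)),
      avg n (z ∘ τ) = koszulSign (S.dg ∘ z) τ.symm • avg n z := by
    intro n z τ
    simp only [avg]
    rw [smul_comm (koszulSign (S.dg ∘ z) τ.symm)]
    congr 1
    rw [Finset.smul_sum, ← Equiv.sum_comp (Equiv.mulLeft τ) fun σ : Equiv.Perm (Fin n) =>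
      koszulSign (S.dg ∘ z) τ.symm • koszulSign (S.dg ∘ z) σ.symm • y (List.ofFn (z ∘ σ))]
    refine Finset.sum_congr rfl fun σ _ => ?_
    rw [Equiv.coe_mulLeft, koszulSign_mul, smul_smul, ← mul_assoc, koszulSign_mul_self, one_mul]
    rfl
  let g : List B → M := fun c => if P c then avg c.length c.get else 0
  have hg : ∀ {n : ℕ} (z : Fin n → B), P (List.ofFn z) → g (List.ofFn z) = avg n z := by
    intro n z hz
    have : ∀ (m : ℕ) (e : m = n) (z' : Fin m → B), (∀ i, z' i = z (Fin.cast e i)) →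
        avg m z' = avg n z := by
      rintro m rfl z' hz'
      rw [show z' = z from funext hz']
    simp only [g, if_pos hz]
    exact this _ (by simp) _ fun i => by simp; rfl
  refine ⟨g, fun c hc => if_neg hc, fun c => ?_, ?_, fun c hc => ?_, fun c hc => ?_⟩
  · obtain ⟨n, z, rfl⟩ : ∃ n, ∃ z : Fin n → B, List.ofFn z = c := ⟨_, _, List.ofFn_get c⟩
    by_cases hc : P (List.ofFn z)
    · rw [hg z hc]
      refine Submodule.smul_mem _ _ (Submodule.sum_mem _ fun σ _ => zsmul_mem ?_ _)
      rw [← (hperm z σ).wt_eq]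
      exact hy _
    · simp only [g, if_neg hc, zero_mem]
  · refine swap_symm_of_perm S.dg fun n z σ => ?_
    by_cases hc : P (List.ofFn z)
    · rw [hg z hc, hg _ (hP _ _ (hperm z σ).symm hc), havg]
    · have hc' : ¬P (List.ofFn (z ∘ σ)) := fun h => hc (hP _ _ (hperm z σ) h)
      simp only [g, if_neg hc, if_neg hc', smul_zero]
  · obtain ⟨n, z, rfl⟩ : ∃ n, ∃ z : Fin n → B, List.ofFn z = c := ⟨_, _, List.ofFn_get c⟩
    by_cases hP : P (List.ofFn z)
    · rw [hg z hP]
      simp only [avg]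
      rw [Finset.sum_eq_zero, smul_zero]
      intro σ _
      rw [hy0 _ (by rw [hFperm, hc, smul_zero]), smul_zero]
    · simp only [g, if_neg hP]
  · obtain ⟨n, z, rfl⟩ : ∃ n, ∃ z : Fin n → B, List.ofFn z = c := ⟨_, _, List.ofFn_get c⟩
    rw [hg z hc]
    simp only [avg]
    rw [map_smul, map_sum]
    have : ∀ σ ∈ (Finset.univ : Finset (Equiv.Perm (Fin n))),
        θ (koszulSign (S.dg ∘ z) σ.symm • y (List.ofFn (z ∘ σ))) =
          F ((List.ofFn z).map S.tag) := by
      intro σ _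
      rw [map_zsmul, hyF _ (hP _ _ (hperm z σ).symm hc), hFperm, smul_smul, koszulSign_mul_self,
        one_smul]
    rw [Finset.sum_congr rfl this, Finset.sum_const, Finset.card_univ, Fintype.card_perm,
      Fintype.card_fin, ← Nat.cast_smul_eq_nsmul O, smul_smul, ← map_natCast (algebraMap K O),
      ← map_mul, inv_mul_cancel₀ (Nat.cast_ne_zero.2 n.factorial_ne_zero), map_one, one_smul]

end GradedDualBasis

end DualBasis

/-! ### Partial brackets and their corrections -/

section AnchorVia

variable {K O M A : Type*} [Field K] [CommRing O] [Algebra K O]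
  [AddCommGroup M] [Module O M]
  [LieRing A] [LieAlgebra K A] [Module O A] [LieRingModule A O] [LieRinehartRing O A]
  [LieRinehartAlgebra K O A]

variable (K) in
/-- The anchor on `M` that is induced by a map to a Lie–Rinehart algebra. -/
def anchorVia (π : M →ₗ[O] A) : M →ₗ[O] Derivation K O O where
  toFun x := LieRinehartAlgebra.anchor K O A (π x)
  map_add' x y := by
    rw [_root_.map_add]; exact (LieRinehartAlgebra.anchor K O A).toLieHom.map_add _ _
  map_smul' f x := by
    rw [_root_.map_smul]; exact (LieRinehartAlgebra.anchor K O A).map_smul_apply f (π x)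

theorem anchorVia_lie (π : M →ₗ[O] A) {x y z : M} (h : π z = ⁅π x, π y⁆) :
    anchorVia K π z = ⁅anchorVia K π x, anchorVia K π y⁆ := by
  change LieRinehartAlgebra.anchor K O A (π z) = _
  rw [h]
  exact (LieRinehartAlgebra.anchor K O A).toLieHom.map_lie _ _

end AnchorVia

section HookDefect

variable {O M A : Type*} [CommRing O] [AddCommGroup M] [Module O M] [LieRing A] [Module O A]
  {π : M →ₗ[O] A} {q : List M → M}

/-- The failure of the compatibility of the binary bracket with the bracket of `A`. -/
def hookDefect (π : M →ₗ[O] A) (q : List M → M) : List (ℤ × M) → A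
  | [p, p'] => ⁅π p.2, π p'.2⁆ - π (q [p.2, p'.2])
  | _ => 0

theorem hookDefect_of_length {l : List (ℤ × M)} (h : l.length ≠ 2) : hookDefect π q l = 0 := by
  match l, h with
  | [], _ => rfl
  | [_], _ => rfl
  | [_, _], h => simp at h
  | _ :: _ :: _ :: _, _ => rfl

end HookDefect

section Correction

variable {K O M A B : Type*} [Field K] [CommRing O] [Algebra K O]
  [AddCommGroup M] [Module K M] [Module O M] [IsScalarTower K O M]
  [LieRing A] [LieAlgebra K A] [Module O A] [LieRingModule A O] [LieRinehartRing O A]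
  [LieRinehartAlgebra K O A]
  {deg : ℤ → Submodule O M}

/-- Brackets on a projective resolution of the Lie–Rinehart algebra `A`, whose unary part is the
differential of the resolution, and which satisfy the higher Jacobi identities and the
compatibility with the Lie bracket of `A` on the submodule `M₀`. -/
structure IsPartialBracket (K : Type*) [Field K] [Algebra K O] [Module K M] [IsScalarTower K O M]
    [LieAlgebra K A] [LieRinehartAlgebra K O A] (S : GradedDualBasis deg B) (M₀ : Submodule O M)
    (π : M →ₗ[O] A) (q : List M → M) : Prop extends
    IsLeibnizBracket deg (anchorVia K π) q where
  hook_eq_zero : ∀ i, i ≠ -1 → ∀ x ∈ deg i, π x = 0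
  hook_differential : ∀ x, π (q [x]) = 0
  differential_comp : ∀ x, q [q [x]] = 0
  surjective : ∀ a : A, ∃ x ∈ deg (-1), π x = a
  exact_hook : ∀ x ∈ deg (-1), π x = 0 → ∃ y ∈ deg (-2), q [y] = x
  exact_differential : ∀ i, i ≤ -2 → ∀ x ∈ deg i, q [x] = 0 → ∃ y ∈ deg (i - 1), q [y] = x
  sec_mem : ∀ x ∈ M₀, ∀ b, S.sec x b ≠ 0 → S.val b ∈ M₀
  bracket_mem : ∀ l, (∀ x ∈ l, x ∈ M₀) → q l ∈ M₀
  hook_bracket : ∀ x ∈ M₀, ∀ y ∈ M₀, x ∈ deg (-1) → y ∈ deg (-1) → π (q [x, y]) = ⁅π x, π y⁆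
  jac_eq_zero : ∀ l, Homog deg l → (∀ x ∈ vals l, x ∈ M₀) → jac q l = 0

/-- A graded symmetric function `g` on lists of generators, the `O`-multilinear extension of which
can be added to a family of brackets without changing the unary bracket and the brackets on `M₀`. -/
structure IsCorrection (S : GradedDualBasis deg B) (M₀ : Submodule O M) (g : List B → M) :
    Prop where
  eq_zero_of_length : ∀ c, c.length < 2 → g c = 0
  mem_deg : ∀ c, g c ∈ deg (wt S.dg c + 1)
  swap : ∀ l₁ a b l₂, g (l₁ ++ a :: b :: l₂) =
    esign (S.dg a * S.dg b) • g (l₁ ++ b :: a :: l₂)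
  eq_zero_of_mem : ∀ c, (∀ b ∈ c, S.val b ∈ M₀) → g c = 0

/-- The family of brackets `q`, corrected by the multilinear extension of `g`. -/
noncomputable def corrected (S : GradedDualBasis deg B) (q : List M → M) (g : List B → M)
    (l : List M) : M := q l + S.ext l g

variable {S : GradedDualBasis deg B} {M₀ : Submodule O M} {π : M →ₗ[O] A} {q : List M → M}
  {g g' : List B → M}

namespace IsCorrection

theorem add (hg : IsCorrection S M₀ g) (hg' : IsCorrection S M₀ g') :
    IsCorrection S M₀ fun c => g c + g' c where
  eq_zero_of_length c hc := by
    rw [hg.eq_zero_of_length c hc, hg'.eq_zero_of_length c hc, add_zero]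
  mem_deg c := add_mem (hg.mem_deg c) (hg'.mem_deg c)
  swap l₁ a b l₂ := by rw [hg.swap, hg'.swap, smul_add]
  eq_zero_of_mem c hc := by rw [hg.eq_zero_of_mem c hc, hg'.eq_zero_of_mem c hc, add_zero]

theorem corrected_singleton (hg : IsCorrection S M₀ g) (x : M) :
    corrected S q g [x] = q [x] := by
  rw [corrected, S.ext_eq_zero, add_zero]
  intro c hc
  exact hg.eq_zero_of_length c (by rw [hc.length_eq]; simp)

theorem corrected_of_mem (hg : IsCorrection S M₀ g)
    (hsec : ∀ x ∈ M₀, ∀ b, S.sec x b ≠ 0 → S.val b ∈ M₀) {l : List M} (hl : ∀ x ∈ l, x ∈ M₀) :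
    corrected S q g l = q l := by
  rw [corrected, S.ext_eq_zero, add_zero]
  intro c hc
  refine hg.eq_zero_of_mem c ?_
  induction hc with
  | nil => simp
  | @cons x b l c h1 _ ih =>
    have := ih fun x hx => hl x (List.mem_cons_of_mem _ hx)
    simpa using ⟨hsec x (hl x List.mem_cons_self) b h1, this⟩

end IsCorrection

namespace IsPartialBracket

theorem corrected (hq : IsPartialBracket K S M₀ π q) (hg : IsCorrection S M₀ g) :
    IsPartialBracket K S M₀ π (corrected S q g) where
  nil := by
    rw [_root_.corrected, hq.nil, S.ext_nil, hg.eq_zero_of_length [] (by simp), add_zero]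
  linear l₁ l₂ := by
    have h := S.ext_linear l₁ l₂ g
    constructor
    · intro x y
      simp only [_root_.corrected, (hq.linear l₁ l₂).map_add, h.map_add]
      abel
    · intro k x
      simp only [_root_.corrected, (hq.linear l₁ l₂).map_smul, smul_add]
      rw [← algebraMap_smul O k x, h.map_smul, algebraMap_smul]
  mem_deg l hl := add_mem (hq.mem_deg l hl) (S.ext_mem fun c hc => by
    rw [← hc.wt_eq hl]; exact hg.mem_deg c)
  swap l₁ a b l₂ hl := by
    have h1 := hq.swap l₁ a b l₂ hl
    have h2 := S.ext_swap hg.swap l₁ a b l₂ hl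
    dsimp only at h1 h2
    simp only [_root_.corrected, h1, h2, smul_add]
  smul l₁ l₂ f x h := by
    simp only [_root_.corrected, hq.smul l₁ l₂ f x h, (S.ext_linear l₁ l₂ g).map_smul, smul_add]
  leibniz x y f := by
    have h := (S.ext_linear [x] [] g).map_smul f y
    simp only [List.cons_append, List.nil_append] at h
    rw [_root_.corrected, _root_.corrected, hq.leibniz, h, smul_add, add_assoc]
  deg_eq_bot := hq.deg_eq_bot
  anchor_eq_zero := hq.anchor_eq_zero
  hook_eq_zero := hq.hook_eq_zero
  hook_differential x := by rw [hg.corrected_singleton, hq.hook_differential]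
  differential_comp x := by
    rw [hg.corrected_singleton, hg.corrected_singleton, hq.differential_comp]
  surjective := hq.surjective
  exact_hook x := by simpa only [hg.corrected_singleton] using hq.exact_hook x
  exact_differential i := by
    simpa only [hg.corrected_singleton] using hq.exact_differential i
  sec_mem := hq.sec_mem
  bracket_mem l hl := by rw [hg.corrected_of_mem hq.sec_mem hl]; exact hq.bracket_mem l hl
  hook_bracket x hx y hy := by
    rw [hg.corrected_of_mem hq.sec_mem (by simp [hx, hy])]
    exact hq.hook_bracket x hx y hy
  jac_eq_zero l hl hl₀ := by
    rw [← hq.jac_eq_zero l hl hl₀]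
    refine splitSum_congr _ fun I J hIJ => ?_
    have h : ∀ x ∈ vals I ++ vals J, x ∈ M₀ := fun x hx => hl₀ x (by
      rw [← List.map_append] at hx
      exact (hIJ.map Prod.snd).mem_iff.1 hx)
    have hI : ∀ x ∈ vals I, x ∈ M₀ := fun x hx => h x (List.mem_append_left _ hx)
    rw [hg.corrected_of_mem hq.sec_mem hI, hg.corrected_of_mem hq.sec_mem]
    intro x hx
    rcases List.mem_cons.1 hx with rfl | hx
    · exact hq.bracket_mem _ hI
    · exact h x (List.mem_append_right _ hx)

/-- The differential, as an `O`-linear map. -/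
def differential (hq : IsPartialBracket K S M₀ π q) : M →ₗ[O] M where
  toFun x := q [x]
  map_add' x y := hq.map_add x y []
  map_smul' f x := hq.smul [] [] f x (by simp)

theorem hookDefect_swap (hq : IsPartialBracket K S M₀ π q) : SwapSymm deg (hookDefect π q) := by
  intro l₁ p p' l₂ hl
  by_cases h : l₁ = [] ∧ l₂ = []
  · obtain ⟨rfl, rfl⟩ := h
    obtain ⟨a, x⟩ := p
    obtain ⟨b, y⟩ := p'
    simp only [List.nil_append, homog_cons] at hl
    have h1 := hq.swap_head hl.1 hl.2.1 homog_nil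
    simp only [List.map_nil] at h1
    simp only [List.nil_append, hookDefect]
    rw [h1, map_zsmul, smul_sub, ← lie_skew]
    congr 1
    by_cases ha : a = -1
    · by_cases hb : b = -1
      · rw [ha, hb, show esign (-1 * -1) = -1 from esign_one, neg_one_smul]
      · simp [hq.hook_eq_zero b hb y hl.2.1]
    · simp [hq.hook_eq_zero a ha x hl.1]
  · have : l₁.length + l₂.length ≠ 0 := by
      simpa [← List.length_eq_zero_iff] using h
    rw [hookDefect_of_length (by simp; omega), hookDefect_of_length (by simp; omega), smul_zero]

theorem hookDefect_multiLin (hq : IsPartialBracket K S M₀ π q) :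
    MultiLin deg (hookDefect π q) := by
  refine hq.hookDefect_swap.multiLin (fun l a x y _ _ _ => ?_) (fun l a f x hl hx => ?_)
  · match l with
    | [] => simp [hookDefect]
    | [p] =>
      simp only [hookDefect, hq.map_add, _root_.map_add, add_lie]
      abel
    | _ :: _ :: _ => simp [hookDefect]
  · match l, hl with
    | [], _ => simp [hookDefect]
    | [p], hl =>
      have h := hq.smul_cons hx hl f
      simp only [List.map_cons, List.map_nil, IsLeibnizBracket.anomaly] at h
      simp only [hookDefect, h, _root_.map_add, _root_.map_smul, map_zsmul]
      rw [← lie_skew, LieRinehartRing.leibniz_smul_right, ← lie_skew (π x)]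
      have e : esign a • (anchorVia K π p.2) f • π x = - (⁅π p.2, f⁆ • π x) := by
        by_cases ha : a = -1
        · rw [ha, show esign (-1) = -1 by rw [esign_neg, esign_one], neg_one_smul]
          rfl
        · simp [hq.hook_eq_zero a ha x hx]
      rw [e, smul_sub, smul_neg]
      abel
    | _ :: _ :: _, _ => simp [hookDefect]

/-- The binary bracket can be corrected such that it is compatible with the bracket of `A`. -/
theorem exists_hook_correction [CharZero K] (hq : IsPartialBracket K S M₀ π q) :
    ∃ g, IsCorrection S M₀ g ∧ (∀ c, wt S.dg c ≠ -2 → g c = 0) ∧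
      ∀ x ∈ deg (-1), ∀ y ∈ deg (-1), π (_root_.corrected S q g [x, y]) = ⁅π x, π y⁆ := by
  obtain ⟨g, h1, h2, h3, h4, h5⟩ := S.exists_symm_lift K π hq.hookDefect_swap
    (fun c => c.map S.dg = [-1, -1])
    (fun c c' hc h => by
      have := (hc.map S.dg).symm
      rw [h] at this
      exact List.perm_replicate.1
        (show (c'.map S.dg).Perm (List.replicate 2 (-1)) from this))
    (fun c hc => by
      obtain ⟨y, hy, hy'⟩ := hq.surjective (hookDefect π q (c.map S.tag))
      refine ⟨y, ?_, hy'⟩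
      rw [wt, hc]
      exact hy)
  refine ⟨g, ⟨fun c hc => h1 c fun h => ?_, h2, h3, fun c hc => ?_⟩, fun c hc => h1 c fun h => ?_,
    fun x hx y hy => ?_⟩
  · have := congrArg List.length h
    simp at this
    omega
  · by_cases h : c.map S.dg = [-1, -1]
    · refine h4 c ?_
      obtain ⟨b, b', rfl⟩ := List.length_eq_two.1
        (by simpa using congrArg List.length h : c.length = 2)
      simp only [List.map_cons, List.map_nil, List.cons.injEq, and_true] at h
      simp only [List.mem_cons, List.not_mem_nil, or_false, forall_eq_or_imp, forall_eq] at hc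
      have := hq.hook_bracket _ hc.1 _ hc.2 (h.1 ▸ S.val_mem b) (h.2 ▸ S.val_mem b')
      simp [hookDefect, GradedDualBasis.tag, this]
    · exact h1 c h
  · rw [wt, h] at hc
    exact hc rfl
  · have hl : Homog deg [(-1, x), (-1, y)] := by simp [hx, hy, homog_nil]
    have h6 : π (S.ext [x, y] g) = hookDefect π q [(-1, x), (-1, y)] := by
      rw [← S.ext_eq_of_multiLin hq.hookDefect_multiLin hl, S.map_ext]
      refine S.ext_congr fun c hc => h5 c ?_
      exact GradedDualBasis.Occurs.map_dg (l := [(-1, x), (-1, y)]) hl hc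
    rw [_root_.corrected, _root_.map_add, h6, hookDefect]
    abel

end IsPartialBracket

end Correction

/-! ### Obstruction theory for the higher Jacobi identities -/

namespace IsGradedBracket

variable {K O M : Type*} [Field K] [CommRing O]
  [AddCommGroup M] [Module K M] [Module O M] {deg : ℤ → Submodule O M} {q q' : List M → M}

theorem jac_eq_zero_of_not_neg (hq : IsGradedBracket K deg q) (hbot : ∀ i, 0 ≤ i → deg i = ⊥)
    {l : List (ℤ × M)} (hl : Homog deg l) (h : ¬∀ p ∈ l, p.1 < 0) : jac q l = 0 := by
  refine splitSum_eq_zero _ fun I J hIJ => ?_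
  have h0 := (hIJ.map Prod.snd).mem_iff.2 (exists_zero_mem hbot hl h)
  rw [List.map_append, List.mem_append] at h0
  rcases h0 with h0 | h0
  · rw [hq.eq_zero_of_mem h0, hq.zero_cons]
  · exact hq.eq_zero_of_mem (List.mem_cons_of_mem _ h0)

/-- The Jacobiator on arguments of total degree `≥ m` depends only on the brackets of arguments of
total degree `≥ m`. -/
theorem jac_congr (hq : IsGradedBracket K deg q) (hq' : IsGradedBracket K deg q')
    (hbot : ∀ i, 0 ≤ i → deg i = ⊥) {m : ℤ}
    (h : ∀ l, Homog deg l → m ≤ wt Prod.fst l → q (vals l) = q' (vals l)) {l : List (ℤ × M)}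
    (hl : Homog deg l) (hm : m ≤ wt Prod.fst l) : jac q l = jac q' l := by
  by_cases hneg : ∀ p ∈ l, p.1 < 0
  · refine splitSum_congr _ fun I J hIJ => ?_
    have hIJ' := homog_append.1 (hl.perm hIJ)
    have hJ := wt_le_neg_length Prod.fst (l := J) fun p hp =>
      hneg p (hIJ.mem_iff.1 (List.mem_append_right _ hp))
    have hw := hIJ.wt_eq Prod.fst
    rw [wt_append] at hw
    rw [← h I hIJ'.1 (by omega)]
    refine h ((wt Prod.fst I + 1, q (vals I)) :: J)
      (homog_cons.2 ⟨hq.mem_deg _ hIJ'.1, hIJ'.2⟩) ?_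
    rw [wt_cons]
    dsimp only
    omega
  · rw [hq.jac_eq_zero_of_not_neg hbot hl hneg, hq'.jac_eq_zero_of_not_neg hbot hl hneg]

/-- If the Jacobiator vanishes in all higher total degrees, it takes values in the cycles. -/
theorem differential_jac [CharZero K] (hq : IsGradedBracket K deg q) {l : List (ℤ × M)}
    (hl : Homog deg l) (hneg : ∀ p ∈ l, p.1 < 0)
    (h : ∀ l', Homog deg l' → wt Prod.fst l < wt Prod.fst l' → jac q l' = 0) :
    q [jac q l] = 0 := by
  have hb := hq.bianchi hl
  rw [splitSum_eq_right_nil, splitSum_eq_zero] at hb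
  · exact hb
  · intro I J hIJ
    have hIJ' := homog_append.1 (hl.perm hIJ)
    refine h _ (homog_cons.2 ⟨hq.mem_deg _ hIJ'.1, hIJ'.2⟩) ?_
    rw [← hIJ.wt_eq, wt_append, wt_cons]
    dsimp only
    omega
  · intro I J hIJ hJ
    have hw := wt_le_neg_length Prod.fst (l := J) fun p hp =>
      hneg p (hIJ.mem_iff.1 (List.mem_append_right _ hp))
    have := List.length_pos_of_ne_nil hJ
    rw [h I (homog_append.1 (hl.perm hIJ)).1, hq.zero_cons]
    rw [← hIJ.wt_eq, wt_append]
    omega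

end IsGradedBracket

section Induction

variable {K O M A B : Type*} [Field K] [CommRing O] [Algebra K O]
  [AddCommGroup M] [Module K M] [Module O M] [IsScalarTower K O M]
  [LieRing A] [LieAlgebra K A] [Module O A] [LieRingModule A O] [LieRinehartRing O A]
  [LieRinehartAlgebra K O A]
  {deg : ℤ → Submodule O M}
  {S : GradedDualBasis deg B} {M₀ : Submodule O M} {π : M →ₗ[O] A} {q : List M → M}
  {g g' : List B → M}

namespace IsPartialBracket

theorem isAnchoredBracket (hq : IsPartialBracket K S M₀ π q)
    (hhook : ∀ x ∈ deg (-1), ∀ y ∈ deg (-1), π (q [x, y]) = ⁅π x, π y⁆) :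
    IsAnchoredBracket deg (anchorVia K π) q where
  toIsLeibnizBracket := hq.toIsLeibnizBracket
  anchor_differential x := by
    change LieRinehartAlgebra.anchor K O A (π (q [x])) = _
    rw [hq.hook_differential]
    exact (LieRinehartAlgebra.anchor K O A).toLieHom.map_zero
  anchor_bracket x hx y hy := anchorVia_lie π (hhook x hx y hy)

/-- On arguments of a given total degree, only the part of the correction in this degree matters. -/
theorem corrected_eq_of_wt (g g' : List B → M) {l : List (ℤ × M)} (hl : Homog deg l)
    (h : ∀ c, wt S.dg c = wt Prod.fst l → g c = g' c) :
    _root_.corrected S q g (vals l) = _root_.corrected S q g' (vals l) := by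
  rw [_root_.corrected, _root_.corrected, S.ext_congr fun c hc => h c (hc.wt_eq hl)]

/-- If the binary bracket is compatible with the Lie bracket of `A`, then the hook annihilates the
Jacobiator: on three elements of degree `-1` this is the Jacobi identity of `A`. -/
theorem hook_jac (hq : IsPartialBracket K S M₀ π q)
    (hhook : ∀ x ∈ deg (-1), ∀ y ∈ deg (-1), π (q [x, y]) = ⁅π x, π y⁆) {l : List (ℤ × M)}
    (hl : Homog deg l) : π (jac q l) = 0 := by
  have h0 : ∀ l, Homog deg l → l.length ≠ 2 → π (q (vals l)) = 0 := fun l hl h =>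
    hq.map_bracket_eq_zero hq.deg_eq_bot π hq.hook_eq_zero hq.hook_differential hl
      fun h' => h (by simpa using congrArg List.length h')
  have h2 : ∀ a x b y, x ∈ deg a → y ∈ deg b → π (q [x, y]) = ⁅π x, π y⁆ := by
    intro a x b y hx hy
    by_cases hab : a = -1 ∧ b = -1
    · obtain ⟨rfl, rfl⟩ := hab
      exact hhook x hx y hy
    · have := hq.map_bracket_eq_zero hq.deg_eq_bot π hq.hook_eq_zero hq.hook_differential
        (l := [(a, x), (b, y)]) (by simp [hx, hy, homog_nil]) (by simpa using hab)
      simp only [List.map_cons, List.map_nil] at this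
      rw [this]
      rcases not_and_or.1 hab with h | h
      · rw [hq.hook_eq_zero a h x hx, zero_lie]
      · rw [hq.hook_eq_zero b h y hy, lie_zero]
  -- only the nested brackets `q(q(x_I), y)` contribute
  let G : List (ℤ × M) → List (ℤ × M) → A := fun I J =>
    match J with
    | [p] => ⁅π (q (vals I)), π p.2⁆
    | _ => 0
  have h1 : π (jac q l) = splitSum Prod.fst l G := by
    refine (map_splitSum Prod.fst π.toAddMonoidHom l _).trans (splitSum_congr _ fun I J hIJ => ?_)
    have hIJ' := homog_append.1 (hl.perm hIJ)
    have hI := hq.mem_deg I hIJ'.1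
    match J, hIJ'.2 with
    | [], hJ => exact hq.hook_differential _
    | [p], hJ => exact h2 _ _ _ _ hI (homog_cons.1 hJ).1
    | p :: p' :: J, hJ =>
      exact h0 ((wt Prod.fst I + 1, q (vals I)) :: p :: p' :: J) (homog_cons.2 ⟨hI, hJ⟩) (by simp)
  rw [h1]
  by_cases h3 : l.length = 3
  · obtain ⟨p₁, p₂, p₃, rfl⟩ := List.length_eq_three.1 h3
    obtain ⟨a, x⟩ := p₁
    obtain ⟨b, y⟩ := p₂
    obtain ⟨c, z⟩ := p₃
    simp only [homog_cons] at hl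
    obtain ⟨hx, hy, hz, -⟩ := hl
    have hG : splitSum Prod.fst [(a, x), (b, y), (c, z)] G =
        ⁅⁅π x, π y⁆, π z⁆ + esign (b * c) • ⁅⁅π x, π z⁆, π y⁆ +
          esign (a * b + a * c) • ⁅⁅π y, π z⁆, π x⁆ := by
      simp only [splitSum_cons, splitSum_nil, G, List.map_cons, List.map_nil, smul_zero, add_zero,
        zero_add, wt_cons, wt_nil, h2 a x b y hx hy, h2 a x c z hx hz, h2 b y c z hy hz, mul_add,
        mul_zero, esign_zero, one_smul]
      abel
    rw [hG]
    by_cases h : a = -1 ∧ b = -1 ∧ c = -1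
    · obtain ⟨rfl, rfl, rfl⟩ := h
      rw [show esign (-1 * -1) = -1 from esign_one,
        show esign (-1 * -1 + -1 * -1) = 1 by
          rw [← esign_zero]; exact esign_eq_of_even ⟨1, rfl⟩,
        neg_one_smul, one_smul, lie_lie (π x) (π y) (π z), ← lie_skew ⁅π x, π z⁆ (π y),
        ← lie_skew ⁅π y, π z⁆ (π x)]
      abel
    · rcases not_and_or.1 h with h | h
      · simp [hq.hook_eq_zero a h x hx]
      rcases not_and_or.1 h with h | h
      · simp [hq.hook_eq_zero b h y hy]
      · simp [hq.hook_eq_zero c h z hz]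
  · refine splitSum_eq_zero _ fun I J hIJ => ?_
    have hlen := hIJ.length_eq
    match J, hIJ with
    | [], _ => rfl
    | [p], hIJ =>
      simp only [G]
      rw [h0 I (homog_append.1 (hl.perm hIJ)).1 (by
        intro h; rw [← hIJ.length_eq] at h3; simp [h] at h3), zero_lie]
    | _ :: _ :: _, _ => rfl

/-- A correction that is concentrated in the total degree of the arguments changes the Jacobiator by
a boundary. -/
theorem jac_corrected (hq : IsPartialBracket K S M₀ π q) (hg : IsCorrection S M₀ g)
    {l : List (ℤ × M)} (hl : Homog deg l) (hneg : ∀ p ∈ l, p.1 < 0)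
    (h : ∀ c, wt S.dg c ≠ wt Prod.fst l → g c = 0) :
    jac (_root_.corrected S q g) l = jac q l + q [S.ext (vals l) g] := by
  have hq' := hq.corrected hg
  have hcor : ∀ l', Homog deg l' → wt Prod.fst l' ≠ wt Prod.fst l →
      _root_.corrected S q g (vals l') = q (vals l') := fun l' hl' hw => by
    rw [_root_.corrected, S.ext_eq_zero, add_zero]
    intro c hc
    exact h c (by rwa [hc.wt_eq hl'])
  -- Only the outer unary bracket sees the correction, as in all other terms the arguments of both
  -- brackets have a total degree different from that of `l`.
  let G : List (ℤ × M) → List (ℤ × M) → M := fun I J =>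
    if J = [] then q [S.ext (vals I) g] else 0
  have hG : splitSum Prod.fst l G = q [S.ext (vals l) g] := by
    rw [splitSum_eq_right_nil]
    · simp [G]
    · intro I J _ hJ
      simp [G, hJ]
  rw [← hG, jac, jac, ← splitSum_add]
  refine splitSum_congr _ fun I J hIJ => ?_
  have hIJ' := homog_append.1 (hl.perm hIJ)
  by_cases hJ : J = []
  · subst hJ
    simp only [List.map_nil, hg.corrected_singleton, G, if_true]
    exact hq.map_add _ _ []
  · have hw := hIJ.wt_eq Prod.fst
    have hwJ := wt_le_neg_length Prod.fst (l := J) fun p hp =>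
      hneg p (hIJ.mem_iff.1 (List.mem_append_right _ hp))
    have := List.length_pos_of_ne_nil hJ
    rw [wt_append] at hw
    simp only [G, if_neg hJ, add_zero]
    rw [hcor I hIJ'.1 (by omega)]
    refine hcor ((wt Prod.fst I + 1, q (vals I)) :: J)
      (homog_cons.2 ⟨hq.mem_deg _ hIJ'.1, hIJ'.2⟩) ?_
    rw [wt_cons]
    dsimp only
    omega

variable (S M₀ π q) in
/-- `g` is a correction, concentrated in total degrees `> -t`, such that the corrected brackets are
compatible with the Lie bracket of `A` and satisfy the higher Jacobi identities in total degrees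
`> -t`. -/
structure IsApproximation (t : ℤ) (g : List B → M) : Prop extends IsCorrection S M₀ g where
  eq_zero_of_wt : ∀ c, wt S.dg c ≤ -t → g c = 0
  hook : ∀ x ∈ deg (-1), ∀ y ∈ deg (-1), π (_root_.corrected S q g [x, y]) = ⁅π x, π y⁆
  jac_eq_zero : ∀ l, Homog deg l → -t < wt Prod.fst l → jac (_root_.corrected S q g) l = 0

/-- In total degrees `> -3`, the Jacobiator vanishes as its values have degree `≥ 0`. -/
theorem exists_approximation_three [CharZero K] (hq : IsPartialBracket K S M₀ π q) :
    ∃ g, IsApproximation S M₀ π q 3 g := by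
  obtain ⟨g, hg, hw, hhook⟩ := hq.exists_hook_correction
  refine ⟨g, hg, fun c hc => hw c (by omega), hhook, fun l hl hwl => ?_⟩
  have hm := (hq.corrected hg).jac_mem_deg hl
  rwa [hq.deg_eq_bot _ (by omega), Submodule.mem_bot] at hm

/-- The induction step: the Jacobiator in total degree `-t` is a cycle, hence it can be cancelled by
a correction of the brackets in this degree. -/
theorem exists_approximation_succ [CharZero K] (hq : IsPartialBracket K S M₀ π q) {t : ℤ}
    (ht : 3 ≤ t) (hg : IsApproximation S M₀ π q t g) :
    ∃ g', IsApproximation S M₀ π q (t + 1) g' ∧ ∀ c, -t < wt S.dg c → g' c = g c := by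
  set r := _root_.corrected S q g with hr
  have hr' : IsPartialBracket K S M₀ π r := hq.corrected hg.toIsCorrection
  have hra := hr'.isAnchoredBracket hg.hook
  have hF : SwapSymm deg fun l => -jac r l := fun l₁ a b l₂ hl => by
    simp only [hr'.jac_swap l₁ a b l₂ hl, smul_neg]
  have hFm : MultiLin deg fun l => -jac r l := by
    constructor
    · intro l₁ l₂ d x y h₁ h₂ hx hy
      simp only [hra.jac_multiLin.add l₁ l₂ d x y h₁ h₂ hx hy, neg_add]
    · intro l₁ l₂ d f x h₁ h₂ hx
      simp only [hra.jac_multiLin.smul l₁ l₂ d f x h₁ h₂ hx, smul_neg]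
  obtain ⟨h, h1, h2, h3, h4, h5⟩ := S.exists_symm_lift K hr'.differential hF
    (fun c => wt S.dg c = -t ∧ 2 ≤ c.length ∧ ∀ b ∈ c, S.dg b < 0)
    (fun c c' hc hP => ⟨by rw [← hP.1, hc.wt_eq], hc.length_eq ▸ hP.2.1,
      fun b hb => hP.2.2 b (hc.mem_iff.2 hb)⟩)
    (fun c hc => by
      have hl := S.homog_tag c
      have hm := neg_mem (hr'.jac_mem_deg hl)
      rw [S.wt_tag, hc.1] at hm
      rw [hc.1]
      -- For `t = 3`, the Jacobiator has values of degree `-1`, where exactness involves the hook.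
      by_cases h3 : t = 3
      · subst h3
        exact hr'.exact_hook _ hm (by rw [map_neg, hr'.hook_jac hg.hook hl, neg_zero])
      · have hd := hr'.exact_differential (-t + 2) (by omega) _ hm (by
          refine ((map_neg hr'.differential _).trans ?_)
          rw [neg_eq_zero]
          refine hr'.differential_jac hl ?_ fun l' hl' hw => hg.jac_eq_zero l' hl' ?_
          · intro p hp
            obtain ⟨b, hb, rfl⟩ := List.mem_map.1 hp
            exact hc.2.2 b hb
          · rwa [S.wt_tag, hc.1] at hw)
        rwa [show -t + 2 - 1 = -t + 1 by ring] at hd)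
  have hc : IsCorrection S M₀ h := by
    refine ⟨fun c hc => h1 c fun hP => by omega, h2, h3, fun c hc => h4 c ?_⟩
    rw [neg_eq_zero]
    refine hr'.jac_eq_zero _ (S.homog_tag c) ?_
    simpa [GradedDualBasis.tag] using hc
  have hsum : _root_.corrected S q (fun c => g c + h c) = _root_.corrected S r h := by
    funext l
    simp only [_root_.corrected, hr, S.ext_add, add_assoc]
  have hrh := hr'.corrected hc
  refine ⟨fun c => g c + h c, ⟨hg.toIsCorrection.add hc, fun c hw => ?_, fun x hx y hy => ?_,
    fun l hl hw => ?_⟩, fun c hw => ?_⟩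
  · rw [hg.eq_zero_of_wt c (by omega), h1 c (by omega), add_zero]
  · rw [hsum, ← hg.hook x hx y hy, ← hr, _root_.corrected, S.ext_eq_zero, add_zero]
    intro c hc'
    have := GradedDualBasis.Occurs.wt_eq (l := [(-1, x), (-1, y)])
      (by simp [hx, hy, homog_nil]) hc'
    simp only [wt_cons, wt_nil] at this
    exact h1 c (by omega)
  · rw [hsum]
    by_cases hlt : -t < wt Prod.fst l
    · rw [← hg.jac_eq_zero l hl hlt]
      refine hrh.jac_congr hr'.toIsGradedBracket hq.deg_eq_bot (m := -t + 1) (fun l' hl' hw' => ?_)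
        hl hlt
      rw [_root_.corrected, S.ext_eq_zero, add_zero]
      intro c hc'
      have := hc'.wt_eq hl'
      exact h1 c (by omega)
    · have hlt' : wt Prod.fst l = -t := by omega
      by_cases hneg : ∀ p ∈ l, p.1 < 0
      · rw [hr'.jac_corrected hc hl hneg fun c hc => h1 c (by omega)]
        have hext : r [S.ext (vals l) h] = S.ext (vals l) fun c => hr'.differential (h c) :=
          S.map_ext hr'.differential _ _
        by_cases hlen : 2 ≤ l.length
        · rw [hext, S.ext_congr (g' := fun c => -jac r (c.map S.tag)),
            S.ext_eq_of_multiLin hFm hl, add_neg_cancel]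
          intro c hc'
          refine h5 c ⟨by rw [hc'.wt_eq hl, hlt'], ?_, hc'.dg_neg hq.deg_eq_bot hl⟩
          rw [hc'.length_eq]
          simpa using hlen
        · rw [S.ext_eq_zero fun c hc' => hc.eq_zero_of_length c (by
            rw [hc'.length_eq]; simpa using hlen), hr'.zero_cons, add_zero]
          match l, hlen with
          | [], _ => exact hr'.zero_cons [] ▸ congrArg (fun x => r [x]) hr'.nil
          | [p], _ =>
            rw [jac, splitSum_cons, splitSum_nil]
            simp [hr'.nil, hr'.zero_cons, hr'.differential_comp]
          | _ :: _ :: _, hlen => simp at hlen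
      · exact hrh.jac_eq_zero_of_not_neg hq.deg_eq_bot hl hneg
  · dsimp only
    rw [h1 c (by omega), add_zero]

/-- A family of brackets that satisfies the higher Jacobi identities on `M₀` can be corrected, away
from `M₀`, such that they hold everywhere. -/
theorem exists_correction [CharZero K] (hq : IsPartialBracket K S M₀ π q) :
    ∃ g, IsCorrection S M₀ g ∧
      (∀ x ∈ deg (-1), ∀ y ∈ deg (-1), π (_root_.corrected S q g [x, y]) = ⁅π x, π y⁆) ∧
      ∀ l, Homog deg l → jac (_root_.corrected S q g) l = 0 := by
  obtain ⟨g₀, hg₀⟩ := hq.exists_approximation_three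
  choose! next hnext hnext' using fun (n : ℕ) (g : List B → M)
    (hg : IsApproximation S M₀ π q ((n : ℤ) + 3) g) =>
      hq.exists_approximation_succ (by omega) hg
  let G : ℕ → List B → M := fun n => n.rec g₀ next
  have hG : ∀ n : ℕ, IsApproximation S M₀ π q ((n : ℤ) + 3) (G n) := by
    intro n
    induction n with
    | zero => rw [Nat.cast_zero, zero_add]; exact hg₀
    | succ n ih =>
      have := hnext n (G n) ih
      rwa [show (n : ℤ) + 3 + 1 = ((n + 1 : ℕ) : ℤ) + 3 by push_cast; ring] at this
  have hstable : ∀ c (n : ℕ), (-wt S.dg c).toNat ≤ n → G n c = G (-wt S.dg c).toNat c := by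
    intro c n hn
    induction n, hn using Nat.le_induction with
    | base => rfl
    | succ n hn ih =>
      rw [← ih]
      exact hnext' n (G n) (hG n) c (by omega)
  -- the corrections stabilize in every total degree
  let g : List B → M := fun c => G (-wt S.dg c).toNat c
  have hg : IsCorrection S M₀ g := by
    refine ⟨fun c => (hG _).eq_zero_of_length c, fun c => (hG _).mem_deg c,
      fun l₁ a b l₂ => ?_, fun c => (hG _).eq_zero_of_mem c⟩
    have hp : (l₁ ++ a :: b :: l₂).Perm (l₁ ++ b :: a :: l₂) :=
      (List.Perm.swap b a l₂).append_left l₁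
    simp only [g, hp.wt_eq S.dg]
    exact (hG _).swap l₁ a b l₂
  have hagree : ∀ (n : ℕ) l, Homog deg l → -(n : ℤ) ≤ wt Prod.fst l →
      _root_.corrected S q g (vals l) = _root_.corrected S q (G n) (vals l) := by
    intro n l hl hw
    refine corrected_eq_of_wt g (G n) hl fun c hc => ?_
    exact (hstable c n (by omega)).symm
  refine ⟨g, hg, fun x hx y hy => ?_, fun l hl => ?_⟩
  · rw [← (hG 2).hook x hx y hy]
    congr 1
    exact hagree 2 [(-1, x), (-1, y)] (by simp [hx, hy, homog_nil]) (by simp)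
  · have h := (hG (-wt Prod.fst l).toNat)
    rw [← h.jac_eq_zero l hl (by omega)]
    exact (hq.corrected hg).jac_congr (hq.corrected h.toIsCorrection).toIsGradedBracket
      hq.deg_eq_bot (hagree _) hl (by omega)

end IsPartialBracket

end Induction

/-! ### Extension of a complex to a resolution -/

universe t

section Resolution

variable {O : Type u} {A : Type v} {M' : Type w} [CommRing O] [AddCommGroup A] [Module O A]
  [AddCommGroup M'] [Module O M']

/-- A graded module, extended by the free module on a graded set `Γ` of generators. -/
noncomputable def extDeg {Γ : Type*} (deg' : ℤ → Submodule O M') (gd : Γ → ℤ) (i : ℤ) :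
    Submodule O (M' × (Γ →₀ O)) :=
  (deg' i).prod (Finsupp.supported O O {γ | gd γ = i})

/-- A step in the construction of a resolution that extends the complex `D`: a module `Z`, the
generators of the free module that is added in this step, and the map to `Z` that has to be made
surjective. -/
structure ResolutionStage (D : ℕ → Submodule O M') (d' : ∀ k, D (k + 1) →ₗ[O] D k) (k : ℕ) where
  Z : Type t
  [addCommGroup : AddCommGroup Z]
  [module : Module O Z]
  f : D k →ₗ[O] Z
  f_comp : ∀ x, f (d' k x) = 0

namespace ResolutionStage

attribute [instance] addCommGroup module

variable {D : ℕ → Submodule O M'} {d' : ∀ k, D (k + 1) →ₗ[O] D k} {k : ℕ}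

/-- The surjection to `Z` from the sum of the given module and the free module on `Z`. -/
noncomputable def cover (s : ResolutionStage D d' k) : D k × (s.Z →₀ O) →ₗ[O] s.Z :=
  s.f.coprod (Finsupp.linearCombination O id)

theorem cover_surjective (s : ResolutionStage D d' k) : Function.Surjective s.cover :=
  fun z => ⟨(0, Finsupp.single z 1), by simp [cover]⟩

/-- The inclusion of the kernel of `cover`. -/
noncomputable def kerIncl (s : ResolutionStage D d' k) :
    LinearMap.ker s.cover →ₗ[O] D k × (s.Z →₀ O) := (LinearMap.ker s.cover).subtype

theorem cover_inl (s : ResolutionStage D d' k) (m : D k) : s.cover (m, 0) = s.f m := by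
  simp [cover]

theorem cover_single (s : ResolutionStage D d' k) (y : s.Z) :
    s.cover (0, Finsupp.single y 1) = y := by simp [cover]

/-- In the next step, the kernel of the surjection of this step has to be covered. -/
noncomputable def next (s : ResolutionStage.{u, w, max u v w} D d' k)
    (hd : ∀ x, d' k (d' (k + 1) x) = 0) :
    ResolutionStage.{u, w, max u v w} D d' (k + 1) where
  Z := LinearMap.ker s.cover
  f := ((LinearMap.inl O (D k) (s.Z →₀ O)).comp (d' k)).codRestrict _ fun x => by
    simpa [cover] using s.f_comp x
  f_comp x := by
    ext1
    simp [hd]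

end ResolutionStage

/-- Successive covers of the kernels give the homogeneous components of a resolution. The module `A`
itself is the first module to be covered, and is lifted to the universe of the kernels. -/
theorem exists_resolutionStages (D : ℕ → Submodule O M') (δ : ∀ k, D (k + 1) →ₗ[O] D k)
    (hδ : ∀ k x, δ k (δ (k + 1) x) = 0) (f₀ : D 0 →ₗ[O] A) (hf₀ : ∀ x, f₀ (δ 0 x) = 0) :
    ∃ (s : ∀ k, ResolutionStage.{u, w, max u v w} D δ k) (φ : (s 0).Z ≃ₗ[O] A)
      (z : ∀ k, (s (k + 1)).Z →ₗ[O] D k × ((s k).Z →₀ O)),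
      (∀ x, φ ((s 0).f x) = f₀ x) ∧ (∀ k x, z k ((s (k + 1)).f x) = (δ k x, 0)) ∧
      (∀ k y, (s k).cover (z k y) = 0) ∧ (∀ k e, (s k).cover e = 0 → ∃ y, z k y = e) ∧
      ∀ k, Function.Injective (z k) := by
  let s₀ : ResolutionStage.{u, w, max u v w} D δ 0 :=
    { Z := ULift.{max u v w} A
      f := ULift.moduleEquiv.symm.toLinearMap.comp f₀
      f_comp := fun x => by
        change ULift.up (f₀ (δ 0 x)) = 0
        rw [hf₀]; rfl }
  let s : ∀ k, ResolutionStage.{u, w, max u v w} D δ k :=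
    fun k => k.rec s₀ fun k s => ResolutionStage.next.{u, v, w} s (hδ k)
  exact ⟨s, (ULift.moduleEquiv : ULift.{max u v w} A ≃ₗ[O] A),
    fun k => (s k).kerIncl,
    fun x => rfl, fun k x => rfl, fun k y => y.2, fun k e he => ⟨⟨e, he⟩, rfl⟩,
    fun k => Subtype.val_injective⟩

/-- The embedding of a homogeneous component into the graded module. -/
noncomputable def stageIncl {D : ℕ → Submodule O M'} {Z : ℕ → Type*} (k : ℕ) :
    D k × (Z k →₀ O) →ₗ[O] M' × ((Σ k, Z k) →₀ O) :=
  (D k).subtype.prodMap (Finsupp.lmapDomain O O (Sigma.mk k))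

theorem stageIncl_injective {D : ℕ → Submodule O M'} {Z : ℕ → Type*} (k : ℕ) :
    Function.Injective (stageIncl (D := D) (Z := Z) k) := by
  rintro ⟨m, v⟩ ⟨m', v'⟩ h
  simp only [stageIncl, LinearMap.prodMap_apply, Prod.mk.injEq] at h
  exact Prod.ext (Subtype.ext h.1) (Finsupp.mapDomain_injective sigma_mk_injective h.2)

theorem exists_stageIncl {deg' : ℤ → Submodule O M'} {Z : ℕ → Type*} {k : ℕ}
    {x : M' × ((Σ k, Z k) →₀ O)}
    (hx : x ∈ extDeg deg' (fun γ : Σ k, Z k => -(γ.1 : ℤ) - 1) (-(k : ℤ) - 1)) :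
    ∃ e, stageIncl (D := fun k : ℕ => deg' (-(k : ℤ) - 1)) k e = x := by
  obtain ⟨m, v⟩ := x
  refine ⟨(⟨m, hx.1⟩, v.comapDomain (Sigma.mk k) sigma_mk_injective.injOn), ?_⟩
  refine Prod.ext rfl (Finsupp.mapDomain_comapDomain _ sigma_mk_injective _ fun γ hγ => ?_)
  have h := hx.2 hγ
  obtain ⟨j, z⟩ := γ
  have hj : j = k := by
    simp only [Set.mem_ofPred_eq] at h
    omega
  subst hj
  exact ⟨z, rfl⟩

theorem stageIncl_mem {deg' : ℤ → Submodule O M'} {Z : ℕ → Type*} (k : ℕ)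
    (e : deg' (-(k : ℤ) - 1) × (Z k →₀ O)) :
    stageIncl (D := fun k : ℕ => deg' (-(k : ℤ) - 1)) (Z := Z) k e ∈
      extDeg deg' (fun γ : Σ k, Z k => -(γ.1 : ℤ) - 1) (-(k : ℤ) - 1) := by
  refine ⟨e.1.2, fun γ hγ => ?_⟩
  classical
  have := Finsupp.mapDomain_support hγ
  obtain ⟨z, -, rfl⟩ := Finset.mem_image.1 this
  rfl

/-- A complex of modules over `A`, concentrated in negative degrees, is a direct summand (as a
graded module) of a resolution of `A`, with a free complement. -/
theorem exists_resolution (deg' : ℤ → Submodule O M') (d' : M' →ₗ[O] M') (π' : M' →ₗ[O] A)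
    (hbot : ∀ i, 0 ≤ i → deg' i = ⊥) (hd : ∀ i, ∀ x ∈ deg' i, d' x ∈ deg' (i + 1))
    (hdd : ∀ x, d' (d' x) = 0) (hπ : ∀ i, i ≠ -1 → ∀ x ∈ deg' i, π' x = 0)
    (hπd : ∀ x, π' (d' x) = 0) :
    ∃ (Γ : Type (max u v w)) (gd : Γ → ℤ) (d : M' × (Γ →₀ O) →ₗ[O] M' × (Γ →₀ O))
      (π : M' × (Γ →₀ O) →ₗ[O] A),
      (∀ γ, gd γ < 0) ∧ (∀ m, d (m, 0) = (d' m, 0)) ∧ (∀ m, π (m, 0) = π' m) ∧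
      (∀ i, ∀ x ∈ extDeg deg' gd i, d x ∈ extDeg deg' gd (i + 1)) ∧
      (∀ x, d (d x) = 0) ∧ (∀ x, π (d x) = 0) ∧
      (∀ i, i ≠ -1 → ∀ x ∈ extDeg deg' gd i, π x = 0) ∧
      (∀ a, ∃ x ∈ extDeg deg' gd (-1), π x = a) ∧
      (∀ x ∈ extDeg deg' gd (-1), π x = 0 → ∃ y ∈ extDeg deg' gd (-2), d y = x) ∧
      (∀ i, i ≤ -2 → ∀ x ∈ extDeg deg' gd i, d x = 0 →
        ∃ y ∈ extDeg deg' gd (i - 1), d y = x) := by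
  let D : ℕ → Submodule O M' := fun k => deg' (-(k : ℤ) - 1)
  let δ : ∀ k, D (k + 1) →ₗ[O] D k := fun k => d'.restrict fun x hx => by
    have := hd _ x hx
    rwa [show -((k + 1 : ℕ) : ℤ) - 1 + 1 = -(k : ℤ) - 1 by push_cast; ring] at this
  have hδ : ∀ k x, δ k (δ (k + 1) x) = 0 := fun k x => Subtype.ext (hdd x)
  obtain ⟨s, φ, z, hφ, hzf, hz, hz', hzi⟩ := exists_resolutionStages.{u, v, w} D δ hδ
    (π'.comp (D 0).subtype) fun x => hπd x
  let Γ : Type (max u v w) := Σ k, (s k).Z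
  let gd : Γ → ℤ := fun γ => -(γ.1 : ℤ) - 1
  let j : ∀ k, D k × ((s k).Z →₀ O) →ₗ[O] M' × (Γ →₀ O) := fun k =>
    stageIncl (D := D) (Z := fun k => (s k).Z) k
  let dΓ : Γ → M' × (Γ →₀ O) := fun γ =>
    match γ with
    | ⟨0, _⟩ => 0
    | ⟨k + 1, y⟩ => j k (z k y)
  let πΓ : Γ → A := fun γ =>
    match γ with
    | ⟨0, y⟩ => φ y
    | ⟨_ + 1, _⟩ => 0
  let d : M' × (Γ →₀ O) →ₗ[O] M' × (Γ →₀ O) :=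
    ((LinearMap.inl O M' (Γ →₀ O)).comp d').coprod (Finsupp.linearCombination O dΓ)
  let π : M' × (Γ →₀ O) →ₗ[O] A := π'.coprod (Finsupp.linearCombination O πΓ)
  have hd0 : ∀ e, d (j 0 e) = 0 := by
    rintro ⟨m, v⟩
    have hm : d' m = 0 := by
      have := hd _ _ m.2
      rwa [hbot _ (by simp), Submodule.mem_bot] at this
    have hv : Finsupp.linearCombination O dΓ (v.mapDomain (Sigma.mk 0)) = 0 := by
      rw [Finsupp.linearCombination_mapDomain]
      exact (Finsupp.linearCombination_apply _ _).trans (Finset.sum_eq_zero fun y _ => smul_zero _)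
    simp [d, j, stageIncl, hm, hv]
  have hdj : ∀ k e, d (j (k + 1) e) = j k (z k ((s (k + 1)).cover e)) := by
    intro k
    suffices h : d.comp (j (k + 1)) = (j k).comp ((z k).comp (s (k + 1)).cover) from
      fun e => LinearMap.congr_fun h e
    refine LinearMap.prod_ext ?_ (Finsupp.lhom_ext' fun y => LinearMap.ext_ring ?_)
    · ext1 m
      simp only [LinearMap.comp_apply, LinearMap.inl_apply, ResolutionStage.cover_inl, hzf]
      simp [d, j, stageIncl, δ]
    · simp only [LinearMap.comp_apply, LinearMap.inr_apply, Finsupp.lsingle_apply,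
        ResolutionStage.cover_single]
      simp [d, j, stageIncl, dΓ]
  have hπ0 : ∀ e, π (j 0 e) = φ ((s 0).cover e) := by
    suffices h : π.comp (j 0) = φ.toLinearMap.comp (s 0).cover from
      fun e => LinearMap.congr_fun h e
    refine LinearMap.prod_ext ?_ (Finsupp.lhom_ext' fun y => LinearMap.ext_ring ?_)
    · ext1 m
      simp only [LinearMap.comp_apply, LinearMap.inl_apply, ResolutionStage.cover_inl,
        LinearEquiv.coe_coe, hφ]
      simp [π, j, stageIncl]
    · simp only [LinearMap.comp_apply, LinearMap.inr_apply, Finsupp.lsingle_apply,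
        ResolutionStage.cover_single, LinearEquiv.coe_coe]
      simp [π, j, stageIncl, πΓ]
  have hπj : ∀ k e, π (j (k + 1) e) = 0 := by
    rintro k ⟨m, v⟩
    have hm : π' m = 0 := hπ _ (by push_cast; omega) _ m.2
    have hv : Finsupp.linearCombination O πΓ (v.mapDomain (Sigma.mk (k + 1))) = 0 := by
      rw [Finsupp.linearCombination_mapDomain]
      exact (Finsupp.linearCombination_apply _ _).trans (Finset.sum_eq_zero fun y _ => smul_zero _)
    simp [π, j, stageIncl, hm, hv]
  have hj : ∀ (k : ℕ) x, x ∈ extDeg deg' gd (-(k : ℤ) - 1) → ∃ e, j k e = x :=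
    fun k x hx => exists_stageIncl hx
  have hjm : ∀ (k : ℕ) e, j k e ∈ extDeg deg' gd (-(k : ℤ) - 1) := fun k e =>
    stageIncl_mem (deg' := deg') (Z := fun k => (s k).Z) k e
  have hext : ∀ i, 0 ≤ i → ∀ x ∈ extDeg deg' gd i, x = 0 := by
    rintro i hi ⟨m, v⟩ hx
    refine Prod.ext (by simpa [hbot i hi] using hx.1) (Finsupp.support_eq_empty.1 ?_)
    refine Finset.eq_empty_of_forall_notMem fun γ hγ => ?_
    have : gd γ = i := hx.2 hγ
    simp only [gd] at this
    omega
  have hcases : ∀ i, i < 0 → ∃ k : ℕ, i = -(k : ℤ) - 1 := fun i hi => ⟨(-i - 1).toNat, by omega⟩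
  refine ⟨Γ, gd, d, π, fun γ => by simp only [gd]; omega, fun m => by simp [d],
    fun m => by simp [π], fun i x hx => ?_, fun x => ?_, fun x => ?_, fun i hi x hx => ?_,
    fun a => ?_, fun x hx h => ?_, fun i hi x hx h => ?_⟩
  · by_cases hi : i < 0
    · obtain ⟨k, rfl⟩ := hcases i hi
      obtain ⟨e, rfl⟩ := hj k x hx
      rcases k with _ | k
      · rw [hd0]; exact zero_mem _
      · rw [hdj, show -((k + 1 : ℕ) : ℤ) - 1 + 1 = -(k : ℤ) - 1 by push_cast; ring]
        exact hjm k _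
    · rw [hext i (not_lt.1 hi) x hx, map_zero]
      exact zero_mem _
  · suffices h : d.comp d = 0 from LinearMap.congr_fun h x
    refine LinearMap.prod_ext ?_ (Finsupp.lhom_ext' fun γ => LinearMap.ext_ring ?_)
    · ext1 m
      simp [d, hdd]
    · have : d (0, Finsupp.single γ 1) = dΓ γ := by simp [d]
      simp only [LinearMap.comp_apply, LinearMap.inr_apply, Finsupp.lsingle_apply, this,
        LinearMap.zero_apply]
      match γ with
      | ⟨0, _⟩ => exact map_zero d
      | ⟨1, y⟩ => exact hd0 _
      | ⟨k + 2, y⟩ =>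
        change d (j (k + 1) (z (k + 1) y)) = 0
        rw [hdj, hz, map_zero, map_zero]
  · suffices h : π.comp d = 0 from LinearMap.congr_fun h x
    refine LinearMap.prod_ext ?_ (Finsupp.lhom_ext' fun γ => LinearMap.ext_ring ?_)
    · ext1 m
      simp [d, π, hπd]
    · have : d (0, Finsupp.single γ 1) = dΓ γ := by simp [d]
      simp only [LinearMap.comp_apply, LinearMap.inr_apply, Finsupp.lsingle_apply, this,
        LinearMap.zero_apply]
      match γ with
      | ⟨0, _⟩ => exact map_zero π
      | ⟨1, y⟩ =>
        change π (j 0 (z 0 y)) = 0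
        rw [hπ0, hz, map_zero]
      | ⟨k + 2, y⟩ => exact hπj k _
  · by_cases hi' : i < 0
    · obtain ⟨k, rfl⟩ := hcases i hi'
      obtain ⟨e, rfl⟩ := hj k x hx
      rcases k with _ | k
      · simp at hi
      · exact hπj k e
    · rw [hext i (not_lt.1 hi') x hx, map_zero]
  · obtain ⟨e, he⟩ := (s 0).cover_surjective (φ.symm a)
    refine ⟨j 0 e, by simpa using hjm 0 e, ?_⟩
    rw [hπ0, he, φ.apply_symm_apply]
  · obtain ⟨e, rfl⟩ := hj 0 x (by simpa using hx)
    rw [hπ0] at h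
    obtain ⟨y, rfl⟩ := hz' 0 e ((map_eq_zero_iff φ φ.injective).1 h)
    obtain ⟨e', rfl⟩ := (s 1).cover_surjective y
    exact ⟨j 1 e', by simpa using hjm 1 e', hdj 0 e'⟩
  · obtain ⟨k, rfl⟩ : ∃ k : ℕ, i = -((k + 1 : ℕ) : ℤ) - 1 := ⟨(-i - 2).toNat, by omega⟩
    obtain ⟨e, rfl⟩ := hj (k + 1) x hx
    rw [hdj] at h
    have h0 : (s (k + 1)).cover e = 0 := by
      have := stageIncl_injective k (h.trans (map_zero (j k)).symm)
      exact (map_eq_zero_iff (z k) (hzi k)).1 this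
    obtain ⟨y, rfl⟩ := hz' (k + 1) e h0
    obtain ⟨e', rfl⟩ := (s (k + 2)).cover_surjective y
    refine ⟨j (k + 2) e', ?_, hdj (k + 1) e'⟩
    have := hjm (k + 2) e'
    rwa [show -((k + 2 : ℕ) : ℤ) - 1 = -((k + 1 : ℕ) : ℤ) - 1 - 1 by push_cast; ring] at this

end Resolution

/-! ### The extended graded module -/

section ExtendedModule

variable {O M' Γ : Type*} [CommRing O] [AddCommGroup M'] [Module O M']
  {deg' : ℤ → Submodule O M'} {gd : Γ → ℤ}

theorem extDeg_isInternal (h : DirectSum.IsInternal deg') :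
    DirectSum.IsInternal (extDeg deg' gd) := by
  rw [DirectSum.isInternal_submodule_iff_iSupIndep_and_iSup_eq_top] at h ⊢
  obtain ⟨h1, h2⟩ := h
  refine ⟨fun i => ?_, ?_⟩
  · have hle : ⨆ j, ⨆ (_ : j ≠ i), extDeg deg' gd j ≤
        (⨆ j, ⨆ (_ : j ≠ i), deg' j).prod (Finsupp.supported O O {γ | gd γ ≠ i}) :=
      iSup₂_le fun j hj => Submodule.prod_mono (le_iSup₂_of_le j hj le_rfl)
        (Finsupp.supported_mono fun γ (hγ : gd γ = j) => by
          change gd γ ≠ i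
          rwa [hγ])
    refine Disjoint.mono_right hle (Submodule.disjoint_def.2 ?_)
    rintro ⟨m, v⟩ ⟨hm, hv⟩ ⟨hm', hv'⟩
    refine Prod.ext (Submodule.disjoint_def.1 (h1 i) m hm hm') ?_
    refine Finsupp.support_eq_empty.1 (Finset.eq_empty_of_forall_notMem fun γ hγ => ?_)
    exact (hv' hγ : gd γ ≠ i) (hv hγ)
  · refine eq_top_iff.2 ?_
    rintro ⟨m, v⟩ -
    have e : ((m, v) : M' × (Γ →₀ O)) = (m, 0) + (0, v) := by simp
    rw [e]
    refine add_mem ?_ ?_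
    · have hm : m ∈ ⨆ i, deg' i := h2 ▸ Submodule.mem_top
      have hle : (⨆ i, deg' i).map (LinearMap.inl O M' (Γ →₀ O)) ≤ ⨆ i, extDeg deg' gd i := by
        rw [Submodule.map_iSup]
        refine iSup_mono fun i => ?_
        rintro _ ⟨m, hm, rfl⟩
        exact ⟨hm, zero_mem _⟩
      exact hle ⟨m, hm, rfl⟩
    · induction v using Finsupp.induction_linear with
      | zero => exact zero_mem _
      | add v v' hv hv' =>
        have e : ((0, v + v') : M' × (Γ →₀ O)) = (0, v) + (0, v') := by simp
        rw [e]
        exact add_mem (hv (by simp)) (hv' (by simp))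
      | single γ r =>
        exact Submodule.mem_iSup_of_mem (gd γ) ⟨zero_mem _, Finsupp.single_mem_supported O r rfl⟩

theorem extDeg_projective (h : ∀ i, Module.Projective O (deg' i)) (i : ℤ) :
    Module.Projective O (extDeg deg' gd i) := by
  have := h i
  have : Module.Projective O (Finsupp.supported O O {γ | gd γ = i}) :=
    Module.Projective.of_equiv (Finsupp.supportedEquivFinsupp {γ | gd γ = i}).symm
  let e : (deg' i × Finsupp.supported O O {γ | gd γ = i}) ≃ₗ[O] extDeg deg' gd i :=
    { toFun := fun x => ⟨(x.1, x.2), x.1.2, x.2.2⟩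
      invFun := fun x => (⟨x.1.1, x.2.1⟩, ⟨x.1.2, x.2.2⟩)
      map_add' := fun _ _ => rfl
      map_smul' := fun _ _ => rfl
      left_inv := fun _ => rfl
      right_inv := fun _ => rfl }
  exact Module.Projective.of_equiv e

theorem extDeg_eq_bot (h : ∀ i, 0 ≤ i → deg' i = ⊥) (hgd : ∀ γ, gd γ < 0) (i : ℤ) (hi : 0 ≤ i) :
    extDeg deg' gd i = ⊥ := by
  refine eq_bot_iff.2 ?_
  rintro ⟨m, v⟩ hx
  refine Prod.ext (by simpa [h i hi] using hx.1) (Finsupp.support_eq_empty.1 ?_)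
  refine Finset.eq_empty_of_forall_notMem fun γ hγ => ?_
  have h1 : gd γ = i := hx.2 hγ
  have := hgd γ
  omega

/-- A graded module with projective components, extended by a free module, has a homogeneous dual
basis; the generators are all homogeneous elements of the given module and the generators of the
free module. -/
theorem exists_gradedDualBasis (hint : DirectSum.IsInternal deg')
    (hproj : ∀ i, Module.Projective O (deg' i)) :
    ∃ S : GradedDualBasis (extDeg deg' gd) ((Σ i, deg' i) ⊕ Γ),
      ∀ m b, S.sec (m, 0) b ≠ 0 → ∃ m', S.val b = (m', 0) := by
  classical
  choose σ hσ using fun i => (hproj i).out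
  let e := LinearEquiv.ofBijective (DirectSum.coeLinearMap deg') hint
  have he : ∀ i (x : deg' i), e.symm (x : M') = DirectSum.lof O ℤ (fun i => deg' i) i x := by
    intro i x
    rw [LinearEquiv.symm_apply_eq]
    exact (DirectSum.coeLinearMap_lof deg' i x).symm
  let sec₁ : M' →ₗ[O] ((Σ i, deg' i) ⊕ Γ) →₀ O :=
    (DirectSum.toModule O ℤ _ fun i =>
      (Finsupp.lmapDomain O O fun x : deg' i => Sum.inl ⟨i, x⟩).comp (σ i)).comp e.symm.toLinearMap
  let sec : M' × (Γ →₀ O) →ₗ[O] ((Σ i, deg' i) ⊕ Γ) →₀ O :=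
    sec₁.coprod (Finsupp.lmapDomain O O Sum.inr)
  have hsec₁ : ∀ i (x : deg' i), sec₁ x = (σ i x).mapDomain fun x : deg' i => Sum.inl ⟨i, x⟩ := by
    intro i x
    simp only [sec₁, LinearMap.comp_apply, LinearEquiv.coe_coe, he, DirectSum.toModule_lof]
    rfl
  let val : (Σ i, deg' i) ⊕ Γ → M' × (Γ →₀ O) :=
    Sum.elim (fun p => ((p.2 : M'), 0)) fun γ => (0, Finsupp.single γ 1)
  have hinl : ∀ m γ, sec₁ m (Sum.inr γ) = 0 := by
    intro m γ
    have : (Finsupp.lapply (Sum.inr γ)).comp sec₁ = 0 := by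
      have h : ((Finsupp.lapply (Sum.inr γ)).comp sec₁).comp e.toLinearMap = 0 := by
        refine DirectSum.linearMap_ext O fun i => LinearMap.ext fun x => ?_
        have : e (DirectSum.lof O ℤ (fun i => deg' i) i x) = x :=
          DirectSum.coeLinearMap_lof deg' i x
        simp only [LinearMap.comp_apply, LinearEquiv.coe_coe, this, hsec₁]
        exact Finsupp.mapDomain_of_notMem_range _ _ (by simp)
      refine LinearMap.ext fun m => ?_
      have := LinearMap.congr_fun h (e.symm m)
      simpa using this
    exact LinearMap.congr_fun this m
  refine ⟨⟨sec, val, Sum.elim (fun p => p.1) gd, ?_, ?_, ?_⟩, ?_⟩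
  · rintro (⟨i, x⟩ | γ)
    · exact ⟨x.2, zero_mem _⟩
    · exact ⟨zero_mem _, Finsupp.single_mem_supported O 1 rfl⟩
  · rintro i ⟨m, v⟩ ⟨hm, hv⟩ b hb
    lift m to deg' i using hm
    have hs : sec ((m : M'), v) = sec₁ m + v.mapDomain Sum.inr := by simp [sec]
    rw [hs, hsec₁] at hb
    rcases b with ⟨i', x'⟩ | γ
    · rw [Finsupp.add_apply, Finsupp.mapDomain_of_notMem_range v _ (by simp), add_zero,
        ← Finsupp.mem_support_iff] at hb
      obtain ⟨y, -, hy⟩ := Finset.mem_image.1 (Finsupp.mapDomain_support hb)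
      simp only [Sum.inl.injEq, Sigma.mk.injEq] at hy
      exact hy.1.symm
    · rw [Finsupp.add_apply, Finsupp.mapDomain_of_notMem_range (σ i m) _ (by simp), zero_add,
        Finsupp.mapDomain_apply Sum.inr_injective] at hb
      exact hv (Finsupp.mem_support_iff.2 hb)
  · suffices h : (Finsupp.linearCombination O val).comp sec = LinearMap.id from
      fun x => LinearMap.congr_fun h x
    refine LinearMap.prod_ext ?_ (Finsupp.lhom_ext' fun γ => LinearMap.ext_ring ?_)
    · have h : ((Finsupp.linearCombination O val).comp sec₁).comp e.toLinearMap =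
          (LinearMap.inl O M' (Γ →₀ O)).comp e.toLinearMap := by
        refine DirectSum.linearMap_ext O fun i => LinearMap.ext fun x => ?_
        have h1 : e (DirectSum.lof O ℤ (fun i => deg' i) i x) = x :=
          DirectSum.coeLinearMap_lof deg' i x
        simp only [LinearMap.comp_apply, LinearEquiv.coe_coe, h1, hsec₁,
          Finsupp.linearCombination_mapDomain]
        have h2 : Finsupp.linearCombination O
            (val ∘ fun x : deg' i => Sum.inl (⟨i, x⟩ : Σ i, deg' i)) =
            ((LinearMap.inl O M' (Γ →₀ O)).comp (deg' i).subtype).comp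
              (Finsupp.linearCombination O id) := by
          refine Finsupp.lhom_ext' fun y => LinearMap.ext_ring ?_
          simp [val]
        rw [h2, LinearMap.comp_apply, hσ i x]
        rfl
      refine LinearMap.ext fun m => ?_
      have := LinearMap.congr_fun h (e.symm m)
      simpa [sec] using this
    · simp [sec, val]
  · rintro m (⟨i, x⟩ | γ) hb
    · exact ⟨x, rfl⟩
    · have hs : sec (m, 0) = sec₁ m := by simp [sec]
      exact (hb (by rw [hs, hinl])).elim

end ExtendedModule

/-! ### Brackets as functions on lists -/

section ListFun

variable {K O M : Type*} [Field K] [CommRing O] [AddCommGroup M] [Module K M] [Module O M]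

/-- A family of multilinear maps, as a function on lists. -/
def listFun (b : ∀ n, MultilinearMap K (fun _ : Fin n => M) M) (l : List M) : M :=
  b l.length l.get

theorem listFun_ofFn (b : ∀ n, MultilinearMap K (fun _ : Fin n => M) M) {n : ℕ} (x : Fin n → M) :
    listFun b (List.ofFn x) = b n x := by
  have : ∀ (m : ℕ) (e : m = n) (x' : Fin m → M), (∀ i, x' i = x (Fin.cast e i)) →
      b m x' = b n x := by
    rintro m rfl x' h
    rw [show x' = x from funext h]
  exact this _ (by simp) _ fun i => by simp; rfl

theorem ofFn_update_get {α : Type*} (l₁ l₂ : List α) (a x : α) :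
    List.ofFn (Function.update (l₁ ++ a :: l₂).get ⟨l₁.length, by simp⟩ x) = l₁ ++ x :: l₂ := by
  refine List.ext_getElem (by simp; omega) fun i h1 h2 => ?_
  simp only [List.getElem_ofFn, Function.update_apply, Fin.ext_iff]
  rcases lt_trichotomy i l₁.length with h | rfl | h
  · simp [h.ne, List.getElem_append_left h]
  · simp
  · obtain ⟨j, hj⟩ : ∃ j, i - l₁.length = j + 1 := ⟨i - l₁.length - 1, by omega⟩
    simp [h.ne', List.getElem_append_right h.le, hj]

theorem listFun_append_cons (b : ∀ n, MultilinearMap K (fun _ : Fin n => M) M) (l₁ l₂ : List M)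
    (a x : M) : listFun b (l₁ ++ x :: l₂) = b (l₁ ++ a :: l₂).length
      (Function.update (l₁ ++ a :: l₂).get ⟨l₁.length, by simp⟩ x) := by
  rw [← ofFn_update_get l₁ l₂ a x, listFun_ofFn]

theorem listFun_linear (b : ∀ n, MultilinearMap K (fun _ : Fin n => M) M) (l₁ l₂ : List M) :
    IsLinearMap K fun x => listFun b (l₁ ++ x :: l₂) := by
  constructor
  · intro x y
    simp only [listFun_append_cons b l₁ l₂ 0]
    exact (b _).map_update_add _ _ _ _
  · intro k x
    simp only [listFun_append_cons b l₁ l₂ 0]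
    exact (b _).map_update_smul _ _ _ _

theorem exists_ofFn_update {α : Type*} {n : ℕ} (x : Fin n → α) (i : Fin n) :
    ∃ l₁ l₂, l₁.length + l₂.length + 1 = n ∧
      ∀ a, List.ofFn (Function.update x i a) = l₁ ++ a :: l₂ := by
  have hsplit : List.ofFn x = (List.ofFn x).take i ++ x i :: (List.ofFn x).drop (i + 1) := by
    conv_lhs => rw [← List.take_append_drop i (List.ofFn x), List.drop_eq_getElem_cons (by simp)]
    simp
  generalize hl₁ : (List.ofFn x).take i = l₁ at hsplit
  generalize (List.ofFn x).drop (i + 1) = l₂ at hsplit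
  have hlen := congrArg List.length hsplit
  have hi : l₁.length = i := by rw [← hl₁]; simp
  simp only [List.length_ofFn, List.length_append, List.length_cons] at hlen
  refine ⟨l₁, l₂, by omega, fun a => ?_⟩
  have := ofFn_update_get l₁ l₂ (x i) a
  rw [← this]
  have h3 : ∀ (m : ℕ) (e : m = n) (x' : Fin m → α) (j : Fin m), (∀ i, x' i = x (Fin.cast e i)) →
      j.val = i.val → List.ofFn (Function.update x i a) = List.ofFn (Function.update x' j a) := by
    rintro m rfl x' j h hj
    rw [show x' = x from funext h, show j = i from Fin.ext hj]
  refine h3 _ (by simp; omega) _ _ (fun j => ?_) hi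
  simp only [List.get_eq_getElem, ← hsplit]
  simp
  rfl

/-- A function on lists that is linear in each argument, as a family of multilinear maps. -/
def toMultilinear (q : List M → M) (hq : ∀ l₁ l₂, IsLinearMap K fun x => q (l₁ ++ x :: l₂))
    (n : ℕ) : MultilinearMap K (fun _ : Fin n => M) M where
  toFun x := q (List.ofFn x)
  map_update_add' {inst} x i a b := by
    obtain rfl := Subsingleton.elim inst (instDecidableEqFin n)
    obtain ⟨l₁, l₂, -, h⟩ := exists_ofFn_update x i
    simp only [h]
    exact (hq l₁ l₂).map_add a b
  map_update_smul' {inst} x i c a := by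
    obtain rfl := Subsingleton.elim inst (instDecidableEqFin n)
    obtain ⟨l₁, l₂, -, h⟩ := exists_ofFn_update x i
    simp only [h]
    exact (hq l₁ l₂).map_smul c a

theorem toMultilinear_apply (q : List M → M)
    (hq : ∀ l₁ l₂, IsLinearMap K fun x => q (l₁ ++ x :: l₂)) {n : ℕ} (x : Fin n → M) :
    toMultilinear q hq n x = q (List.ofFn x) := rfl

theorem listFun_toMultilinear (q : List M → M)
    (hq : ∀ l₁ l₂, IsLinearMap K fun x => q (l₁ ++ x :: l₂)) :
    listFun (toMultilinear q hq) = q := by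
  funext l
  rw [listFun, toMultilinear_apply, List.ofFn_get]

/-- A sum over shuffles, as it occurs in the higher Jacobi identities and in the definition of a
morphism, in terms of functions on lists. -/
theorem sum_shuffle_bracket {N : Type*} [AddCommGroup N]
    (b : ∀ n, MultilinearMap K (fun _ : Fin n => M) M) (hb : b 0 = 0) (T : List M → N)
    (t : ∀ n, (Fin n → M) → N) (hT : ∀ n x, t n x = T (List.ofFn x)) (hT0 : ∀ l, T (0 :: l) = 0)
    {n : ℕ} (d : Fin n → ℤ) (x : Fin n → M) :
    ∑ I : Finset (Fin n) with I.Nonempty, koszulSign d (shuffleKey I) •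
      t (Iᶜ.card + 1) (Fin.cons (b I.card (sublist x I)) (sublist x Iᶜ) : Fin (Iᶜ.card + 1) → M) =
    splitSum Prod.fst (List.ofFn fun a => (d a, x a)) fun I J =>
      T (listFun b (vals I) :: vals J) := by
  have hv : ∀ I : Finset (Fin n), vals (List.ofFn (sublist (fun a => (d a, x a)) I)) =
      List.ofFn (sublist x I) := fun I => List.map_ofFn
  rw [← sum_shuffle_eq_splitSum, Finset.sum_filter_of_ne]
  · refine Finset.sum_congr rfl fun I _ => ?_
    rw [hv, hv, listFun_ofFn, hT, List.ofFn_cons]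
    rfl
  · intro I _ h
    by_contra hI
    rw [Finset.not_nonempty_iff_eq_empty] at hI
    subst hI
    refine h ?_
    have h0 : b (∅ : Finset (Fin n)).card (sublist x ∅) = 0 := by
      have : ∀ (m : ℕ) (_ : m = 0) (y : Fin m → M), b m y = 0 := by
        rintro m rfl y
        rw [hb]; rfl
      exact this _ Finset.card_empty _
    rw [h0, hT, List.ofFn_cons, hT0, smul_zero]

theorem swapSymm_listFun {deg : ℤ → Submodule O M}
    (b : ∀ n, MultilinearMap K (fun _ : Fin n => M) M)
    (hb : ∀ (n : ℕ) (d : Fin n → ℤ) (x : Fin n → M), (∀ a, x a ∈ deg (d a)) →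
      ∀ σ : Equiv.Perm (Fin n), b n (x ∘ σ) = koszulSign d σ.symm • b n x) :
    SwapSymm deg fun l => listFun b (vals l) := by
  intro l₁ p p' l₂ hl
  have h := homog_append.1 hl
  have h' := homog_cons.1 h.2
  have h'' := homog_cons.1 h'.2
  lift l₁ to List {p : ℤ × M // p.2 ∈ deg p.1} using h.1
  lift l₂ to List {p : ℤ × M // p.2 ∈ deg p.1} using h''.2
  have := swap_symm_of_perm (fun p : {p : ℤ × M // p.2 ∈ deg p.1} => p.1.1)
    (F := fun l => listFun b (vals (l.map Subtype.val))) (fun n y σ => by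
      simp only [vals, List.map_ofFn, listFun_ofFn]
      exact hb n (fun a => (y a).1.1) (fun a => (y a).1.2) (fun a => (y a).2) σ)
    l₁ ⟨p, h'.1⟩ ⟨p', h''.1⟩ l₂
  simpa using this

theorem SwapSymm.perm {deg : ℤ → Submodule O M} {N : Type*} [AddCommGroup N]
    {F : List (ℤ × M) → N} (hF : SwapSymm deg F) {n : ℕ} (d : Fin n → ℤ) (x : Fin n → M)
    (hx : ∀ a, x a ∈ deg (d a)) (σ : Equiv.Perm (Fin n)) :
    F (List.ofFn fun a => (d (σ a), x (σ a))) =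
      koszulSign d σ.symm • F (List.ofFn fun a => (d a, x a)) := by
  have := perm_symm_of_swap (fun p : {p : ℤ × M // p.2 ∈ deg p.1} => p.1.1)
    (F := fun l => F (l.map Subtype.val)) (fun l₁ p p' l₂ => by
      have := hF (l₁.map Subtype.val) p.1 p'.1 (l₂.map Subtype.val) (by
        intro r hr
        simp only [List.mem_append, List.mem_cons, List.mem_map] at hr
        rcases hr with ⟨r', -, rfl⟩ | rfl | rfl | ⟨r', -, rfl⟩
        exacts [r'.2, p.2, p'.2, r'.2])
      simpa using this) (fun a => ⟨(d a, x a), hx a⟩) σ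
  simpa [List.map_ofFn, Function.comp_def] using this

end ListFun

/-! ### Leibniz brackets from covariant derivatives -/

section Connection

variable {K O M B : Type*} [Field K] [CommRing O] [Algebra K O] [AddCommGroup M] [Module O M]
  {deg : ℤ → Submodule O M} (S : GradedDualBasis deg B)

/-- The covariant derivative along the derivation `D` that is given by the dual basis, multiplied by
a sign `ε` that depends on the degree. -/
noncomputable def covDeriv (ε : ℤ → ℤ) (D : Derivation K O O) (x : M) : M :=
  (S.sec x).sum fun b r => ε (S.dg b) • D r • S.val b

theorem covDeriv_add (ε : ℤ → ℤ) (D : Derivation K O O) (x y : M) :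
    covDeriv S ε D (x + y) = covDeriv S ε D x + covDeriv S ε D y := by
  rw [covDeriv, map_add, Finsupp.sum_add_index' (by simp) (by simp [add_smul])]
  rfl

theorem covDeriv_smul [Module K M] [IsScalarTower K O M] (ε : ℤ → ℤ) (D : Derivation K O O) (k : K)
    (x : M) :
    covDeriv S ε D (k • x) = k • covDeriv S ε D x := by
  rw [covDeriv, covDeriv, ← algebraMap_smul O k x, map_smul, Finsupp.sum_smul_index' (by simp),
    Finsupp.smul_sum]
  refine Finsupp.sum_congr fun b _ => ?_
  rw [algebraMap_smul, D.map_smul, smul_assoc]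
  exact smul_comm _ k _

theorem covDeriv_leibniz (D : Derivation K O O) (f : O) (x : M) :
    covDeriv S 1 D (f • x) = D f • x + f • covDeriv S 1 D x := by
  have h : D f • x = (S.sec x).sum fun b r => D f • r • S.val b := by
    conv_lhs => rw [← S.sum_sec x, Finsupp.smul_sum]
  rw [h, covDeriv, covDeriv, map_smul, Finsupp.sum_smul_index' (by simp), Finsupp.smul_sum,
    ← Finsupp.sum_add]
  refine Finsupp.sum_congr fun b _ => ?_
  simp only [Pi.one_apply, one_smul, smul_eq_mul, Derivation.leibniz, add_smul, smul_smul]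
  rw [add_comm, mul_comm (D f)]

theorem covDeriv_add_left (ε : ℤ → ℤ) (D D' : Derivation K O O) (x : M) :
    covDeriv S ε (D + D') x = covDeriv S ε D x + covDeriv S ε D' x := by
  simp [covDeriv, add_smul, Finsupp.sum_add]

theorem covDeriv_smul_left (ε : ℤ → ℤ) (f : O) (D : Derivation K O O) (x : M) :
    covDeriv S ε (f • D) x = f • covDeriv S ε D x := by
  simp only [covDeriv, Finsupp.smul_sum, Derivation.smul_apply, smul_assoc, smul_comm f]

theorem covDeriv_mem (ε : ℤ → ℤ) (D : Derivation K O O) {i : ℤ} {x : M} (hx : x ∈ deg i) :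
    covDeriv S ε D x ∈ deg i := by
  refine Submodule.sum_mem _ fun b hb => zsmul_mem (Submodule.smul_mem _ _ ?_) _
  rw [← S.dg_eq i x hx b (Finsupp.mem_support_iff.1 hb)]
  exact S.val_mem b

theorem covDeriv_sign (ε : ℤ → ℤ) (D : Derivation K O O) {i : ℤ} {x : M} (hx : x ∈ deg i) :
    covDeriv S ε D x = ε i • covDeriv S 1 D x := by
  rw [covDeriv, covDeriv, Finsupp.sum, Finsupp.sum, Finset.smul_sum]
  refine Finset.sum_congr rfl fun b hb => ?_
  rw [S.dg_eq i x hx b (Finsupp.mem_support_iff.1 hb), Pi.one_apply, one_smul]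

/-- An anchored element has degree `-1`, therefore the covariant derivative along its anchor has the
degree of a binary bracket. -/
theorem covDeriv_anchor_mem {S : GradedDualBasis deg B} {ρ : M →ₗ[O] Derivation K O O}
    (hρ : ∀ i, i ≠ -1 → ∀ x ∈ deg i, ρ x = 0) (ε : ℤ → ℤ) {i j : ℤ} {x y : M} (hx : x ∈ deg i)
    (hy : y ∈ deg j) :
    covDeriv S ε (ρ x) y ∈ deg (i + j + 1) := by
  by_cases hi : i = -1
  · rw [hi, show -1 + j + 1 = j by ring]
    exact covDeriv_mem S ε _ hy
  · have h0 : covDeriv S ε (0 : Derivation K O O) y = 0 := by simp [covDeriv]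
    rw [hρ i hi x hx, h0]
    exact zero_mem _

variable [Module K M] [IsScalarTower K O M]

/-- A graded symmetric binary bracket that satisfies the Leibniz rule for the anchor `ρ`, built from
covariant derivatives: `∇_{ρ(x)} y` plus its graded symmetrization. -/
noncomputable def leibnizBracket (ρ : M →ₗ[O] Derivation K O O) : M →ₗ[K] M →ₗ[K] M :=
  have hρ : ∀ (k : K) x, ρ (k • x) = algebraMap K O k • ρ x := fun k x => by
    rw [← map_smul, algebraMap_smul]
  LinearMap.mk₂ K (fun x y => covDeriv S 1 (ρ x) y + covDeriv S esign (ρ y) x)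
    (fun x x' y => by rw [map_add, covDeriv_add_left, covDeriv_add]; abel)
    (fun k x y => by
      rw [hρ, covDeriv_smul_left, covDeriv_smul, algebraMap_smul, smul_add])
    (fun x y y' => by rw [map_add, covDeriv_add_left, covDeriv_add]; abel)
    (fun k x y => by
      rw [hρ, covDeriv_smul_left, covDeriv_smul, algebraMap_smul, smul_add])

theorem leibnizBracket_apply (ρ : M →ₗ[O] Derivation K O O) (x y : M) :
    leibnizBracket S ρ x y = covDeriv S 1 (ρ x) y + covDeriv S esign (ρ y) x := rfl

theorem leibnizBracket_smul (ρ : M →ₗ[O] Derivation K O O) (x y : M) (f : O) :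
    leibnizBracket S ρ x (f • y) = ρ x f • y + f • leibnizBracket S ρ x y := by
  simp only [leibnizBracket_apply, map_smul, covDeriv_smul_left, covDeriv_leibniz, smul_add,
    add_assoc]

variable {S} {ρ : M →ₗ[O] Derivation K O O} (hρ : ∀ i, i ≠ -1 → ∀ x ∈ deg i, ρ x = 0)
include hρ

theorem leibnizBracket_mem {i j : ℤ} {x y : M} (hx : x ∈ deg i) (hy : y ∈ deg j) :
    leibnizBracket S ρ x y ∈ deg (i + j + 1) :=
  add_mem (covDeriv_anchor_mem hρ 1 hx hy)
    (add_comm i j ▸ covDeriv_anchor_mem hρ esign hy hx)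

theorem leibnizBracket_swap {i j : ℤ} {x y : M} (hx : x ∈ deg i) (hy : y ∈ deg j) :
    leibnizBracket S ρ x y = esign (i * j) • leibnizBracket S ρ y x := by
  have h0 : ∀ z, covDeriv S (1 : ℤ → ℤ) (0 : Derivation K O O) z = 0 := by simp [covDeriv]
  rw [leibnizBracket_apply, leibnizBracket_apply, covDeriv_sign S esign _ hx,
    covDeriv_sign S esign _ hy, smul_add, smul_smul, ← esign_add, add_comm]
  congr 1
  · by_cases hj : j = -1
    · rw [hj, esign_eq_of_even (m := i) (n := i * -1) ⟨i, by ring⟩]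
    · rw [hρ j hj y hy, h0, smul_zero, smul_zero]
  · by_cases hi : i = -1
    · rw [hi, esign_eq_of_even (m := -1 * j + j) (n := 0) ⟨0, by ring⟩, esign_zero, one_smul]
    · rw [hρ i hi x hx, h0, smul_zero]

end Connection

section LowArity

variable {K O M : Type*} [Field K] [CommRing O] [AddCommGroup M] [Module K M] [Module O M]

/-- The function on lists that consists of a unary and of a binary operation. -/
def lowArity (φ : M →ₗ[O] M) (β : M →ₗ[K] M →ₗ[K] M) : List M → M
  | [x] => φ x
  | [x, y] => β x y
  | _ => 0

variable {φ : M →ₗ[O] M} {β : M →ₗ[K] M →ₗ[K] M} {deg : ℤ → Submodule O M}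

theorem lowArity_of_length {l : List M} (h1 : l.length ≠ 1) (h2 : l.length ≠ 2) :
    lowArity φ β l = 0 := by
  match l, h1, h2 with
  | [], _, _ => rfl
  | [_], h1, _ => simp at h1
  | [_, _], _, h2 => simp at h2
  | _ :: _ :: _ :: _, _, _ => rfl

theorem lowArity_linear [Algebra K O] [IsScalarTower K O M] (l₁ l₂ : List M) :
    IsLinearMap K fun x => lowArity φ β (l₁ ++ x :: l₂) := by
  match l₁, l₂ with
  | [], [] => exact ⟨φ.map_add, fun k x => by
      change φ (k • x) = k • φ x
      rw [← algebraMap_smul O k x, map_smul, algebraMap_smul]⟩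
  | [], [y] => exact ⟨fun x x' => β.map_add₂ x x' y, fun k x => β.map_smul₂ k x y⟩
  | [y], [] => exact ⟨(β y).map_add, (β y).map_smul⟩
  | [], _ :: _ :: _ => exact ⟨fun _ _ => (add_zero 0).symm, fun k _ => (smul_zero k).symm⟩
  | [_], _ :: _ => exact ⟨fun _ _ => (add_zero 0).symm, fun k _ => (smul_zero k).symm⟩
  | a :: b :: l₁, l₂ =>
    have h : ∀ x, lowArity φ β (a :: b :: l₁ ++ x :: l₂) = 0 := fun x =>
      lowArity_of_length (by simp) (by simp)
    exact ⟨fun _ _ => by simp only [h, add_zero], fun _ _ => by simp only [h, smul_zero]⟩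

theorem lowArity_smul (l₁ l₂ : List M) (f : O) (x : M) (h : l₁.length + l₂.length ≠ 1) :
    lowArity φ β (l₁ ++ (f • x) :: l₂) = f • lowArity φ β (l₁ ++ x :: l₂) := by
  by_cases h0 : l₁.length + l₂.length = 0
  · obtain rfl : l₁ = [] := List.length_eq_zero_iff.1 (by omega)
    obtain rfl : l₂ = [] := List.length_eq_zero_iff.1 (by omega)
    exact φ.map_smul f x
  · rw [lowArity_of_length (by simp; omega) (by simp; omega),
      lowArity_of_length (by simp; omega) (by simp; omega), smul_zero]

theorem lowArity_mem (hφ : ∀ i, ∀ x ∈ deg i, φ x ∈ deg (i + 1))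
    (hβ : ∀ i j, ∀ x ∈ deg i, ∀ y ∈ deg j, β x y ∈ deg (i + j + 1)) {l : List (ℤ × M)}
    (hl : Homog deg l) : lowArity φ β (vals l) ∈ deg (wt Prod.fst l + 1) := by
  match l, hl with
  | [], _ => exact zero_mem _
  | [p], hl =>
    simp only [wt_cons, wt_nil, add_zero]
    exact hφ _ _ (homog_cons.1 hl).1
  | [p, p'], hl =>
    simp only [wt_cons, wt_nil, add_zero]
    exact hβ _ _ _ (homog_cons.1 hl).1 _ (homog_cons.1 (homog_cons.1 hl).2).1
  | _ :: _ :: _ :: _, _ => exact zero_mem _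

theorem lowArity_swap
    (hβ : ∀ i j, ∀ x ∈ deg i, ∀ y ∈ deg j, β x y = esign (i * j) • β y x) :
    SwapSymm deg fun l => lowArity φ β (vals l) := by
  intro l₁ p p' l₂ hl
  by_cases h : l₁.length + l₂.length = 0
  · obtain rfl : l₁ = [] := List.length_eq_zero_iff.1 (by omega)
    obtain rfl : l₂ = [] := List.length_eq_zero_iff.1 (by omega)
    exact hβ _ _ _ (homog_cons.1 hl).1 _ (homog_cons.1 (homog_cons.1 hl).2).1
  · dsimp only
    rw [lowArity_of_length (by simp; omega) (by simp; omega),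
      lowArity_of_length (by simp; omega) (by simp; omega), smul_zero]

end LowArity

/-! ### The brackets of a Lie `∞`-algebroid as functions on lists -/

section Homogeneous

variable {O M N : Type*} [CommRing O] [AddCommGroup M] [Module O M] [AddCommGroup N] [Module O N]

theorem eq_zero_of_homogeneous {deg : ℤ → Submodule O M} (h : DirectSum.IsInternal deg)
    (φ : M →ₗ[O] N) (hφ : ∀ i, ∀ x ∈ deg i, φ x = 0) (x : M) : φ x = 0 := by
  have hle : ⨆ i, deg i ≤ LinearMap.ker φ := iSup_le hφ
  rw [h.submodule_iSup_eq_top] at hle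
  exact hle Submodule.mem_top

end Homogeneous

namespace LieInftyAlgebroid

variable {K O M A : Type*} [Field K] [CommRing O] [Algebra K O]
  [AddCommGroup M] [Module K M] [Module O M] [IsScalarTower K O M] (E : LieInftyAlgebroid K O M)

theorem listFun_singleton (x : M) : listFun E.bracket [x] = E.bracket 1 ![x] :=
  listFun_ofFn E.bracket ![x]

theorem listFun_pair (x y : M) : listFun E.bracket [x, y] = E.bracket 2 ![x, y] :=
  listFun_ofFn E.bracket ![x, y]

/-- The brackets of a Lie `∞`-algebroid, as a function on lists. -/
theorem isLeibnizBracket : IsLeibnizBracket E.deg E.anchor (listFun E.bracket) where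
  nil := by
    have := listFun_ofFn E.bracket ![]
    rw [E.bracket_zero] at this
    exact this
  linear := listFun_linear E.bracket
  mem_deg l hl := by
    obtain ⟨n, y, rfl⟩ : ∃ (n : ℕ) (y : Fin n → ℤ × M), l = List.ofFn y :=
      ⟨_, l.get, (List.ofFn_get l).symm⟩
    rw [vals, List.map_ofFn, listFun_ofFn, wt, List.map_ofFn, List.sum_ofFn]
    exact E.bracket_mem_deg n _ _ fun a => hl (y a) (List.mem_ofFn.2 ⟨a, rfl⟩)
  swap := swapSymm_listFun E.bracket E.bracket_symm
  smul l₁ l₂ f x h := by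
    rw [listFun_append_cons _ l₁ l₂ x, listFun]
    have := E.bracket_smul (l₁ ++ x :: l₂).length (by simp; omega) (l₁ ++ x :: l₂).get
      ⟨l₁.length, by simp⟩ f
    rwa [show (l₁ ++ x :: l₂).get ⟨l₁.length, by simp⟩ = x by simp] at this
  leibniz x y f := by
    rw [E.listFun_pair, E.listFun_pair]
    exact E.leibniz x y f
  deg_eq_bot := E.deg_eq_bot
  anchor_eq_zero := E.anchor_eq_zero

theorem jac_eq_zero {l : List (ℤ × M)} (hl : Homog E.deg l) : jac (listFun E.bracket) l = 0 := by
  obtain ⟨n, y, rfl⟩ : ∃ (n : ℕ) (y : Fin n → ℤ × M), l = List.ofFn y :=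
    ⟨_, l.get, (List.ofFn_get l).symm⟩
  rw [jac, ← sum_shuffle_bracket E.bracket E.bracket_zero (listFun E.bracket)
    (fun n => E.bracket n) (fun n x => (listFun_ofFn E.bracket x).symm)
    E.isLeibnizBracket.zero_cons (fun a => (y a).1) fun a => (y a).2]
  exact E.jacobi n _ _ fun a => hl (y a) (List.mem_ofFn.2 ⟨a, rfl⟩)

/-- The differential, as an `O`-linear map. -/
def differential : M →ₗ[O] M where
  toFun x := listFun E.bracket [x]
  map_add' x y := E.isLeibnizBracket.map_add x y []
  map_smul' f x := E.isLeibnizBracket.smul [] [] f x (by simp)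

theorem differential_mem {i : ℤ} {x : M} (hx : x ∈ E.deg i) : E.differential x ∈ E.deg (i + 1) := by
  have := E.isLeibnizBracket.mem_deg [(i, x)] (by simpa [homog_nil] using hx)
  change listFun E.bracket [x] ∈ _
  simpa using this

theorem differential_comp (x : M) : E.differential (E.differential x) = 0 := by
  refine eq_zero_of_homogeneous E.isInternal (E.differential ∘ₗ E.differential)
    (fun i x hx => ?_) x
  have h := E.jac_eq_zero (l := [(i, x)]) (by simpa [homog_nil] using hx)
  rw [IsGradedBracket.jac_cons] at h
  change listFun E.bracket [listFun E.bracket [x]] = 0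
  simpa [E.isLeibnizBracket.nil, E.isLeibnizBracket.zero_cons] using h

variable {E} [LieRing A] [LieAlgebra K A] [Module O A] [LieRingModule A O] [LieRinehartRing O A]
  [LieRinehartAlgebra K O A] {π : M →ₗ[O] A}

theorem IsHook.hook_differential_eq_zero (h : E.IsHook π) (x : M) : π (E.differential x) = 0 := by
  refine eq_zero_of_homogeneous E.isInternal (π ∘ₗ E.differential) (fun i x hx => ?_) x
  by_cases hi : i = -2
  · subst hi
    rw [LinearMap.comp_apply, ← h.hook_differential x hx, ← E.listFun_singleton]
    rfl
  · exact h.eq_zero (i + 1) (by omega) _ (E.differential_mem hx)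

/-- The anchor is determined by the hook. -/
theorem IsHook.anchorVia_eq (h : E.IsHook π) (x : M) : anchorVia K π x = E.anchor x := by
  refine sub_eq_zero.1 (eq_zero_of_homogeneous E.isInternal (anchorVia K π - E.anchor)
    (fun i x hx => ?_) x)
  rw [LinearMap.sub_apply, sub_eq_zero]
  by_cases hi : i = -1
  · subst hi
    exact h.anchor_hook x hx
  · rw [E.anchor_eq_zero i hi x hx]
    change LieRinehartAlgebra.anchor K O A (π x) = 0
    rw [h.eq_zero i hi x hx]
    exact (anchorVia K (LinearMap.id (R := O) (M := A))).map_zero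

end LieInftyAlgebroid

/-! ### Initial brackets on the resolution -/

section Extension

variable {K O M' F : Type*} [Field K] [CommRing O] [AddCommGroup M'] [Module K M'] [Module O M']
  [AddCommGroup F] [Module K F] [Module O F]

/-- The linear map `d`, minus the linear map that it induces on the summand `M'`. -/
def reducedLinear (d : M' × F →ₗ[O] M' × F) : M' × F →ₗ[O] M' × F :=
  d - LinearMap.inl O M' F ∘ₗ LinearMap.fst O M' F ∘ₗ d ∘ₗ LinearMap.inl O M' F ∘ₗ
    LinearMap.fst O M' F

/-- The bilinear map `β`, minus its restriction to the summand `M'`. -/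
def reducedBilinear (β : M' × F →ₗ[K] M' × F →ₗ[K] M' × F) : M' × F →ₗ[K] M' × F →ₗ[K] M' × F :=
  β - β.compl₁₂ (LinearMap.inl K M' F ∘ₗ LinearMap.fst K M' F)
    (LinearMap.inl K M' F ∘ₗ LinearMap.fst K M' F)

theorem reducedLinear_apply (d : M' × F →ₗ[O] M' × F) (x : M' × F) :
    reducedLinear d x = d x - ((d (x.1, 0)).1, 0) := rfl

theorem reducedBilinear_apply (β : M' × F →ₗ[K] M' × F →ₗ[K] M' × F) (x y : M' × F) :
    reducedBilinear β x y = β x y - β (x.1, 0) (y.1, 0) := rfl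

/-- The function on lists in `M' × F` that is given by the function `q'` on the components in `M'`,
and by the parts of `d` and `β` that do not come from `M'`. On `M'`, it restricts to `q'`. -/
def extBracket (q' : List M' → M') (d : M' × F →ₗ[O] M' × F)
    (β : M' × F →ₗ[K] M' × F →ₗ[K] M' × F) (l : List (M' × F)) : M' × F :=
  (q' (l.map Prod.fst), 0) + lowArity (reducedLinear d) (reducedBilinear β) l

variable {q' : List M' → M'} {d : M' × F →ₗ[O] M' × F} {β : M' × F →ₗ[K] M' × F →ₗ[K] M' × F}

theorem extBracket_singleton (hd : ∀ m, d (m, 0) = (q' [m], 0)) (x : M' × F) :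
    extBracket q' d β [x] = d x := by
  simp [extBracket, lowArity, reducedLinear_apply, hd]

theorem extBracket_pair (x y : M' × F) :
    extBracket q' d β [x, y] = (q' [x.1, y.1], 0) + (β x y - β (x.1, 0) (y.1, 0)) := rfl

theorem extBracket_inl (hd : ∀ m, d (m, 0) = (q' [m], 0)) (l : List M') :
    extBracket q' d β (l.map fun m => (m, 0)) = (q' l, 0) := by
  have h : lowArity (reducedLinear d) (reducedBilinear β) (l.map fun m => (m, (0 : F))) = 0 := by
    match l with
    | [] => rfl
    | [x] => simp [lowArity, reducedLinear_apply, hd]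
    | [x, y] => simp [lowArity, reducedBilinear_apply]
    | _ :: _ :: _ :: _ => rfl
  rw [extBracket, h, add_zero, List.map_map]
  simp [Function.comp_def]

end Extension

section Partial

open LieInftyAlgebroid

variable {K O M' A Γ : Type*} [Field K] [CommRing O] [Algebra K O]
  [AddCommGroup M'] [Module K M'] [Module O M'] [IsScalarTower K O M']
  [LieRing A] [LieAlgebra K A] [Module O A] [LieRingModule A O] [LieRinehartRing O A]
  [LieRinehartAlgebra K O A] {E : LieInftyAlgebroid K O M'} {π' : M' →ₗ[O] A}
  {gd : Γ → ℤ} {d : M' × (Γ →₀ O) →ₗ[O] M' × (Γ →₀ O)} {π : M' × (Γ →₀ O) →ₗ[O] A}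
  {B : Type*}

/-- The initial brackets satisfy the Leibniz rule for the anchor that is induced by `A`, as both the
brackets of `E` and the binary bracket built from covariant derivatives do. -/
theorem isLeibnizBracket_extBracket (hE : E.IsHook π') (S : GradedDualBasis (extDeg E.deg gd) B)
    (hgd : ∀ γ, gd γ < 0)
    (hπ' : ∀ m, π (m, 0) = π' m)
    (hdeg : ∀ i, ∀ x ∈ extDeg E.deg gd i, d x ∈ extDeg E.deg gd (i + 1))
    (hπ : ∀ i, i ≠ -1 → ∀ x ∈ extDeg E.deg gd i, π x = 0) :
    IsLeibnizBracket (extDeg E.deg gd) (anchorVia K π)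
      (extBracket (listFun E.bracket) d (leibnizBracket S (anchorVia K π))) := by
  have hρ : ∀ i, i ≠ -1 → ∀ x ∈ extDeg E.deg gd i, anchorVia K π x = 0 := fun i hi x hx => by
    change LieRinehartAlgebra.anchor K O A (π x) = 0
    rw [hπ i hi x hx]
    exact (anchorVia K (LinearMap.id (R := O) (M := A))).map_zero
  have hp : ∀ {i : ℤ} {x : M' × (Γ →₀ O)}, x ∈ extDeg E.deg gd i → (x.1, 0) ∈ extDeg E.deg gd i :=
    fun hx => ⟨hx.1, zero_mem _⟩
  have hfst : ∀ {l : List (ℤ × (M' × (Γ →₀ O)))}, Homog (extDeg E.deg gd) l →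
      Homog E.deg (l.map fun p => (p.1, p.2.1)) := fun hl p hp => by
    obtain ⟨p', hp', rfl⟩ := List.mem_map.1 hp
    exact (hl p' hp').1
  have hvals : ∀ l : List (ℤ × (M' × (Γ →₀ O))),
      (vals l).map Prod.fst = vals (l.map fun p => (p.1, p.2.1)) := fun l => by
    simp [vals, Function.comp_def]
  have hE' := E.isLeibnizBracket
  refine
    { nil := ?_, linear := fun l₁ l₂ => ?_, mem_deg := fun l hl => ?_,
      swap := fun l₁ a b l₂ hl => ?_, smul := fun l₁ l₂ f x h => ?_, leibniz := fun x y f => ?_,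
      deg_eq_bot := extDeg_eq_bot E.deg_eq_bot hgd, anchor_eq_zero := hρ }
  · simp only [extBracket, List.map_nil, hE'.nil, lowArity]
    exact add_zero _
  · have h1 := hE'.linear (l₁.map Prod.fst) (l₂.map Prod.fst)
    constructor
    · intro x y
      simp only [extBracket, List.map_append, List.map_cons, Prod.fst_add, h1.map_add,
        (lowArity_linear l₁ l₂).map_add]
      rw [← add_zero (0 : Γ →₀ O), ← Prod.mk_add_mk, add_zero]
      abel
    · intro k x
      simp only [extBracket, List.map_append, List.map_cons, Prod.smul_fst, h1.map_smul,
        (lowArity_linear l₁ l₂).map_smul, smul_add, Prod.smul_mk, smul_zero]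
  · have h1 := hE'.mem_deg _ (hfst hl)
    have h2 := lowArity_mem (φ := reducedLinear d)
      (β := reducedBilinear (leibnizBracket S (anchorVia K π))) (deg := extDeg E.deg gd)
      (fun i x hx => by
        rw [reducedLinear_apply]
        exact sub_mem (hdeg i x hx) (hp (hdeg i _ (hp hx))))
      (fun i j x hx y hy => by
        rw [reducedBilinear_apply]
        exact sub_mem (leibnizBracket_mem hρ hx hy) (leibnizBracket_mem hρ (hp hx) (hp hy))) hl
    have h3 : wt Prod.fst (l.map fun p => (p.1, p.2.1)) = wt Prod.fst l := by
      simp [wt, Function.comp_def]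
    rw [h3] at h1
    rw [extBracket, hvals]
    exact add_mem ⟨h1, zero_mem _⟩ h2
  · have h1 := hE'.swap (l₁.map fun p => (p.1, p.2.1)) (a.1, a.2.1) (b.1, b.2.1)
      (l₂.map fun p => (p.1, p.2.1)) (by
        have := hfst hl
        rwa [List.map_append, List.map_cons, List.map_cons] at this)
    have h2 := lowArity_swap (φ := reducedLinear d)
      (β := reducedBilinear (leibnizBracket S (anchorVia K π))) (deg := extDeg E.deg gd)
      (fun i j x hx y hy => by
        rw [reducedBilinear_apply, reducedBilinear_apply, leibnizBracket_swap hρ hx hy,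
          leibnizBracket_swap hρ (hp hx) (hp hy), smul_sub]) l₁ a b l₂ hl
    dsimp only at h1 h2 ⊢
    rw [extBracket, extBracket, smul_add, h2, hvals, hvals, List.map_append, List.map_append,
      List.map_cons, List.map_cons, List.map_cons, List.map_cons, h1]
    congr 1
    exact Prod.ext rfl (smul_zero _).symm
  · have h1 := hE'.smul (l₁.map Prod.fst) (l₂.map Prod.fst) f x.1 (by simpa using h)
    simp only [extBracket, List.map_append, List.map_cons, Prod.smul_fst, h1,
      lowArity_smul l₁ l₂ f x h, smul_add, Prod.smul_mk, smul_zero]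
  · have h1 := hE'.leibniz x.1 y.1 f
    have h2 : anchorVia K π (x.1, 0) = E.anchor x.1 := by
      rw [← hE.anchorVia_eq]
      change LieRinehartAlgebra.anchor K O A (π (x.1, 0)) = _
      rw [hπ']
      rfl
    have h3 : ((f • y).1, (0 : Γ →₀ O)) = f • (y.1, (0 : Γ →₀ O)) := by simp
    simp only [extBracket_pair]
    rw [h3, leibnizBracket_smul, leibnizBracket_smul, h2, Prod.smul_fst, h1]
    simp only [smul_add, smul_sub, Prod.smul_mk, smul_zero]
    rw [← add_zero (0 : Γ →₀ O), ← Prod.mk_add_mk, add_zero]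
    abel

/-- The initial brackets on the resolution restrict to the brackets of `E`, hence satisfy the higher
Jacobi identities there. -/
theorem isPartialBracket_extBracket (hE : E.IsHook π') (S : GradedDualBasis (extDeg E.deg gd) B)
    (hS : ∀ m b, S.sec (m, 0) b ≠ 0 → ∃ m', S.val b = (m', 0))
    (hgd : ∀ γ, gd γ < 0) (hd : ∀ m, d (m, 0) = (E.differential m, 0))
    (hπ' : ∀ m, π (m, 0) = π' m)
    (hdeg : ∀ i, ∀ x ∈ extDeg E.deg gd i, d x ∈ extDeg E.deg gd (i + 1))
    (hdd : ∀ x, d (d x) = 0) (hπd : ∀ x, π (d x) = 0)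
    (hπ : ∀ i, i ≠ -1 → ∀ x ∈ extDeg E.deg gd i, π x = 0)
    (hsurj : ∀ a : A, ∃ x ∈ extDeg E.deg gd (-1), π x = a)
    (hex : ∀ x ∈ extDeg E.deg gd (-1), π x = 0 → ∃ y ∈ extDeg E.deg gd (-2), d y = x)
    (hex' : ∀ i, i ≤ -2 → ∀ x ∈ extDeg E.deg gd i, d x = 0 →
      ∃ y ∈ extDeg E.deg gd (i - 1), d y = x) :
    IsPartialBracket K S (LinearMap.range (LinearMap.inl O M' (Γ →₀ O))) π
      (extBracket (listFun E.bracket) d (leibnizBracket S (anchorVia K π))) := by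
  have hsingle := extBracket_singleton (q' := listFun E.bracket) (d := d)
    (β := leibnizBracket S (anchorVia K π)) hd
  have hinl := extBracket_inl (q' := listFun E.bracket) (d := d)
    (β := leibnizBracket S (anchorVia K π)) hd
  have hlist : ∀ l : List (M' × (Γ →₀ O)),
      (∀ x ∈ l, x ∈ LinearMap.range (LinearMap.inl O M' (Γ →₀ O))) →
        l = (l.map Prod.fst).map fun m => (m, 0) := fun l hl => by
    rw [List.map_map]
    refine (List.map_id l).symm.trans (List.map_congr_left fun x hx => ?_)
    obtain ⟨m, rfl⟩ := hl x hx
    rfl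
  refine
    { toIsLeibnizBracket := isLeibnizBracket_extBracket hE S hgd hπ' hdeg hπ
      hook_eq_zero := hπ
      hook_differential := fun x => by rw [hsingle, hπd]
      differential_comp := fun x => by rw [hsingle, hsingle, hdd]
      surjective := hsurj
      exact_hook := by simpa only [hsingle] using hex
      exact_differential := by simpa only [hsingle] using hex'
      sec_mem := ?_, bracket_mem := fun l hl => ?_, hook_bracket := ?_,
      jac_eq_zero := fun l hl hl₀ => ?_ }
  · rintro _ ⟨m, rfl⟩ b hb
    obtain ⟨m', hm'⟩ := hS m b hb
    exact ⟨m', hm'.symm⟩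
  · rw [hlist l hl, hinl]
    exact ⟨_, rfl⟩
  · rintro _ ⟨m, rfl⟩ _ ⟨m', rfl⟩ hm hm'
    have h := hinl [m, m']
    simp only [List.map_cons, List.map_nil] at h
    simp only [LinearMap.inl_apply]
    rw [h, hπ', hπ', hπ', E.listFun_pair]
    exact hE.hook_bracket m hm.1 m' hm'.1
  · have h := E.jac_eq_zero (l := l.map fun p => (p.1, p.2.1)) fun p hp => by
      obtain ⟨p', hp', rfl⟩ := List.mem_map.1 hp
      exact (hl p' hp').1
    rw [jac, splitSum_map] at h
    have h' := congrArg (LinearMap.inl O M' (Γ →₀ O)).toAddMonoidHom h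
    rw [map_splitSum, map_zero] at h'
    rw [← h', jac]
    refine splitSum_congr _ fun I J hIJ => ?_
    have hm : ∀ x ∈ vals I ++ vals J, x ∈ LinearMap.range (LinearMap.inl O M' (Γ →₀ O)) :=
      fun x hx => hl₀ x (by
        rw [← List.map_append] at hx
        exact (hIJ.map Prod.snd).mem_iff.1 hx)
    rw [hlist (vals I) fun x hx => hm x (List.mem_append_left _ hx),
      hlist (vals J) fun x hx => hm x (List.mem_append_right _ hx), hinl,
      ← List.map_cons (f := fun m : M' => (m, (0 : Γ →₀ O))), hinl]
    simp [vals, Function.comp_def]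

end Partial

/-! ### Lie `∞`-algebroids from functions on lists -/

namespace LieInftyAlgebroid

section OfList

variable {K O M : Type*} [Field K] [CommRing O] [Algebra K O]
  [AddCommGroup M] [Module K M] [Module O M] [IsScalarTower K O M] {deg : ℤ → Submodule O M}
  {ρ : M →ₗ[O] Derivation K O O} {q : List M → M}

/-- The Lie `∞`-algebroid with the brackets that are given by a function on lists. -/
def ofList (hq : IsAnchoredBracket deg ρ q) (hint : DirectSum.IsInternal deg)
    (hproj : ∀ i, Module.Projective O (deg i)) (hjac : ∀ l, Homog deg l → jac q l = 0) :
    LieInftyAlgebroid K O M where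
  deg := deg
  isInternal := hint
  deg_eq_bot := hq.deg_eq_bot
  projective := hproj
  bracket := toMultilinear q hq.linear
  bracket_zero := MultilinearMap.ext fun x => by
    rw [toMultilinear_apply, List.ofFn_zero, hq.nil]
    rfl
  bracket_mem_deg n d x hx := by
    have h := hq.mem_deg (List.ofFn fun a => (d a, x a)) fun p hp => by
      obtain ⟨a, rfl⟩ := List.mem_ofFn.1 hp
      exact hx a
    rw [vals, List.map_ofFn, wt, List.map_ofFn, List.sum_ofFn] at h
    exact h
  bracket_symm n d x hx σ := by
    have h := hq.swap.perm d x hx σ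
    simp only [vals, List.map_ofFn] at h
    exact h
  anchor := ρ
  anchor_eq_zero := hq.anchor_eq_zero
  jacobi n d x hx := by
    have h0 : toMultilinear q hq.linear 0 = 0 := MultilinearMap.ext fun x => by
      rw [toMultilinear_apply, List.ofFn_zero, hq.nil]
      rfl
    rw [sum_shuffle_bracket (toMultilinear q hq.linear) h0 q
      (fun n => toMultilinear q hq.linear n) (fun n x => rfl) hq.zero_cons d x,
      listFun_toMultilinear]
    refine hjac _ fun p hp => ?_
    obtain ⟨a, rfl⟩ := List.mem_ofFn.1 hp
    exact hx a
  bracket_smul n hn x a f := by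
    obtain ⟨l₁, l₂, hl, h⟩ := exists_ofFn_update x a
    have h1 := h (x a)
    rw [Function.update_eq_self] at h1
    rw [toMultilinear_apply, toMultilinear_apply, h, h1]
    exact hq.smul l₁ l₂ f (x a) (by omega)
  leibniz := hq.leibniz
  anchor_differential x _ := hq.anchor_differential x
  anchor_bracket := hq.anchor_bracket

end OfList

/-! ### Strict morphisms -/

section Strict

variable {K O M' M : Type*} [Field K] [CommRing O] [Algebra K O]
  [AddCommGroup M'] [Module K M'] [Module O M'] [IsScalarTower K O M']
  [AddCommGroup M] [Module K M] [Module O M] [IsScalarTower K O M]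

/-- The Taylor coefficients of a strict morphism. -/
def strictTaylor (ι : M' →ₗ[O] M) : ∀ n, MultilinearMap O (fun _ : Fin n => M') M
  | 1 => MultilinearMap.ofSubsingleton O M' M 0 ι
  | _ => 0

theorem strictTaylor_of_ne (ι : M' →ₗ[O] M) {n : ℕ} (hn : n ≠ 1) : strictTaylor ι n = 0 := by
  match n, hn with
  | 0, _ => rfl
  | _ + 2, _ => rfl

theorem strictTaylor_of_eq (ι : M' →ₗ[O] M) {n : ℕ} (hn : n = 1) (x : Fin n → M') :
    strictTaylor ι n x = ι (x ⟨0, by omega⟩) := by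
  subst hn
  rfl

theorem block_id {n : ℕ} (b : Fin n) : block (id : Fin n → Fin n) b = {b} := by
  ext j
  simp [block]

theorem id_mem_setPartitions (n : ℕ) : (id : Fin n → Fin n) ∈ setPartitions n n := by
  simp only [setPartitions, Finset.mem_filter, Finset.mem_univ, true_and]
  exact ⟨Function.surjective_id, fun j b hb => ⟨b, hb, rfl⟩⟩

/-- The only partition of `{0, …, n-1}` into blocks with one element is encoded by the identity. -/
theorem eq_id_of_card_block {n k : ℕ} {c : Fin n → Fin k} (hc : c ∈ setPartitions n k)
    (h : ∀ b, (block c b).card = 1) : ∃ e : k = n, Fin.cast e ∘ c = id := by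
  simp only [setPartitions, Finset.mem_filter, Finset.mem_univ, true_and] at hc
  have hinj : Function.Injective c := fun i j hij => by
    refine Finset.card_le_one.1 (h (c j)).le i ?_ j ?_ <;> simp [block, hij]
  obtain rfl : n = k := by
    simpa using Fintype.card_of_bijective ⟨hinj, hc.1⟩
  refine ⟨rfl, ?_⟩
  have hmono : StrictMono c := fun i j hij => by
    by_contra hji
    obtain ⟨i', hi', e⟩ := hc.2 i (c j) (lt_of_le_of_ne (not_lt.1 hji) fun e => hij.ne' (hinj e))
    rw [hinj e] at hi'
    exact hi'.asymm hij
  exact hmono.eq_id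

/-- A linear map that commutes with all brackets is a strict morphism. On the side of the brackets
of `E`, only the partition into one-element blocks contributes, and on the side of the brackets of
`E'`, only the shuffle that moves all arguments into the inner bracket. -/
theorem exists_strict_morphism (E' : LieInftyAlgebroid K O M') (E : LieInftyAlgebroid K O M)
    (ι : M' →ₗ[O] M) (hdeg : ∀ i, ∀ x ∈ E'.deg i, ι x ∈ E.deg i)
    (hι : ∀ (n : ℕ) (x : Fin n → M'), ι (E'.bracket n x) = E.bracket n fun a => ι (x a))
    (hanchor : ∀ x, E.anchor (ι x) = E'.anchor x) : ∃ Φ : Morphism E' E, Φ.IsStrict ι := by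
  refine ⟨⟨strictTaylor ι, rfl, fun n d x hx => ?_, fun n d x hx σ => ?_, fun n d x hx => ?_,
    fun x _ => hanchor x⟩, fun x => rfl, fun n hn => strictTaylor_of_ne ι hn⟩
  · by_cases hn : n = 1
    · subst hn
      rw [Fin.sum_univ_one]
      exact hdeg _ _ (hx 0)
    · rw [strictTaylor_of_ne ι hn]
      exact zero_mem _
  · by_cases hn : n = 1
    · subst hn
      obtain rfl : σ = 1 := Subsingleton.elim _ _
      exact ((congrArg (· • _) (koszulSign_id d)).trans (one_smul ℤ _)).symm
    · rw [strictTaylor_of_ne ι hn]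
      exact (smul_zero _).symm
  · let T : List M' → M := fun l => match l with
      | [y] => ι y
      | _ => 0
    have hT : ∀ n (x : Fin n → M'), strictTaylor ι n x = T (List.ofFn x) := by
      intro n x
      match n with
      | 0 => rfl
      | 1 => rfl
      | n + 2 => simp only [List.ofFn_succ]; rfl
    have hT0 : ∀ l, T (0 :: l) = 0 := by
      intro l
      match l with
      | [] => exact ι.map_zero
      | _ :: _ => rfl
    rw [sum_shuffle_bracket E'.bracket E'.bracket_zero T (fun n => strictTaylor ι n) hT hT0,
      splitSum_eq_right_nil]
    swap
    · intro I J _ hJ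
      match J, hJ with
      | _ :: _, _ => rfl
    have hL : T (listFun E'.bracket (vals (List.ofFn fun a => (d a, x a))) :: vals []) =
        E.bracket n fun a => ι (x a) := by
      rw [← hι, vals, List.map_ofFn, listFun_ofFn]
      rfl
    rw [hL]
    have hzero : ∀ k, ∀ c ∈ setPartitions n k, (¬∃ e : k = n, Fin.cast e ∘ c = id) →
        (koszulSign d c •
          E.bracket k fun b => strictTaylor ι (block c b).card (sublist x (block c b))) = 0 := by
      intro k c hc h
      obtain ⟨b, hb⟩ : ∃ b, (block c b).card ≠ 1 := by
        by_contra! h'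
        exact h (eq_id_of_card_block hc h')
      rw [(E.bracket k).map_coord_zero b (by rw [strictTaylor_of_ne ι hb]; rfl), smul_zero]
    by_cases hn : n = 0
    · subst hn
      rw [E.bracket_zero]
      rfl
    · rw [Finset.sum_eq_single n, Finset.sum_eq_single id]
      · rw [koszulSign_id, one_smul]
        congr 1
        funext b
        have hb : (block id b).card = 1 := by rw [block_id, Finset.card_singleton]
        rw [strictTaylor_of_eq ι hb]
        have := Finset.orderEmbOfFin_mem (block id b) rfl ⟨0, by omega⟩
        exact congrArg (fun j => ι (x j)) (Finset.mem_filter.1 this).2.symm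
      · exact fun c hc h => hzero n c hc fun ⟨_, h'⟩ => h h'
      · exact fun h => (h (id_mem_setPartitions n)).elim
      · exact fun k _ h => Finset.sum_eq_zero fun c hc => hzero k c hc fun ⟨e, _⟩ => h e
      · intro h
        exact (h (Finset.mem_Icc.2 ⟨by omega, le_rfl⟩)).elim

end Strict

end LieInftyAlgebroid

/-! ### Extension to a universal Lie `∞`-algebroid -/

theorem mainTheorem6 {K : Type*} {O : Type u} {A : Type v} {M' : Type w}
    [Field K] [CharZero K] [CommRing O] [Algebra K O]
    [LieRing A] [LieAlgebra K A] [Module O A] [LieRingModule A O] [LieRinehartRing O A]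
    [LieRinehartAlgebra K O A]
    [AddCommGroup M'] [Module K M'] [Module O M'] [IsScalarTower K O M']
    (E' : LieInftyAlgebroid K O M') (π' : M' →ₗ[O] A) (hπ' : E'.IsHook π') :
    ∃ (M : Type (max u v w)) (_ : AddCommGroup M) (_ : Module K M) (_ : Module O M)
      (_ : IsScalarTower K O M) (E : LieInftyAlgebroid K O M) (π : M →ₗ[O] A)
      (ι : M' →ₗ[O] M),
      E.IsUniversal π ∧
      LieInftyAlgebroid.IsSubcomplexInclusion E' π' E π ι ∧
      LieInftyAlgebroid.IsGradedDirectSummand E' E ι ∧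
      ∃ Φ : LieInftyAlgebroid.Morphism E' E, Φ.IsOver π' π ∧ Φ.IsStrict ι := by
  obtain ⟨Γ, gd, d, π, hgd, hd, hππ', hdeg, hdd, hπd, hπ, hsurj, hex, hex'⟩ :=
    exists_resolution.{u, v, w} E'.deg E'.differential π' E'.deg_eq_bot
      (fun i x hx => E'.differential_mem hx) E'.differential_comp hπ'.eq_zero
      hπ'.hook_differential_eq_zero
  obtain ⟨S, hS⟩ := exists_gradedDualBasis (gd := gd) E'.isInternal E'.projective
  have hq := isPartialBracket_extBracket hπ' S hS hgd hd hππ' hdeg hdd hπd hπ hsurj hex hex'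
  obtain ⟨g, hg, hhook, hjac⟩ := hq.exists_correction
  have hq' := hq.corrected hg
  have hsingle : ∀ x, corrected S (extBracket (listFun E'.bracket) d
      (leibnizBracket S (anchorVia K π))) g [x] = d x := fun x => by
    rw [hg.corrected_singleton]
    exact extBracket_singleton hd x
  -- The corrections do not affect the brackets of elements of `E'`.
  have hinl : ∀ l : List M', corrected S (extBracket (listFun E'.bracket) d
      (leibnizBracket S (anchorVia K π))) g (l.map (LinearMap.inl O M' (Γ →₀ O))) =
      LinearMap.inl O M' (Γ →₀ O) (listFun E'.bracket l) := fun l => by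
    rw [hg.corrected_of_mem hq.sec_mem]
    · exact extBracket_inl hd l
    · intro x hx
      obtain ⟨m, -, rfl⟩ := List.mem_map.1 hx
      exact ⟨m, rfl⟩
  let E : LieInftyAlgebroid K O (M' × (Γ →₀ O)) :=
    LieInftyAlgebroid.ofList (hq'.isAnchoredBracket hhook)
      (extDeg_isInternal E'.isInternal) (extDeg_projective E'.projective) hjac
  have hE1 : ∀ x, E.bracket 1 ![x] = d x := hsingle
  have hdeg' : ∀ i, ∀ x ∈ E'.deg i, LinearMap.inl O M' (Γ →₀ O) x ∈ E.deg i :=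
    fun i x hx => ⟨hx, zero_mem _⟩
  have hanchor : ∀ x, E.anchor (LinearMap.inl O M' (Γ →₀ O) x) = E'.anchor x := fun x => by
    rw [← hπ'.anchorVia_eq]
    change LieRinehartAlgebra.anchor K O A (π (x, 0)) = _
    rw [hππ']
    rfl
  refine ⟨M' × (Γ →₀ O), inferInstance, inferInstance, inferInstance, inferInstance, E, π,
    LinearMap.inl O M' (Γ →₀ O), ?_, ?_, ?_, ?_⟩
  · exact
      { isHook :=
          { eq_zero := hπ
            anchor_hook := fun x _ => rfl
            hook_bracket := hhook
            hook_differential := fun x _ => by rw [hE1, hπd] }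
        surjective := hsurj
        exact_hook := by
          simp only [hE1]
          exact hex
        exact_differential := by
          simp only [hE1]
          exact hex' }
  · exact
      { injective := LinearMap.inl_injective
        map_deg := hdeg'
        map_differential := fun x => by
          rw [hE1, ← E'.listFun_singleton]
          exact (hd x).symm
        hook_comp := hππ' }
  · refine ⟨fun i => (⊥ : Submodule O M').prod (Finsupp.supported O O {γ | gd γ = i}), fun i =>
      ⟨eq_bot_iff.2 ?_, le_antisymm (sup_le ?_ ?_) ?_⟩⟩
    · rintro x ⟨⟨m, -, rfl⟩, h, -⟩
      exact Prod.ext h rfl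
    · rintro _ ⟨m, hm, rfl⟩
      exact hdeg' i m hm
    · rintro x ⟨h, h'⟩
      exact ⟨(show x.1 = 0 from h) ▸ zero_mem (E'.deg i), h'⟩
    · rintro ⟨m, v⟩ ⟨hm, hv⟩
      rw [show (m, v) = LinearMap.inl O M' (Γ →₀ O) m + (0, v) by simp]
      exact Submodule.add_mem_sup ⟨m, hm, rfl⟩ ⟨zero_mem _, hv⟩
  · obtain ⟨Φ, hΦ⟩ := LieInftyAlgebroid.exists_strict_morphism E' E
      (LinearMap.inl O M' (Γ →₀ O)) hdeg'
      (fun n x => by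
        rw [← listFun_ofFn E'.bracket, ← hinl, List.map_ofFn]
        rfl) hanchor
    exact ⟨Φ, fun x _ => by rw [hΦ.1 x]; exact hππ' x, hΦ⟩
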